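/- **Setting.** Positions in strings start at $1$, and $T[i:j]$ is the substring of $T$ from position $i$ to position $j$ (empty if $j<i$). For a nonempty string $P$ let $\mathrm{Occ}(T,P)=\{k\ge 1 : T[k:k+|P|-1]=P\}$, and let $\mathrm{nOcc}(T,P)$ be the largest size of a subset of $\mathrm{Occ}(T,P)$ in which any two elements $k_1<k_2$ satisfy $k_1+|P|-1<k_2$. Let $\mathrm{LnOcc}(T,P)$ (respectively $\mathrm{RnOcc}(T,P)$) be the set of occurrences obtained by greedily taking the leftmost (rightmost) occurrence and continuing in the part of $T$ to the right (left) of it. For $1\le j\le j+q-1\le|T|$ and $P=T[j:j+q-1]$, the *longest overlapping cover* $\mathrm{loc}_q(T,j)$ is the (unique) pair $(b,e)$ with $e-b$ maximal such that $b\in\mathrm{Occ}(T,P)$, $e-(q-1)\in\mathrm{Occ}(T,P)$, $b\le j\le j+q-1\le e$, and for every $k\in[b:e-q]\cap\mathrm{Occ}(T,P)$ there is an occurrence of $P$ in $[k+1:\min\{k+q-1,e-q+1\}]$. A *straight line program* (SLP) of size $n\ge1$ over a finite alphabet $\{0,\dots,\sigma-1\}$ is a sequence of assignments $X_i=a$ (a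 letter) or $X_i=X_\ell X_r$ with $\ell,r<i$, one for each of the $n$ variables; $X_i$ also denotes the string it derives, and $N=\max_i|X_i|$ (so $N=|T|$ for the derived string $T$ if every variable occurs in the derivation of $T$). The model of computation is a unit-cost word RAM with addition, truncated subtraction, multiplication, comparisons and indirect addressing. **Statement.** (1) There are one RAM program and one constant $C$ such that, for every $\sigma$, every $q\ge 1$ and every SLP of size $n\ge 1$ over $\{0,\dots,\sigma-1\}$, the program, started with $n$, $q$ and the list of the $n$ assignments, halts after at most $C\,q^2n$ steps, handles only numbers and addresses that are at most $C\,(N+qn+\sigma)$ (words of $\log_2(N+qn+\sigma)+O(1)$ bits), and leaves in memory a table that contains, for all variables $X_i=X_\ell X_r$ and all $j$ with $$\max\{1,|X_\ell|-2(q-1)+1\}\le j\le\min\{|X_i|-q+1,\ |X_\ell|+q-1\},$$ the value $\mathrm{nOcc}(X_i[b:e],s_j)$, where $s_j=X_i[j:j+q-1]$ and $(b,e)=\mathrm{loc}_q(X_i,j)$. The entry for $(i,j)$ is at offset $3q\,i'+(j-\max\{1,|X_\ell|-2(q-1)+1\})$ from the start of the table, where $i'\in\{0,\dots,n-1\}$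 is the number of assignments before that of $X_i$. (2) For all such SLPs, $q$, $X_i=X_\ell X_r$ and $j$, with $s_j$ and $(b,e)$ as above, $$\mathrm{nOcc}(X_i[b:e],s_j)=\mathrm{nOcc}(X_i[b:\bar e_\ell],s_j)+\mathrm{nOcc}(X_i[u_1+1:u_2-1],s_j)+\mathrm{nOcc}(X_i[\bar b_r:e],s_j),$$ where $\bar e_\ell$ is the end position of the last occurrence of $s_j$ that lies in $X_i[b:\min\{e,|X_\ell|\}]$, $\bar b_r$ is the start position of the first occurrence of $s_j$ that lies in $X_i[\max\{b,|X_\ell|+1\}:e]$, $u_1$ is the end position (in $X_i$) of the largest element of $\mathrm{LnOcc}(X_i[b:\bar e_\ell],s_j)$, and $u_2$ is the start position (in $X_i$) of the smallest element of $\mathrm{RnOcc}(X_i[\bar b_r:e],s_j)$; if there is no such occurrence on the left then $\bar e_\ell=u_1=b-1$, and if there is none on the right then $\bar b_r=u_2=e+1$. -/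

import Mathlib

namespace SLPNonOverlap

/-! ### Strings, occurrences, non-overlapping occurrences (positions start at 1) -/

section Strings

variable {α : Type*}

/-- `T[i:j]`, the substring from position `i` to position `j` (both included, `1 ≤ i`);
it is empty if `j < i`. -/
def substr (T : List α) (i j : ℕ) : List α := (T.drop (i - 1)).take (j + 1 - i)

/-- `c ⊕ A = {c + x | x ∈ A}`. -/
def shift (c : ℕ) (A : Finset ℕ) : Finset ℕ := A.image (fun x => c + x)

variable [DecidableEq α]

/-- `Occ(T, P) = {k > 0 | T[k:k+|P|-1] = P}`, for a nonempty pattern `P` (which forces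
`k ≤ |T|`). -/
def Occ (T P : List α) : Finset ℕ :=
  (Finset.Icc 1 T.length).filter (fun k => substr T k (k + P.length - 1) = P)

/-- `nOcc(T, P)`: the size of a largest set of pairwise non-overlapping occurrences. -/
def nOcc (T P : List α) : ℕ :=
  ((Occ T P).powerset.filter
    (fun A => ∀ k₁ ∈ A, ∀ k₂ ∈ A, k₁ < k₂ → k₁ + P.length - 1 < k₂)).sup Finset.card

theorem mem_Occ_bounds {T P : List α} {k : ℕ} (h : k ∈ Occ T P) : 1 ≤ k ∧ k ≤ T.length := by
  simpa using (Finset.mem_filter.1 h).1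

/-- Left priority (greedy) non-overlapping occurrences:
`{j} ∪ (j + |P| - 1) ⊕ LnOcc(T[j+|P|:|T|], P)` with `j = min Occ(T, P)`. -/
def LnOcc (T P : List α) : Finset ℕ :=
  if h : P ≠ [] ∧ (Occ T P).Nonempty then
    insert ((Occ T P).min' h.2)
      (shift ((Occ T P).min' h.2 + P.length - 1)
        (LnOcc (substr T ((Occ T P).min' h.2 + P.length) T.length) P))
  else ∅
termination_by T.length
decreasing_by
  have h1 := mem_Occ_bounds ((Occ T P).min'_mem h.2)
  have h2 : 0 < P.length := List.length_pos_iff.2 h.1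
  simp only [substr, List.length_take, List.length_drop]
  omega

/-- Right priority (greedy) non-overlapping occurrences:
`{i} ∪ RnOcc(T[1:i-1], P)` with `i = max Occ(T, P)`. -/
def RnOcc (T P : List α) : Finset ℕ :=
  if h : P ≠ [] ∧ (Occ T P).Nonempty then
    insert ((Occ T P).max' h.2) (RnOcc (substr T 1 ((Occ T P).max' h.2 - 1)) P)
  else ∅
termination_by T.length
decreasing_by
  have h1 := mem_Occ_bounds ((Occ T P).max'_mem h.2)
  simp only [substr, List.length_take, List.length_drop]
  omega

/-- End position of the last of the occurrences `A` of a `q`-gram (`d` if there is none). -/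
def lastEnd (d q : ℕ) (A : Finset ℕ) : ℕ :=
  if h : A.Nonempty then A.max' h + q - 1 else d

/-- Start position of the first of the occurrences `A` (`d` if there is none). -/
def firstStart (d : ℕ) (A : Finset ℕ) : ℕ :=
  if h : A.Nonempty then A.min' h else d

/-- `p = (b, e)` is an overlapping cover of the `q`-gram `P = T[j:j+q-1]` with respect to `j`:
`b` is the start and `e` the end of an occurrence of `P`, `b ≤ j ≤ j+q-1 ≤ e`, and every
occurrence `k ∈ [b:e-q]` is overlapped by a later one that starts in
`[k+1 : min{k+q-1, e-q+1}]`. -/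
def IsCover (T : List α) (q j : ℕ) (p : ℕ × ℕ) : Prop :=
  p.1 ∈ Occ T (substr T j (j + q - 1)) ∧
  p.2 ∈ shift (q - 1) (Occ T (substr T j (j + q - 1))) ∧
  p.1 ≤ j ∧ j + q - 1 ≤ p.2 ∧
  ∀ k ∈ Finset.Icc p.1 (p.2 - q) ∩ Occ T (substr T j (j + q - 1)),
    (Finset.Icc (k + 1) (min (k + q - 1) (p.2 - q + 1)) ∩
      Occ T (substr T j (j + q - 1))).Nonempty

/-- `(b, e)` is an overlapping cover that maximizes `e - b`. -/
def IsLongestCover (T : List α) (q j : ℕ) (p : ℕ × ℕ) : Prop :=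
  IsCover T q j p ∧ ∀ p', IsCover T q j p' → p'.2 - p'.1 ≤ p.2 - p.1

/-- The longest overlapping cover of the `q`-gram `T[j:j+q-1]` with respect to `j`
(`loc_eq_iff` below: it exists and is unique). -/
noncomputable def loc (T : List α) (q j : ℕ) : ℕ × ℕ :=
  Classical.epsilon (IsLongestCover T q j)

theorem IsLongestCover.unique {T : List α} {q j : ℕ} (hq : 1 ≤ q) {p p' : ℕ × ℕ}
    (h : IsLongestCover T q j p) (h' : IsLongestCover T q j p') : p = p' := by
  have key : ∀ a c : ℕ × ℕ, IsLongestCover T q j a → IsLongestCover T q j c →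
      c.1 ≤ a.1 ∧ a.2 ≤ c.2 := by
    intro a c ha hc
    obtain ⟨⟨a1, a2, a3, a4, a5⟩, -⟩ := ha
    obtain ⟨⟨c1, c2, c3, c4, c5⟩, c6⟩ := hc
    have hm : IsCover T q j (min a.1 c.1, max a.2 c.2) := by
      refine ⟨?_, ?_, by simp; omega, by simp; omega, ?_⟩
      · rcases min_choice a.1 c.1 with h | h <;> simp only [h] <;> assumption
      · rcases max_choice a.2 c.2 with h | h <;> simp only [h] <;> assumption
      · intro k hk
        simp only [Finset.mem_inter, Finset.mem_Icc] at hk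
        obtain ⟨⟨k1, k2⟩, k3⟩ := hk
        have hcase : (a.1 ≤ k ∧ k ≤ a.2 - q) ∨ (c.1 ≤ k ∧ k ≤ c.2 - q) := by omega
        rcases hcase with hh | hh
        · obtain ⟨m, hm⟩ := a5 k (by simp [hh, k3])
          simp only [Finset.mem_inter, Finset.mem_Icc] at hm
          exact ⟨m, by simp only [Finset.mem_inter, Finset.mem_Icc]; exact ⟨by omega, hm.2⟩⟩
        · obtain ⟨m, hm⟩ := c5 k (by simp [hh, k3])
          simp only [Finset.mem_inter, Finset.mem_Icc] at hm
          exact ⟨m, by simp only [Finset.mem_inter, Finset.mem_Icc]; exact ⟨by omega, hm.2⟩⟩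
    have := c6 _ hm
    simp only at this
    omega
  have h1 := key _ _ h h'
  have h2 := key _ _ h' h
  exact Prod.ext (by omega) (by omega)

theorem exists_isLongestCover {T : List α} {q j : ℕ} (hq : 1 ≤ q) (hj : 1 ≤ j)
    (hT : j + q - 1 ≤ T.length) : ∃ p, IsLongestCover T q j p := by
  classical
  have hlen : (substr T j (j + q - 1)).length = q := by
    simp only [substr, List.length_take, List.length_drop]; omega
  have hocc : j ∈ Occ T (substr T j (j + q - 1)) := by
    simp only [Occ, Finset.mem_filter, Finset.mem_Icc, hlen, and_true]; omega
  have h0 : IsCover T q j (j, j + q - 1) := by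
    refine ⟨hocc, ?_, le_rfl, le_rfl, ?_⟩
    · simp only [shift, Finset.mem_image]
      exact ⟨j, hocc, by omega⟩
    · intro k hk
      simp only [Finset.mem_inter, Finset.mem_Icc] at hk
      omega
  have hb : ∀ p, IsCover T q j p →
      p ∈ Finset.range (T.length + 1) ×ˢ Finset.range (T.length + q) := by
    intro p hp
    have h1 := mem_Occ_bounds hp.1
    obtain ⟨k, hk, hk'⟩ := Finset.mem_image.1 hp.2.1
    have h2 := mem_Occ_bounds hk
    simp only [Finset.mem_product, Finset.mem_range]
    omega
  obtain ⟨p, hp, hmax⟩ := Finset.exists_max_image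
    ((Finset.range (T.length + 1) ×ˢ Finset.range (T.length + q)).filter (IsCover T q j))
    (fun p => p.2 - p.1) ⟨_, Finset.mem_filter.2 ⟨hb _ h0, h0⟩⟩
  exact ⟨p, (Finset.mem_filter.1 hp).2,
    fun p' hp' => hmax p' (Finset.mem_filter.2 ⟨hb _ hp', hp'⟩)⟩

theorem loc_eq_iff {T : List α} {q j : ℕ} (hq : 1 ≤ q) (hj : 1 ≤ j)
    (hT : j + q - 1 ≤ T.length) (p : ℕ × ℕ) : loc T q j = p ↔ IsLongestCover T q j p := by
  have h : IsLongestCover T q j (loc T q j) :=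
    Classical.epsilon_spec (exists_isLongestCover hq hj hT)
  exact ⟨fun e => e ▸ h, fun hp => h.unique hq hp⟩

end Strings

/-! ### Straight line programs -/

/-- Right-hand side of an assignment: a letter, or a concatenation of two variables. -/
inductive Rule (σ n : ℕ) where
  | letter (a : Fin σ)
  | pair (l r : Fin n)

/-- A straight line program of size `n` over the alphabet `{0, …, σ-1}`.  Variables are numbered
`0, …, n-1`; a concatenation only refers to variables with smaller numbers. -/
structure SLP (σ n : ℕ) where
  rule : Fin n → Rule σ n
  lt_of_pair : ∀ i l r, rule i = Rule.pair l r → l < i ∧ r < i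

/-- The string derived from variable `i`. -/
def SLP.val {σ n : ℕ} (S : SLP σ n) (i : Fin n) : List (Fin σ) :=
  match h : S.rule i with
  | Rule.letter a => [a]
  | Rule.pair l r => S.val l ++ S.val r
termination_by i
decreasing_by
  · exact (S.lt_of_pair i l r h).1
  · exact (S.lt_of_pair i l r h).2

/-- The length `|X_i|` of the string derived from variable `i`. -/
def SLP.len {σ n : ℕ} (S : SLP σ n) (i : Fin n) : ℕ := (S.val i).length

/-- The largest length of a string derived from a variable (the length of the string derived
from the last variable, if every variable is used in its derivation). -/
def SLP.maxLen {σ n : ℕ} (S : SLP σ n) : ℕ := Finset.univ.sup S.len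

/-- For `X_i = X_l X_r`, the first boundary position `max{1, |X_l| - 2(q-1) + 1}`. -/
def SLP.lo {σ n : ℕ} (S : SLP σ n) (q : ℕ) (l : Fin n) : ℕ := max 1 (S.len l + 1 - 2 * (q - 1))

/-- For `X_i = X_l X_r`, the last boundary position `min{|X_l| + q - 1, |X_i| - q + 1}`
(`0`, hence below the first one, if `|X_i| < q`). -/
def SLP.hi {σ n : ℕ} (S : SLP σ n) (q : ℕ) (i l : Fin n) : ℕ :=
  min (S.len l + q - 1) (S.len i + 1 - q)

/-! ### A word RAM

Programs have finitely many registers and a random access memory.  Every number that is produced,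
read or used as an address has to fit into a machine word, that is, to be at most `W`; a run in
which this fails has no execution. -/

/-- State of the machine: contents of the registers and of the memory cells. -/
structure State where
  reg : ℕ → ℕ
  mem : ℕ → ℕ

/-- Arithmetic operations and comparisons. -/
inductive Op where
  | plus | minus | times | less | equal

/-- Subtraction is truncated; comparisons return `1` for true and `0` for false. -/
def Op.apply : Op → ℕ → ℕ → ℕ
  | .plus, x, y => x + y
  | .minus, x, y => x - y
  | .times, x, y => x * y
  | .less, x, y => if x < y then 1 else 0
  | .equal, x, y => if x = y then 1 else 0

/-- Expressions: constants, registers, memory cells, operations. -/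
inductive Expr where
  | lit (k : ℕ)
  | reg (x : ℕ)
  | load (a : Expr)
  | bin (o : Op) (a b : Expr)

/-- A number that has to fit into a word. -/
def fit (W v : ℕ) : Option ℕ := if v ≤ W then some v else none

/-- Value of an expression; `none` if a word overflows on the way. -/
def Expr.eval (W : ℕ) (s : State) : Expr → Option ℕ
  | .lit k => fit W k
  | .reg x => fit W (s.reg x)
  | .load a => (a.eval W s).bind fun p => fit W (s.mem p)
  | .bin o a b => (a.eval W s).bind fun x => (b.eval W s).bind fun y => fit W (o.apply x y)

/-- Number of unit steps to evaluate an expression: one for each of its nodes. -/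
def Expr.cost : Expr → ℕ
  | .lit _ => 1
  | .reg _ => 1
  | .load a => a.cost + 1
  | .bin _ a b => a.cost + b.cost + 1

/-- Programs. -/
inductive Prog where
  | skip
  | assign (x : ℕ) (e : Expr)
  | store (a e : Expr)
  | seq (p q : Prog)
  | cond (c : Expr) (p q : Prog)
  | loop (c : Expr) (p : Prog)

/-- `Exec W p s s' t`: with words bounded by `W`, the program `p` started in state `s` halts in
state `s'` after `t` unit steps. -/
inductive Exec (W : ℕ) : Prog → State → State → ℕ → Prop where
  | skip (s : State) : Exec W .skip s s 1
  | assign {s : State} {x : ℕ} {e : Expr} {v : ℕ} (he : e.eval W s = some v) :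
      Exec W (.assign x e) s { s with reg := Function.update s.reg x v } (e.cost + 1)
  | store {s : State} {a e : Expr} {m v : ℕ} (ha : a.eval W s = some m)
      (he : e.eval W s = some v) :
      Exec W (.store a e) s { s with mem := Function.update s.mem m v } (a.cost + e.cost + 1)
  | seq {p q : Prog} {s s' s'' : State} {t t' : ℕ} (hp : Exec W p s s' t)
      (hq : Exec W q s' s'' t') : Exec W (.seq p q) s s'' (t + t')
  | cond_true {c : Expr} {p q : Prog} {s s' : State} {v t : ℕ} (hc : c.eval W s = some v)
      (hv : v ≠ 0) (hp : Exec W p s s' t) : Exec W (.cond c p q) s s' (c.cost + 1 + t)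
  | cond_false {c : Expr} {p q : Prog} {s s' : State} {t : ℕ} (hc : c.eval W s = some 0)
      (hq : Exec W q s s' t) : Exec W (.cond c p q) s s' (c.cost + 1 + t)
  | loop_true {c : Expr} {p : Prog} {s s' s'' : State} {v t t' : ℕ}
      (hc : c.eval W s = some v) (hv : v ≠ 0) (hp : Exec W p s s' t)
      (hl : Exec W (.loop c p) s' s'' t') : Exec W (.loop c p) s s'' (c.cost + 1 + t + t')
  | loop_false {c : Expr} {p : Prog} {s : State} (hc : c.eval W s = some 0) :
      Exec W (.loop c p) s s (c.cost + 1)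

/-- The three words that encode an assignment: `0, a, 0` for a letter `a`, and `1, l, r` for the
concatenation of the variables `l` and `r`. -/
def Rule.code {σ n : ℕ} : Rule σ n → ℕ → ℕ
  | .letter a, 1 => a
  | .letter _, _ => 0
  | .pair _ _, 0 => 1
  | .pair l _, 1 => l
  | .pair _ r, _ => r

/-- Initial state: `n` and `q` in registers `0` and `1`, the code of the `i`-th assignment in
the memory cells `3i, 3i+1, 3i+2`, and `0` everywhere else. -/
def initState {σ n : ℕ} (S : SLP σ n) (q : ℕ) : State where
  reg x := if x = 0 then n else if x = 1 then q else 0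
  mem a := if h : a / 3 < n then (S.rule ⟨a / 3, h⟩).code (a % 3) else 0

end SLPNonOverlap

open SLPNonOverlap

/-! Both statements rest on greedy selection: some optimal set of non-overlapping occurrences
contains the leftmost one, and some contains the rightmost one (`packing_of_isLeast`,
`packing_of_isGreatest`).

For the split, select greedily from the left inside `X[b:eL]` and from the right inside `X[bR:e]`.
The cut at `|X_l|` forces `eL < bR`, so neither selection disturbs the other. The occurrences still
available are exactly those between `u₁` and `u₂`, and they are packed optimally
(`packing_eq_add_of_LnOcc`, `packing_eq_add_of_RnOcc`, `nOcc_substr_split`).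

For the algorithm, a longest cover is a maximal chain of successively overlapping occurrences. Its
last element is `chainEnd`, reached by `nxt` links. The greedy selection from the right inside the
chain has `count` elements and is made of `jump` steps along `prv` links, so the wanted value is
`count` at `chainEnd` (`nOcc_loc_eq_count`). A link goes back at most `q - 1` positions and a jump
at most `2q - 2`.

The quantity `count` is not local: a selection started in `X_r` may cross the boundary into `X_l`.
Hence the leftmost selected position `final` is kept as well. The selection in `X_i` agrees with
that in `X_r` up to `final` and continues from there (`CopyOf.count_final`). It can only continue if
`final` is at most `2q - 2`, that is, close to the boundary, where all counts are computed
explicitly.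

So `O(q)` words per variable are enough (`Table`): the letters near both ends, `count` and `final`
near the right end, and the chain ends with their `count` and `final` for the first `q - 1`
positions. The tables of `X_l` and `X_r` determine that of `X_i` through a window of `3q` positions
on each side of the boundary. All overlapping equal pairs in the window are found in `O(q²)` steps:
for each distance `d < q`, one scan from right to left maintains the length of the current run of
agreements between the text and its shift by `d` (`Run`), so each pair is tested in constant time.

The program for one variable has loops of nesting depth 2 with at most `10q` iterations each
(`Prog.time_le`), and it runs `n` times. The tables occupy `O(qn)` cells and the window arrays are
indexed by absolute positions of `X_i`, which gives the bound on the words. -/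

namespace SLPNonOverlap

/-! ### Maximum packings of positions and greedy choice -/

section Packing

/-- The largest size of a subset of `F` whose distinct elements differ by at least `q`. -/
def packing (q : ℕ) (F : Finset ℕ) : ℕ :=
  (F.powerset.filter
    (fun A => ∀ k₁ ∈ A, ∀ k₂ ∈ A, k₁ < k₂ → k₁ + q - 1 < k₂)).sup Finset.card

variable {q : ℕ} {F A : Finset ℕ}

theorem card_le_packing (hA : A ⊆ F)
    (h : ∀ k₁ ∈ A, ∀ k₂ ∈ A, k₁ < k₂ → k₁ + q - 1 < k₂) : A.card ≤ packing q F :=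
  Finset.le_sup (f := Finset.card) (Finset.mem_filter.2 ⟨Finset.mem_powerset.2 hA, h⟩)

theorem exists_card_eq_packing (q : ℕ) (F : Finset ℕ) : ∃ A ⊆ F,
    (∀ k₁ ∈ A, ∀ k₂ ∈ A, k₁ < k₂ → k₁ + q - 1 < k₂) ∧ A.card = packing q F := by
  obtain ⟨A, hA, h⟩ := Finset.exists_mem_eq_sup
    (F.powerset.filter (fun A => ∀ k₁ ∈ A, ∀ k₂ ∈ A, k₁ < k₂ → k₁ + q - 1 < k₂))
    ⟨∅, by simp⟩ Finset.card
  rw [Finset.mem_filter, Finset.mem_powerset] at hA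
  exact ⟨A, hA.1, hA.2, h.symm⟩

@[simp] theorem packing_empty : packing q ∅ = 0 := by
  obtain ⟨A, hA, -, h⟩ := exists_card_eq_packing q ∅
  rw [← h, Finset.subset_empty.1 hA, Finset.card_empty]

@[simp] theorem mem_shift {c k : ℕ} : k ∈ shift c F ↔ ∃ x ∈ F, c + x = k := by
  simp [shift]

theorem packing_le_packing_shift (c : ℕ) : packing q F ≤ packing q (shift c F) := by
  obtain ⟨A, hA, hs, h⟩ := exists_card_eq_packing q F
  rw [← h, ← Finset.card_image_of_injective A (f := fun x => c + x) (fun x y hxy => by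
    simpa using hxy)]
  refine card_le_packing (Finset.image_subset_image hA) ?_
  simp only [Finset.mem_image]
  rintro _ ⟨x, hx, rfl⟩ _ ⟨y, hy, rfl⟩ hxy
  have := hs x hx y hy (by omega)
  omega

theorem packing_shift (c : ℕ) : packing q (shift c F) = packing q F := by
  refine le_antisymm ?_ (packing_le_packing_shift c)
  obtain ⟨A, hA, hs, h⟩ := exists_card_eq_packing q (shift c F)
  have hA' : ∀ x ∈ A, x - c ∈ F ∧ c ≤ x := by
    intro x hx
    obtain ⟨y, hy, rfl⟩ := mem_shift.1 (hA hx)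
    simpa using hy
  rw [← h, ← Finset.card_image_of_injOn (s := A) (f := fun x => x - c) (fun x hx y hy hxy => by
    have h1 := (hA' x hx).2
    have h2 := (hA' y hy).2
    simp only at hxy
    omega)]
  refine card_le_packing ?_ ?_
  · intro x hx
    obtain ⟨y, hy, rfl⟩ := Finset.mem_image.1 hx
    exact (hA' y hy).1
  · simp only [Finset.mem_image]
    rintro _ ⟨x, hx, rfl⟩ _ ⟨y, hy, rfl⟩ hxy
    have := hs x hx y hy (by omega)
    have h1 := (hA' x hx).2
    have h2 := (hA' y hy).2
    omega

/-- Exchange argument: the least element of any packing is at least `m`, so the other elements are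
at least `m + q`. Conversely, `m` can be added to every packing of the positions from `m + q` on. -/
theorem packing_of_isLeast {m : ℕ} (hq : 1 ≤ q) (hm : m ∈ F) (hle : ∀ k ∈ F, m ≤ k) :
    packing q F = packing q (F.filter (fun k => m + q ≤ k)) + 1 := by
  apply le_antisymm
  · obtain ⟨A, hA, hs, h⟩ := exists_card_eq_packing q F
    rw [← h]
    rcases A.eq_empty_or_nonempty with rfl | hne
    · simp
    · rw [← Finset.card_erase_add_one (A.min'_mem hne)]
      gcongr
      refine card_le_packing ?_ fun k₁ h₁ k₂ h₂ =>
        hs k₁ (Finset.mem_of_mem_erase h₁) k₂ (Finset.mem_of_mem_erase h₂)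
      intro k hk
      have hk' := Finset.mem_of_mem_erase hk
      have h1 := A.min'_lt_of_mem_erase_min' hne hk
      have h2 := hs _ (A.min'_mem hne) k hk' h1
      have h3 := hle _ (hA (A.min'_mem hne))
      rw [Finset.mem_filter]
      exact ⟨hA hk', by omega⟩
  · obtain ⟨A, hA, hs, h⟩ := exists_card_eq_packing q (F.filter (fun k => m + q ≤ k))
    have hA' : ∀ k ∈ A, k ∈ F ∧ m + q ≤ k := fun k hk => Finset.mem_filter.1 (hA hk)
    have hmA : m ∉ A := fun hk => by have := (hA' m hk).2; omega
    rw [← h, ← Finset.card_insert_of_notMem hmA]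
    refine card_le_packing ?_ ?_
    · intro k hk
      rcases Finset.mem_insert.1 hk with rfl | hk
      · exact hm
      · exact (hA' k hk).1
    · intro k₁ h₁ k₂ h₂ hlt
      rcases Finset.mem_insert.1 h₁ with h₁ | h₁ <;> rcases Finset.mem_insert.1 h₂ with h₂ | h₂
      · omega
      · have := (hA' k₂ h₂).2; omega
      · have := (hA' k₁ h₁).2; omega
      · exact hs _ h₁ _ h₂ hlt

/-- The mirror image of `packing_of_isLeast`; it justifies counting a chain from its right end. -/
theorem packing_of_isGreatest {m : ℕ} (hq : 1 ≤ q) (hm : m ∈ F) (hle : ∀ k ∈ F, k ≤ m) :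
    packing q F = packing q (F.filter (fun k => k + q ≤ m)) + 1 := by
  apply le_antisymm
  · obtain ⟨A, hA, hs, h⟩ := exists_card_eq_packing q F
    rw [← h]
    rcases A.eq_empty_or_nonempty with rfl | hne
    · simp
    · rw [← Finset.card_erase_add_one (A.max'_mem hne)]
      gcongr
      refine card_le_packing ?_ fun k₁ h₁ k₂ h₂ =>
        hs k₁ (Finset.mem_of_mem_erase h₁) k₂ (Finset.mem_of_mem_erase h₂)
      intro k hk
      have hk' := Finset.mem_of_mem_erase hk
      have h1 := A.lt_max'_of_mem_erase_max' hne hk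
      have h2 := hs k hk' _ (A.max'_mem hne) h1
      have h3 := hle _ (hA (A.max'_mem hne))
      rw [Finset.mem_filter]
      exact ⟨hA hk', by omega⟩
  · obtain ⟨A, hA, hs, h⟩ := exists_card_eq_packing q (F.filter (fun k => k + q ≤ m))
    have hA' : ∀ k ∈ A, k ∈ F ∧ k + q ≤ m := fun k hk => Finset.mem_filter.1 (hA hk)
    have hmA : m ∉ A := fun hk => by have := (hA' m hk).2; omega
    rw [← h, ← Finset.card_insert_of_notMem hmA]
    refine card_le_packing ?_ ?_
    · intro k hk
      rcases Finset.mem_insert.1 hk with rfl | hk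
      · exact hm
      · exact (hA' k hk).1
    · intro k₁ h₁ k₂ h₂ hlt
      rcases Finset.mem_insert.1 h₁ with h₁ | h₁ <;> rcases Finset.mem_insert.1 h₂ with h₂ | h₂
      · omega
      · have := (hA' k₂ h₂).2; omega
      · have := (hA' k₁ h₁).2; omega
      · exact hs _ h₁ _ h₂ hlt

end Packing

/-! ### Occurrences in substrings and the split into three parts -/

section Occurrences

variable {α : Type*}

theorem getElem?_substr (T : List α) (i j t : ℕ) :
    (substr T i j)[t]? = if t < j + 1 - i then T[i - 1 + t]? else none := by
  simp only [substr, List.getElem?_take, List.getElem?_drop]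

theorem length_substr (T : List α) (i j : ℕ) :
    (substr T i j).length = min (j + 1 - i) (T.length - (i - 1)) := by
  simp [substr]

variable [DecidableEq α]

theorem nOcc_eq_packing (T P : List α) : nOcc T P = packing P.length (Occ T P) := rfl

theorem mem_Occ {T P : List α} (hP : P ≠ []) {k : ℕ} : k ∈ Occ T P ↔
    1 ≤ k ∧ k + P.length ≤ T.length + 1 ∧ ∀ t < P.length, T[k - 1 + t]? = P[t]? := by
  have hp : 0 < P.length := List.length_pos_iff.2 hP
  simp only [Occ, Finset.mem_filter, Finset.mem_Icc]
  constructor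
  · rintro ⟨⟨h1, h2⟩, h3⟩
    have hl := congrArg List.length h3
    rw [length_substr] at hl
    refine ⟨h1, by omega, fun t ht => ?_⟩
    rw [← h3, getElem?_substr, if_pos (by omega)]
  · rintro ⟨h1, h2, h3⟩
    refine ⟨⟨h1, by omega⟩, List.ext_getElem? fun t => ?_⟩
    rw [getElem?_substr]
    split_ifs with h
    · exact h3 t (by omega)
    · rw [List.getElem?_eq_none (by omega)]

/-- Passing to a substring becomes filtering in the coordinates of `T`; all later arguments about
substrings are arguments about filtered sets of positions. -/
theorem shift_Occ_substr {T P : List α} (hP : P ≠ []) {b : ℕ} (hb : 1 ≤ b) (e : ℕ) :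
    shift (b - 1) (Occ (substr T b e) P) =
      (Occ T P).filter (fun k => b ≤ k ∧ k + P.length ≤ e + 1) := by
  have hp : 0 < P.length := List.length_pos_iff.2 hP
  ext k
  simp only [mem_shift, Finset.mem_filter, mem_Occ hP, length_substr]
  constructor
  · rintro ⟨x, ⟨h1, h2, h3⟩, rfl⟩
    refine ⟨⟨by omega, by omega, fun t ht => ?_⟩, by omega, by omega⟩
    rw [← h3 t ht, getElem?_substr, if_pos (by omega)]
    congr 1
    omega
  · rintro ⟨⟨h1, h2, h3⟩, h4, h5⟩
    refine ⟨k - (b - 1), ⟨by omega, by omega, fun t ht => ?_⟩, by omega⟩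
    rw [← h3 t ht, getElem?_substr, if_pos (by omega)]
    congr 1
    omega

theorem nOcc_substr {T P : List α} (hP : P ≠ []) {b : ℕ} (hb : 1 ≤ b) (e : ℕ) :
    nOcc (substr T b e) P =
      packing P.length ((Occ T P).filter (fun k => b ≤ k ∧ k + P.length ≤ e + 1)) := by
  rw [nOcc_eq_packing, ← shift_Occ_substr hP hb, packing_shift]

theorem LnOcc_of_empty {T P : List α} (h : Occ T P = ∅) : LnOcc T P = ∅ := by
  rw [LnOcc, dif_neg (by simp [h])]

theorem RnOcc_of_empty {T P : List α} (h : Occ T P = ∅) : RnOcc T P = ∅ := by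
  rw [RnOcc, dif_neg (by simp [h])]

theorem shift_shift (c d : ℕ) (F : Finset ℕ) : shift c (shift d F) = shift (c + d) F := by
  ext k
  simp [add_assoc]

theorem shift_insert (c m : ℕ) (F : Finset ℕ) :
    shift c (insert m F) = insert (c + m) (shift c F) := by
  simp [shift]

@[simp] theorem lastEnd_empty (d q : ℕ) : lastEnd d q ∅ = d := by
  simp [lastEnd]

@[simp] theorem firstStart_empty (d : ℕ) : firstStart d ∅ = d := by
  simp [firstStart]

theorem lastEnd_insert {q m d : ℕ} {A : Finset ℕ} (h : ∀ k ∈ A, m ≤ k) :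
    lastEnd d q (insert m A) = lastEnd (m + q - 1) q A := by
  unfold lastEnd
  rw [dif_pos (Finset.insert_nonempty _ _)]
  split_ifs with hA
  · congr 2
    rw [Finset.max'_insert _ _ hA]
    exact max_eq_right (h _ (Finset.max'_mem _ _))
  · simp [Finset.not_nonempty_iff_eq_empty.1 hA]

theorem firstStart_insert {m d : ℕ} {A : Finset ℕ} (h : ∀ k ∈ A, k ≤ m) :
    firstStart d (insert m A) = firstStart m A := by
  unfold firstStart
  rw [dif_pos (Finset.insert_nonempty _ _)]
  split_ifs with hA
  · rw [Finset.min'_insert _ _ hA]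
    exact min_eq_right (h _ (Finset.min'_mem _ _))
  · simp [Finset.not_nonempty_iff_eq_empty.1 hA]

theorem LnOcc_subset {P : List α} (T : List α) : LnOcc T P ⊆ Occ T P := by
  induction hn : T.length using Nat.strong_induction_on generalizing T with
  | _ n ih =>
    subst hn
    rw [LnOcc]
    split_ifs with h
    · have hm := mem_Occ_bounds ((Occ T P).min'_mem h.2)
      have hp : 0 < P.length := List.length_pos_iff.2 h.1
      intro k hk
      rcases Finset.mem_insert.1 hk with rfl | hk
      · exact Finset.min'_mem _ _
      · have hsub := ih (substr T ((Occ T P).min' h.2 + P.length) T.length).length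
          (by rw [length_substr]; omega) _ rfl
        obtain ⟨x, hx, hxk⟩ := mem_shift.1 hk
        have hk' : k ∈ shift ((Occ T P).min' h.2 + P.length - 1)
          (Occ (substr T ((Occ T P).min' h.2 + P.length) T.length) P) :=
          mem_shift.2 ⟨x, hsub hx, hxk⟩
        rw [shift_Occ_substr h.1 (by omega)] at hk'
        exact (Finset.mem_filter.1 hk').1
    · exact Finset.empty_subset _

theorem RnOcc_subset {P : List α} (T : List α) : RnOcc T P ⊆ Occ T P := by
  induction hn : T.length using Nat.strong_induction_on generalizing T with
  | _ n ih =>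
    subst hn
    rw [RnOcc]
    split_ifs with h
    · have hm := mem_Occ_bounds ((Occ T P).max'_mem h.2)
      intro k hk
      rcases Finset.mem_insert.1 hk with rfl | hk
      · exact Finset.max'_mem _ _
      · have hsub := ih (substr T 1 ((Occ T P).max' h.2 - 1)).length
          (by rw [length_substr]; omega) _ rfl
        have hk' : k ∈ shift (1 - 1) (Occ (substr T 1 ((Occ T P).max' h.2 - 1)) P) :=
          mem_shift.2 ⟨k, hsub hk, by simp⟩
        rw [shift_Occ_substr h.1 le_rfl] at hk'
        exact (Finset.mem_filter.1 hk').1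
    · exact Finset.empty_subset _

/-- Since the occurrences in `T`, moved by `c`, form an initial segment of `F`, their least element
is also the least of `F`, and removing it together with everything it overlaps preserves the
situation. The offset `c` and the default `d` vary in the induction because `LnOcc` recurses into a
suffix of `T`, whose positions are renumbered. -/
theorem packing_eq_add_of_LnOcc {P : List α} (hP : P ≠ []) {v : ℕ} (T : List α) (c d : ℕ)
    (F : Finset ℕ)
    (hF : ∀ k, k ∈ shift c (Occ T P) ↔ k ∈ F ∧ k + P.length ≤ v) (hd : ∀ k ∈ F, d < k) :
    packing P.length F = packing P.length (shift c (Occ T P)) +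
      packing P.length
        (F.filter (fun k => lastEnd d P.length (shift c (LnOcc T P)) < k)) := by
  have hp : 0 < P.length := List.length_pos_iff.2 hP
  induction hn : T.length using Nat.strong_induction_on generalizing T c d F with
  | _ n ih =>
    subst hn
    rcases (Occ T P).eq_empty_or_nonempty with h | h
    · rw [LnOcc_of_empty h, h]
      simp only [shift, Finset.image_empty, packing_empty, zero_add, lastEnd_empty]
      rw [Finset.filter_true_of_mem hd]
    · have hmem := (Occ T P).min'_mem h
      have hmin : ∀ k ∈ Occ T P, (Occ T P).min' h ≤ k := fun k hk => Finset.min'_le _ _ hk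
      rw [LnOcc, dif_pos ⟨hP, h⟩]
      generalize (Occ T P).min' h = m at *
      have hm := mem_Occ_bounds hmem
      have hFm : c + m ∈ F ∧ c + m + P.length ≤ v := (hF _).1 (mem_shift.2 ⟨m, hmem, rfl⟩)
      have hFmin : ∀ k ∈ F, c + m ≤ k := by
        intro k hk
        by_contra hlt
        obtain ⟨x, hx, rfl⟩ := mem_shift.1 ((hF k).2 ⟨hk, by omega⟩)
        have := hmin x hx
        omega
      have hO : shift (c + (m + P.length - 1)) (Occ (substr T (m + P.length) T.length) P) =
          (shift c (Occ T P)).filter (fun k => c + m + P.length ≤ k) := by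
        rw [← shift_shift, shift_Occ_substr hP (by omega)]
        ext k
        simp only [mem_shift, Finset.mem_filter]
        constructor
        · rintro ⟨x, ⟨h1, h2, h3⟩, rfl⟩
          exact ⟨⟨x, h1, rfl⟩, by omega⟩
        · rintro ⟨⟨x, h1, rfl⟩, h2⟩
          have := (mem_Occ hP).1 h1
          exact ⟨x, ⟨h1, by omega, by omega⟩, rfl⟩
      have hO1 : ∀ k ∈ shift (c + (m + P.length - 1))
          (LnOcc (substr T (m + P.length) T.length) P), c + m + P.length ≤ k := by
        intro k hk
        obtain ⟨x, hx, rfl⟩ := mem_shift.1 hk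
        have := (mem_Occ_bounds (LnOcc_subset _ hx)).1
        omega
      have key := ih (substr T (m + P.length) T.length).length (by rw [length_substr]; omega)
        (substr T (m + P.length) T.length) (c + (m + P.length - 1)) (c + m + P.length - 1)
        (F.filter (fun k => c + m + P.length ≤ k)) (by
          intro k
          rw [hO, Finset.mem_filter, hF, Finset.mem_filter]
          tauto) (by
          intro k hk
          have := (Finset.mem_filter.1 hk).2
          omega) rfl
      rw [packing_of_isLeast hp hFm.1 hFmin, key, packing_of_isLeast hp
        (mem_shift.2 ⟨m, hmem, rfl⟩) (fun k hk => hFmin k ((hF k).1 hk).1), hO, shift_insert,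
        shift_shift, lastEnd_insert (fun k hk => by have := hO1 k hk; omega),
        Finset.filter_filter]
      have hle : c + m + P.length - 1 ≤ lastEnd (c + m + P.length - 1) P.length
          (shift (c + (m + P.length - 1)) (LnOcc (substr T (m + P.length) T.length) P)) := by
        unfold lastEnd
        split_ifs with hne
        · have := hO1 _ (Finset.max'_mem _ hne)
          omega
        · exact le_rfl
      have : ∀ k, (c + m + P.length ≤ k ∧ lastEnd (c + m + P.length - 1) P.length
          (shift (c + (m + P.length - 1)) (LnOcc (substr T (m + P.length) T.length) P)) < k) ↔
          lastEnd (c + m + P.length - 1) P.length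
          (shift (c + (m + P.length - 1)) (LnOcc (substr T (m + P.length) T.length) P)) < k := by
        intro k
        omega
      simp only [this]
      omega

/-- The mirror image of `packing_eq_add_of_LnOcc`. The offset `c` stays fixed here, as `RnOcc`
recurses into a prefix of `T`. -/
theorem packing_eq_add_of_RnOcc {P : List α} (hP : P ≠ []) {v : ℕ} (c : ℕ) (T : List α) (d : ℕ)
    (F : Finset ℕ)
    (hF : ∀ k, k ∈ shift c (Occ T P) ↔ k ∈ F ∧ v ≤ k) (hd : ∀ k ∈ F, k + P.length ≤ d) :
    packing P.length F =
      packing P.length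
        (F.filter (fun k => k + P.length ≤ firstStart d (shift c (RnOcc T P)))) +
      packing P.length (shift c (Occ T P)) := by
  have hp : 0 < P.length := List.length_pos_iff.2 hP
  induction hn : T.length using Nat.strong_induction_on generalizing T d F with
  | _ n ih =>
    subst hn
    rcases (Occ T P).eq_empty_or_nonempty with h | h
    · rw [RnOcc_of_empty h, h]
      simp only [shift, Finset.image_empty, packing_empty, add_zero, firstStart_empty]
      rw [Finset.filter_true_of_mem hd]
    · have hmem := (Occ T P).max'_mem h
      have hmax : ∀ k ∈ Occ T P, k ≤ (Occ T P).max' h := fun k hk => Finset.le_max' _ _ hk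
      rw [RnOcc, dif_pos ⟨hP, h⟩]
      generalize (Occ T P).max' h = m at *
      have hm := mem_Occ_bounds hmem
      have hFm : c + m ∈ F ∧ v ≤ c + m := (hF _).1 (mem_shift.2 ⟨m, hmem, rfl⟩)
      have hFmax : ∀ k ∈ F, k ≤ c + m := by
        intro k hk
        by_contra hlt
        obtain ⟨x, hx, rfl⟩ := mem_shift.1 ((hF k).2 ⟨hk, by omega⟩)
        have := hmax x hx
        omega
      have hO : shift c (Occ (substr T 1 (m - 1)) P) =
          (shift c (Occ T P)).filter (fun k => k + P.length ≤ c + m) := by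
        have := shift_Occ_substr (T := T) hP le_rfl (m - 1)
        rw [← add_zero c, ← shift_shift c 0, this]
        ext k
        simp only [mem_shift, Finset.mem_filter]
        constructor
        · rintro ⟨x, ⟨h1, h2, h3⟩, rfl⟩
          exact ⟨⟨x, h1, rfl⟩, by omega⟩
        · rintro ⟨⟨x, h1, rfl⟩, h2⟩
          have := (mem_Occ hP).1 h1
          exact ⟨x, ⟨h1, by omega, by omega⟩, rfl⟩
      have hO1 : ∀ k ∈ shift c (RnOcc (substr T 1 (m - 1)) P), k + P.length ≤ c + m := by
        intro k hk
        obtain ⟨x, hx, rfl⟩ := mem_shift.1 hk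
        have := (mem_Occ hP).1 (RnOcc_subset _ hx)
        rw [length_substr] at this
        omega
      have key := ih (substr T 1 (m - 1)).length (by rw [length_substr]; omega)
        (substr T 1 (m - 1)) (c + m)
        (F.filter (fun k => k + P.length ≤ c + m)) (by
          intro k
          rw [hO, Finset.mem_filter, hF, Finset.mem_filter]
          tauto) (by
          intro k hk
          exact (Finset.mem_filter.1 hk).2) rfl
      rw [packing_of_isGreatest hp hFm.1 hFmax, key, packing_of_isGreatest hp
        (mem_shift.2 ⟨m, hmem, rfl⟩) (fun k hk => hFmax k ((hF k).1 hk).1), hO, shift_insert,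
        firstStart_insert (fun k hk => by have := hO1 k hk; omega),
        Finset.filter_filter]
      have hle : firstStart (c + m) (shift c (RnOcc (substr T 1 (m - 1)) P)) ≤ c + m := by
        unfold firstStart
        split_ifs with hne
        · have := hO1 _ (Finset.min'_mem _ hne)
          omega
        · exact le_rfl
      have : ∀ k, (k + P.length ≤ c + m ∧ k + P.length ≤
          firstStart (c + m) (shift c (RnOcc (substr T 1 (m - 1)) P))) ↔
          k + P.length ≤ firstStart (c + m) (shift c (RnOcc (substr T 1 (m - 1)) P)) := by
        intro k
        omega
      simp only [this]
      omega

theorem lastEnd_cases (d q : ℕ) (A : Finset ℕ) :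
    (A = ∅ ∧ lastEnd d q A = d) ∨ ∃ k ∈ A, lastEnd d q A = k + q - 1 ∧ ∀ x ∈ A, x ≤ k := by
  unfold lastEnd
  split_ifs with h
  · exact Or.inr ⟨_, Finset.max'_mem _ h, rfl, fun x hx => Finset.le_max' _ _ hx⟩
  · exact Or.inl ⟨Finset.not_nonempty_iff_eq_empty.1 h, rfl⟩

theorem firstStart_cases (d : ℕ) (A : Finset ℕ) :
    (A = ∅ ∧ firstStart d A = d) ∨ ∃ k ∈ A, firstStart d A = k ∧ ∀ x ∈ A, k ≤ x := by
  unfold firstStart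
  split_ifs with h
  · exact Or.inr ⟨_, Finset.min'_mem _ h, rfl, fun x hx => Finset.min'_le _ _ hx⟩
  · exact Or.inl ⟨Finset.not_nonempty_iff_eq_empty.1 h, rfl⟩

/-- The optimal number of occurrences between `b` and `e` is obtained by choosing greedily from
the left up to `m`, greedily from the right down to `m + 1`, and optimally in between. -/
theorem nOcc_substr_split {X s : List α} (hs : s ≠ []) {b e m eL bR u₁ u₂ : ℕ} (hb : 1 ≤ b)
    (hbe : b ≤ e)
    (heL : eL = lastEnd (b - 1) s.length (shift (b - 1) (Occ (substr X b (min e m)) s)))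
    (hbR : bR = firstStart (e + 1)
      (shift (max b (m + 1) - 1) (Occ (substr X (max b (m + 1)) e) s)))
    (hu₁ : u₁ = lastEnd (b - 1) s.length (shift (b - 1) (LnOcc (substr X b eL) s)))
    (hu₂ : u₂ = firstStart (e + 1) (shift (bR - 1) (RnOcc (substr X bR e) s))) :
    nOcc (substr X b e) s =
      nOcc (substr X b eL) s + nOcc (substr X (u₁ + 1) (u₂ - 1)) s +
        nOcc (substr X bR e) s := by
  have hp : 0 < s.length := List.length_pos_iff.2 hs
  rw [shift_Occ_substr hs hb] at heL
  rw [shift_Occ_substr hs (by omega)] at hbR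
  -- The bounds on `eL` and `bR` give `eL < bR` even when a default value is taken. With `u₁ ≤ eL`
  -- and `bR ≤ u₂`, the two greedy selections then take place on disjoint sides.
  have heL' : b - 1 ≤ eL ∧ eL ≤ e ∧ (eL = b - 1 ∨ eL ≤ m) := by
    rcases lastEnd_cases (b - 1) s.length
      ((Occ X s).filter (fun k => b ≤ k ∧ k + s.length ≤ min e m + 1)) with ⟨-, h⟩ | ⟨k, hk, h, -⟩
    · rw [heL, h]; omega
    · have := (Finset.mem_filter.1 hk).2
      rw [heL, h]; omega
  have hbR' : bR ≤ e + 1 ∧ b ≤ bR ∧ (bR = e + 1 ∨ m + 1 ≤ bR) := by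
    rcases firstStart_cases (e + 1)
      ((Occ X s).filter (fun k => max b (m + 1) ≤ k ∧ k + s.length ≤ e + 1)) with
      ⟨-, h⟩ | ⟨k, hk, h, -⟩
    · rw [hbR, h]; omega
    · have := (Finset.mem_filter.1 hk).2
      rw [hbR, h]; omega
  have hu₁' : b - 1 ≤ u₁ ∧ u₁ ≤ eL := by
    rcases lastEnd_cases (b - 1) s.length (shift (b - 1) (LnOcc (substr X b eL) s)) with
      ⟨-, h⟩ | ⟨k, hk, h, -⟩
    · rw [hu₁, h]; omega
    · have hk' : k ∈ shift (b - 1) (Occ (substr X b eL) s) :=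
        Finset.image_subset_image (LnOcc_subset _) hk
      rw [shift_Occ_substr hs hb] at hk'
      have := (Finset.mem_filter.1 hk').2
      rw [hu₁, h]; omega
  have hu₂' : bR ≤ u₂ ∧ u₂ ≤ e + 1 := by
    rcases firstStart_cases (e + 1) (shift (bR - 1) (RnOcc (substr X bR e) s)) with
      ⟨-, h⟩ | ⟨k, hk, h, -⟩
    · rw [hu₂, h]; omega
    · have hk' : k ∈ shift (bR - 1) (Occ (substr X bR e) s) :=
        Finset.image_subset_image (RnOcc_subset _) hk
      rw [shift_Occ_substr hs (by omega)] at hk'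
      have := (Finset.mem_filter.1 hk').2
      rw [hu₂, h]; omega
  rw [nOcc_substr hs hb e, packing_eq_add_of_LnOcc hs (v := eL + 1) (substr X b eL) (b - 1)
    (b - 1), packing_shift, ← nOcc_eq_packing, ← hu₁, add_assoc]
  · congr 1
    rw [packing_eq_add_of_RnOcc hs (v := bR) (bR - 1) (substr X bR e) (e + 1), packing_shift,
      ← nOcc_eq_packing, ← hu₂, nOcc_substr hs (b := u₁ + 1) (by omega)]
    · congr 2
      rw [Finset.filter_filter, Finset.filter_filter]
      ext k
      simp only [Finset.mem_filter]
      refine and_congr_right fun hk => ?_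
      omega
    -- The right side is unaffected by the restriction to positions after `u₁`, because `u₁ ≤ eL <
    -- bR`.
    · intro k
      rw [shift_Occ_substr hs (by omega)]
      simp only [Finset.mem_filter]
      constructor
      · rintro ⟨h1, h2⟩
        exact ⟨⟨⟨h1, by omega⟩, by omega⟩, by omega⟩
      · rintro ⟨⟨⟨h1, h2⟩, h3⟩, h4⟩
        exact ⟨h1, by omega⟩
    · intro k hk
      simp only [Finset.mem_filter] at hk
      omega
  · intro k
    rw [shift_Occ_substr hs hb]
    simp only [Finset.mem_filter]
    constructor
    · rintro ⟨h1, h2⟩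
      exact ⟨⟨h1, by omega⟩, by omega⟩
    · rintro ⟨⟨h1, h2⟩, h4⟩
      exact ⟨h1, by omega⟩
  · intro k hk
    simp only [Finset.mem_filter] at hk
    omega

end Occurrences

theorem boundary_bounds {σ n q : ℕ} {S : SLP σ n} (hq : 1 ≤ q) {i l : Fin n} {j : ℕ}
    (h1 : S.lo q l ≤ j) (h2 : j ≤ S.hi q i l) : 1 ≤ j ∧ j + q - 1 ≤ (S.val i).length := by
  simp only [SLP.lo, SLP.hi, SLP.len] at h1 h2
  omega

/-- The cover contributes just `1 ≤ b ≤ e`; the rest is `nOcc_substr_split` with the cut at `|X_l|`.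
-/
theorem nOcc_loc_split (σ n q : ℕ) (S : SLP σ n) (hq : 1 ≤ q) (i l : Fin n)
    (j : ℕ) (h1 : S.lo q l ≤ j) (h2 : j ≤ S.hi q i l)
    (X s : List (Fin σ)) (b e eL bR u₁ u₂ : ℕ) (hX : X = S.val i)
    (hs : s = substr X j (j + q - 1)) (hbe : (b, e) = loc X q j)
    (heL : eL = lastEnd (b - 1) q (shift (b - 1) (Occ (substr X b (min e (S.len l))) s)))
    (hbR : bR = firstStart (e + 1)
      (shift (max b (S.len l + 1) - 1) (Occ (substr X (max b (S.len l + 1)) e) s)))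
    (hu₁ : u₁ = lastEnd (b - 1) q (shift (b - 1) (LnOcc (substr X b eL) s)))
    (hu₂ : u₂ = firstStart (e + 1) (shift (bR - 1) (RnOcc (substr X bR e) s))) :
    nOcc (substr X b e) s =
      nOcc (substr X b eL) s + nOcc (substr X (u₁ + 1) (u₂ - 1)) s +
        nOcc (substr X bR e) s := by
  subst hX
  obtain ⟨hj, hT⟩ := boundary_bounds hq h1 h2
  have hlen : s.length = q := by
    rw [hs, length_substr]
    omega
  have hs0 : s ≠ [] := by
    rintro rfl
    simp at hlen
    omega
  obtain ⟨⟨hb, he, hbj, hje, -⟩, -⟩ := (loc_eq_iff hq hj hT (b, e)).1 hbe.symm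
  refine nOcc_substr_split (m := S.len l) hs0 (mem_Occ_bounds hb).1 (by
    simp only at hbj hje; omega) ?_ hbR ?_ hu₂
  · rw [hlen]; exact heL
  · rw [hlen]; exact hu₁

/-! ### Links between overlapping equal `q`-grams, greedy counts and chain ends -/

section Chains

/-- The `q`-grams of the text `x` at positions `k'` and `k` are equal. -/
def Match (x : ℕ → ℕ) (q k' k : ℕ) : Prop := ∀ t < q, x (k' + t) = x (k + t)

instance (x : ℕ → ℕ) (q k' k : ℕ) : Decidable (Match x q k' k) :=
  inferInstanceAs (Decidable (∀ t < q, x (k' + t) = x (k + t)))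

theorem Match.symm {x : ℕ → ℕ} {q k' k : ℕ} (h : Match x q k' k) : Match x q k k' :=
  fun t ht => (h t ht).symm

theorem Match.trans {x : ℕ → ℕ} {q k₁ k₂ k₃ : ℕ} (h : Match x q k₁ k₂) (h' : Match x q k₂ k₃) :
    Match x q k₁ k₃ := fun t ht => (h t ht).trans (h' t ht)

/-- The last earlier occurrence of the `q`-gram at position `k` that overlaps it (`0` if there is
none). -/
def prv (x : ℕ → ℕ) (q k : ℕ) : ℕ :=
  Nat.findGreatest (fun k' => 1 ≤ k' ∧ k < k' + q ∧ Match x q k' k) (k - 1)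

open Classical in
/-- The first later occurrence, inside the prefix of length `L`, of the `q`-gram at position `k`
that overlaps it (`0` if there is none). -/
noncomputable def nxt (x : ℕ → ℕ) (q L k : ℕ) : ℕ :=
  if h : ∃ k', k < k' ∧ k' < k + q ∧ k' + q ≤ L + 1 ∧ Match x q k k' then Nat.find h else 0

variable {x y : ℕ → ℕ} {q k k' a L : ℕ}

theorem prv_le (x : ℕ → ℕ) (q k : ℕ) : prv x q k ≤ k - 1 := Nat.findGreatest_le _

theorem prv_spec (h : prv x q k ≠ 0) : k < prv x q k + q ∧ Match x q (prv x q k) k := by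
  have := Nat.findGreatest_of_ne_zero (P := fun k' => 1 ≤ k' ∧ k < k' + q ∧ Match x q k' k)
    (n := k - 1) rfl h
  exact this.2

theorem le_prv (h1 : 1 ≤ k') (h2 : k' < k) (h3 : k < k' + q) (h4 : Match x q k' k) :
    k' ≤ prv x q k :=
  Nat.le_findGreatest (by omega) ⟨h1, h3, h4⟩

theorem nxt_spec (h : nxt x q L k ≠ 0) : k < nxt x q L k ∧ nxt x q L k < k + q ∧
    nxt x q L k + q ≤ L + 1 ∧ Match x q k (nxt x q L k) := by
  classical
  unfold nxt at h ⊢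
  split_ifs at h ⊢ with h'
  · exact Nat.find_spec h'
  · exact absurd rfl h

theorem nxt_le (h1 : k < k') (h2 : k' < k + q) (h3 : k' + q ≤ L + 1) (h4 : Match x q k k') :
    nxt x q L k ≠ 0 ∧ nxt x q L k ≤ k' := by
  classical
  have h : ∃ k', k < k' ∧ k' < k + q ∧ k' + q ≤ L + 1 ∧ Match x q k k' := ⟨k', h1, h2, h3, h4⟩
  unfold nxt
  rw [dif_pos h]
  exact ⟨fun h0 => by have := (Nat.find_spec h).1; omega, Nat.find_min' h ⟨h1, h2, h3, h4⟩⟩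

theorem nxt_eq (h1 : k < k') (h2 : k' < k + q) (h3 : k' + q ≤ L + 1) (h4 : Match x q k k')
    (h5 : ∀ m, k < m → m + q ≤ L + 1 → Match x q k m → k' ≤ m) : nxt x q L k = k' := by
  obtain ⟨h0, hle⟩ := nxt_le h1 h2 h3 h4
  obtain ⟨s1, s2, s3, s4⟩ := nxt_spec h0
  exact le_antisymm hle (h5 _ s1 s3 s4)

theorem nxt_eq_zero (h : ∀ m, k < m → m < k + q → m + q ≤ L + 1 → ¬ Match x q k m) :
    nxt x q L k = 0 := by
  by_contra h0
  obtain ⟨s1, s2, s3, s4⟩ := nxt_spec h0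
  exact h _ s1 s2 s3 s4

/-- Follow `prv` from `y` until the `q`-gram at position `k` is no longer overlapped. -/
noncomputable def back (x : ℕ → ℕ) (q k y : ℕ) : ℕ :=
  if 0 < y ∧ k < y + q then back x q k (prv x q y) else y
termination_by y
decreasing_by
  have := prv_le x q y
  omega

theorem back_of_lt (h0 : 0 < k') (h : k < k' + q) : back x q k k' = back x q k (prv x q k') := by
  rw [back, if_pos ⟨h0, h⟩]

theorem back_of_le (h : k' + q ≤ k) : back x q k k' = k' := by
  rw [back, if_neg (by omega)]

@[simp] theorem back_zero : back x q k 0 = 0 := by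
  rw [back, if_neg (by omega)]

theorem back_le (k' : ℕ) : back x q k k' ≤ k' := by
  induction k' using Nat.strong_induction_on with
  | _ m ih =>
    rw [back]
    split_ifs with h
    · have h1 := prv_le x q m
      have := ih (prv x q m) (by omega)
      omega
    · exact le_rfl

theorem back_add_le (k' : ℕ) : back x q k k' = 0 ∨ back x q k k' + q ≤ k := by
  induction k' using Nat.strong_induction_on with
  | _ m ih =>
    rw [back]
    split_ifs with h
    · have h1 := prv_le x q m
      exact ih (prv x q m) (by omega)
    · omega

/-- The last visited position that still overlaps `k`, or lies to its right, is at least `k - q +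
1`, and one more link goes back at most `q - 1`. This locality is what makes windows of size `O(q)`
sufficient. -/
theorem lt_back_add (h : k < k' + q) (h0 : back x q k k' ≠ 0) :
    k + 2 ≤ back x q k k' + 2 * q := by
  induction k' using Nat.strong_induction_on with
  | _ m ih =>
    rcases Nat.eq_zero_or_pos m with rfl | hm
    · simp at h0
    rw [back_of_lt hm h] at h0 ⊢
    have h1 := prv_le x q m
    by_cases hp : prv x q m = 0
    · rw [hp, back_zero] at h0; exact absurd rfl h0
    have h2 := (prv_spec hp).1
    by_cases h3 : k < prv x q m + q
    · exact ih _ (by omega) h3 h0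
    · rw [back_of_le (by omega)]
      omega

/-- The predecessor of the occurrence at `k` in the selection from the right: the last position
of its chain at which an occurrence does not overlap that at `k`. -/
noncomputable def jump (x : ℕ → ℕ) (q k : ℕ) : ℕ := back x q k k

theorem jump_add_le (x : ℕ → ℕ) (q k : ℕ) : jump x q k = 0 ∨ jump x q k + q ≤ k := back_add_le k

theorem lt_jump_add (hq : 1 ≤ q) (h0 : jump x q k ≠ 0) : k + 2 ≤ jump x q k + 2 * q :=
  lt_back_add (by omega) h0

/-- The number of occurrences that are selected when one starts from the right at `k`. -/
noncomputable def count (x : ℕ → ℕ) (q k : ℕ) : ℕ :=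
  if 0 < k ∧ 0 < q then count x q (jump x q k) + 1 else 0
termination_by k
decreasing_by
  have := jump_add_le x q k
  omega

/-- The last occurrence that is selected when one starts from the right at `k`. -/
noncomputable def final (x : ℕ → ℕ) (q k : ℕ) : ℕ :=
  if 0 < q ∧ jump x q k ≠ 0 then final x q (jump x q k) else k
termination_by k
decreasing_by
  have := jump_add_le x q k
  omega

@[simp] theorem count_zero : count x q 0 = 0 := by
  rw [count, if_neg (by omega)]

theorem count_eq (hq : 1 ≤ q) (hk : 1 ≤ k) : count x q k = count x q (jump x q k) + 1 := by
  rw [count, if_pos (by omega)]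

theorem count_of_jump_eq_zero (hq : 1 ≤ q) (hk : 1 ≤ k) (h : jump x q k = 0) :
    count x q k = 1 := by
  rw [count_eq hq hk, h, count_zero]

theorem final_of_jump_eq_zero (h : jump x q k = 0) : final x q k = k := by
  rw [final, if_neg (by omega)]

theorem final_eq (hq : 1 ≤ q) (h : jump x q k ≠ 0) : final x q k = final x q (jump x q k) := by
  rw [final, if_pos ⟨hq, h⟩]

theorem final_bounds (hk : 1 ≤ k) :
    1 ≤ final x q k ∧ final x q k ≤ k ∧ (1 ≤ q → jump x q (final x q k) = 0) := by
  induction k using Nat.strong_induction_on with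
  | _ k ih =>
    rw [final]
    have := jump_add_le x q k
    split_ifs with h
    · have h1 := ih (jump x q k) (by omega) (by omega)
      exact ⟨h1.1, by omega, h1.2.2⟩
    · refine ⟨by omega, by omega, fun hq => ?_⟩
      by_contra h'
      exact h ⟨hq, h'⟩

theorem count_le (hq : 1 ≤ q) : count x q k ≤ k := by
  induction k using Nat.strong_induction_on with
  | _ k ih =>
    rcases Nat.eq_zero_or_pos k with rfl | hk
    · simp
    rw [count_eq hq hk]
    have := jump_add_le x q k
    have := ih (jump x q k) (by omega)
    omega

theorem one_le_count (hq : 1 ≤ q) (hk : 1 ≤ k) : 1 ≤ count x q k := by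
  rw [count_eq hq hk]
  omega

/-- The last occurrence in the chain of overlapping occurrences of the `q`-gram at `k`, inside the
prefix of length `L`. -/
noncomputable def chainEnd (x : ℕ → ℕ) (q L k : ℕ) : ℕ :=
  if nxt x q L k ≠ 0 then chainEnd x q L (nxt x q L k) else k
termination_by L - k
decreasing_by
  have := nxt_spec ‹_›
  omega

theorem chainEnd_of_nxt_eq_zero (h : nxt x q L k = 0) : chainEnd x q L k = k := by
  rw [chainEnd, if_neg (by omega)]

theorem chainEnd_of_nxt_ne_zero (h : nxt x q L k ≠ 0) :
    chainEnd x q L k = chainEnd x q L (nxt x q L k) := by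
  rw [chainEnd, if_pos h]

theorem chainEnd_spec (hk : k + q ≤ L + 1) : k ≤ chainEnd x q L k ∧
    chainEnd x q L k + q ≤ L + 1 ∧ nxt x q L (chainEnd x q L k) = 0 := by
  induction hn : L - k using Nat.strong_induction_on generalizing k with
  | _ n ih =>
    subst hn
    rw [chainEnd]
    split_ifs with h
    · have hs := nxt_spec h
      have := ih _ (by omega) hs.2.2.1 rfl
      exact ⟨by omega, this.2⟩
    · exact ⟨le_rfl, hk, not_not.1 h⟩

/-! ### Substrings -/

/-- The first `c` positions of `y` are a copy of the positions `a + 1, …, a + c` of `x`. -/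
def CopyOf (x y : ℕ → ℕ) (a c : ℕ) : Prop := ∀ p, 1 ≤ p → p ≤ c → y p = x (a + p)

variable {c : ℕ}

theorem CopyOf.match_iff (h : CopyOf x y a c) {k k' : ℕ} (hk : 1 ≤ k) (hk' : 1 ≤ k')
    (hkc : k + q ≤ c + 1) (hkc' : k' + q ≤ c + 1) :
    Match y q k' k ↔ Match x q (a + k') (a + k) := by
  refine forall₂_congr fun t ht => ?_
  rw [h _ (by omega) (by omega), h _ (by omega) (by omega), add_assoc, add_assoc]

/-- Truncated subtraction matters: a predecessor in `x` that starts at or before `a` is invisible in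
`y` and becomes `0`, the code for "none". -/
theorem CopyOf.prv (h : CopyOf x y a c) (hk : 1 ≤ k) (hkc : k + q ≤ c + 1) :
    prv y q k = prv x q (a + k) - a := by
  have h1 := prv_le x q (a + k)
  have h2 := prv_le y q k
  apply le_antisymm
  · by_cases h0 : SLPNonOverlap.prv y q k = 0
    · omega
    · have hs := prv_spec h0
      have := le_prv (x := x) (q := q) (k' := a + SLPNonOverlap.prv y q k) (k := a + k) (by omega)
        (by omega) (by omega) ((h.match_iff hk (by omega) hkc (by omega)).1 hs.2)
      omega
  · by_cases h0 : SLPNonOverlap.prv x q (a + k) ≤ a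
    · omega
    · obtain ⟨m, hm⟩ := Nat.exists_eq_add_of_lt (not_le.1 h0)
      have hs := prv_spec (x := x) (q := q) (k := a + k) (by omega)
      rw [hm, add_assoc] at hs
      have := le_prv (x := y) (q := q) (k' := m + 1) (k := k) (by omega)
        (by omega) (by omega) ((h.match_iff hk (by omega) hkc (by omega)).2 hs.2)
      omega

theorem CopyOf.back (h : CopyOf x y a c) (k' : ℕ) (hk : k' = 0 ∨ k' + q ≤ c + 1) :
    back y q k k' = back x q (a + k) (a + k') - a := by
  induction k' using Nat.strong_induction_on with
  | _ m ih =>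
    rcases Nat.eq_zero_or_pos m with rfl | hm
    · have := back_le (x := x) (q := q) (k := a + k) (a + 0)
      rw [back_zero]
      omega
    · by_cases h1 : m + q ≤ k
      · rw [back_of_le h1, back_of_le (by omega)]
        omega
      · have hp := prv_le y q m
        rw [back_of_lt hm (by omega), back_of_lt (x := x) (by omega) (by omega),
          ih _ (by omega) (by omega), h.prv hm (by omega)]
        -- If the link leaves the copy on the left, all later positions are at most `a` as well, and
        -- both sides are `0`.
        by_cases h2 : a ≤ SLPNonOverlap.prv x q (a + m)
        · rw [Nat.add_sub_cancel' h2]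
        · have e1 := back_le (x := x) (q := q) (k := a + k) (SLPNonOverlap.prv x q (a + m))
          have e2 := back_le (x := x) (q := q) (k := a + k)
            (a + (SLPNonOverlap.prv x q (a + m) - a))
          omega

theorem CopyOf.jump (h : CopyOf x y a c) (hkc : k + q ≤ c + 1) :
    jump y q k = jump x q (a + k) - a := h.back k (Or.inr hkc)

/-- A jump goes back at most `2q - 2`, so from `a + k` with `k ≥ 2q - 1` it would end inside the
copy and be seen in `y`. -/
theorem CopyOf.jump_eq_zero (h : CopyOf x y a c) (hq : 1 ≤ q) (hkc : k + q ≤ c + 1)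
    (hk : 2 * q ≤ k + 1) (h0 : SLPNonOverlap.jump y q k = 0) :
    SLPNonOverlap.jump x q (a + k) = 0 := by
  by_contra h1
  have := lt_jump_add hq h1
  rw [h.jump hkc] at h0
  omega

/-- As long as jumps stay in the copy, the selections in `x` and `y` coincide; beyond `final` only
`x` continues. The `+ 1` is there because the position `final` is counted in both terms on the
right. -/
theorem CopyOf.count_final (h : CopyOf x y a c) (hq : 1 ≤ q) (hk : 1 ≤ k) (hkc : k + q ≤ c + 1) :
    count x q (a + k) + 1 = count y q k + count x q (a + final y q k) ∧
      final x q (a + k) = final x q (a + final y q k) := by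
  induction k using Nat.strong_induction_on with
  | _ k ih =>
    have hb := jump_add_le y q k
    by_cases h0 : SLPNonOverlap.jump y q k = 0
    · rw [count_of_jump_eq_zero hq hk h0, final_of_jump_eq_zero h0]
      omega
    · have he := h.jump hkc
      have he' : SLPNonOverlap.jump x q (a + k) = a + SLPNonOverlap.jump y q k := by omega
      have := ih _ (by omega) (Nat.pos_of_ne_zero h0) (by omega)
      rw [count_eq (x := x) hq (by omega), count_eq (x := y) hq hk, final_eq (x := y) hq h0,
        final_eq (x := x) (k := a + k) hq (by omega), he']
      omega

/-- A selection that stops in `y` far from its left end also stops in `x`, by `CopyOf.jump_eq_zero`.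
-/
theorem CopyOf.count_final_of_lt (h : CopyOf x y a c) (hq : 1 ≤ q) (hk : 1 ≤ k)
    (hkc : k + q ≤ c + 1) (hf : 2 * (q - 1) < final y q k) :
    count x q (a + k) = count y q k ∧ final x q (a + k) = a + final y q k := by
  obtain ⟨h1, h2⟩ := h.count_final hq hk hkc
  obtain ⟨f1, f2, f3⟩ := final_bounds (x := y) (q := q) hk
  have h0 := h.jump_eq_zero (k := final y q k) hq (by omega) (by omega) (f3 hq)
  rw [count_of_jump_eq_zero (x := x) hq (by omega) h0] at h1
  rw [final_of_jump_eq_zero (x := x) h0] at h2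
  omega

/-- The selection moves only to the left, so in a prefix nothing is cut off. -/
theorem CopyOf.count_final_prefix (h : CopyOf x y 0 c) (hq : 1 ≤ q) (hk : 1 ≤ k)
    (hkc : k + q ≤ c + 1) : count x q k = count y q k ∧ final x q k = final y q k := by
  obtain ⟨h1, h2⟩ := h.count_final hq hk hkc
  obtain ⟨f1, f2, f3⟩ := final_bounds (x := y) (q := q) hk
  have h0 := h.jump (k := final y q k) (q := q) (by omega)
  rw [f3 hq, Nat.sub_zero, Nat.zero_add] at h0
  rw [Nat.zero_add, Nat.zero_add, count_of_jump_eq_zero (x := x) hq (by omega) h0.symm] at h1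
  rw [Nat.zero_add, Nat.zero_add, final_of_jump_eq_zero (x := x) h0.symm] at h2
  omega

/-- Chains are followed to the right, and `y` is here a copy of everything in `x` between `a + 1`
and the end `a + c`. -/
theorem CopyOf.chainEnd (h : CopyOf x y a c) (hk : 1 ≤ k) (hkc : k + q ≤ c + 1) :
    chainEnd x q (a + c) (a + k) = a + chainEnd y q c k := by
  induction hn : c - k using Nat.strong_induction_on generalizing k with
  | _ n ih =>
    subst hn
    by_cases h0 : nxt y q c k = 0
    · rw [chainEnd_of_nxt_eq_zero h0, chainEnd_of_nxt_eq_zero]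
      refine nxt_eq_zero fun m h1 h2 h3 h4 => ?_
      obtain ⟨m, rfl⟩ := Nat.exists_eq_add_of_le (show a ≤ m by omega)
      exact (nxt_le (x := y) (q := q) (L := c) (k := k) (k' := m) (by omega) (by omega) (by omega)
        ((h.match_iff (by omega) hk (by omega) hkc).2 h4)).1 h0
    · obtain ⟨s1, s2, s3, s4⟩ := nxt_spec h0
      have he : nxt x q (a + c) (a + k) = a + nxt y q c k := by
        refine nxt_eq (by omega) (by omega) (by omega)
          ((h.match_iff (by omega) hk (by omega) hkc).1 s4) fun m h1 h2 h3 => ?_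
        by_contra hlt
        obtain ⟨m, rfl⟩ := Nat.exists_eq_add_of_le (show a ≤ m by omega)
        have := (nxt_le (x := y) (q := q) (L := c) (k := k) (k' := m) (by omega) (by omega)
          (by omega) ((h.match_iff (by omega) hk (by omega) hkc).2 h3)).2
        omega
      rw [chainEnd_of_nxt_ne_zero h0, chainEnd_of_nxt_ne_zero (by omega), he]
      exact ih _ (by omega) (by omega) s3 rfl

theorem CopyOf.nxt_prefix (h : CopyOf x y 0 c) (hcL : c ≤ L) (hk : 1 ≤ k)
    (h0 : nxt y q c k ≠ 0) : nxt x q L k = nxt y q c k := by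
  obtain ⟨s1, s2, s3, s4⟩ := nxt_spec h0
  have hm := fun m (h1 : 1 ≤ m) (h2 : m + q ≤ c + 1) =>
    h.match_iff (q := q) (k := m) (k' := k) h1 hk h2 (by omega)
  simp only [Nat.zero_add] at hm
  refine nxt_eq (by omega) (by omega) (by omega) ((hm _ (by omega) (by omega)).1 s4)
    fun m h1 h2 h3 => ?_
  by_contra hlt
  have := (nxt_le (x := y) (q := q) (L := c) (k := k) (k' := m) (by omega) (by omega)
    (by omega) ((hm _ (by omega) (by omega)).2 h3)).2
  omega

/-- A nearest successor found in the prefix remains the nearest in the longer text, so the chain can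
be resumed where it stopped in the prefix. -/
theorem CopyOf.chainEnd_prefix (h : CopyOf x y 0 c) (hcL : c ≤ L) (hk : 1 ≤ k) :
    SLPNonOverlap.chainEnd x q L (SLPNonOverlap.chainEnd y q c k) =
      SLPNonOverlap.chainEnd x q L k := by
  induction hn : c - k using Nat.strong_induction_on generalizing k with
  | _ n ih =>
    subst hn
    by_cases h0 : nxt y q c k = 0
    · rw [chainEnd_of_nxt_eq_zero h0]
    · obtain ⟨s1, s2, s3, s4⟩ := nxt_spec h0
      rw [chainEnd_of_nxt_ne_zero h0, ih _ (by omega) (by omega) rfl,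
        chainEnd_of_nxt_ne_zero (x := x) (k := k) (by rw [h.nxt_prefix hcL hk h0]; exact h0),
        h.nxt_prefix hcL hk h0]

/-- An occurrence overlapping the one at `k` from the right ends by `k + 2q - 2 ≤ c`, so it would
already lie in the prefix. -/
theorem CopyOf.chainEnd_eq_self (h : CopyOf x y 0 c) (hk : 1 ≤ k)
    (hkc : k + 2 * q ≤ c + 2) (h0 : nxt y q c k = 0) : SLPNonOverlap.chainEnd x q L k = k := by
  refine chainEnd_of_nxt_eq_zero (nxt_eq_zero fun m h1 h2 h3 h4 => ?_)
  have hm := h.match_iff (q := q) (k := m) (k' := k) (by omega) hk (by omega) (by omega)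
  simp only [Nat.zero_add] at hm
  exact (nxt_le (x := y) (q := q) (L := c) (k := k) (k' := m) (by omega) (by omega)
    (by omega) (hm.2 h4)).1 h0

/-! ### The number of non-overlapping occurrences in a longest cover -/

section Cover

variable {O : Finset ℕ} {j b e : ℕ}

/-- `O` is the set of occurrences of the `q`-gram at `j`, and `b`, …, `e` are the first and the
last element of its chain. -/
structure IsChain (x : ℕ → ℕ) (q L : ℕ) (O : Finset ℕ) (j b e : ℕ) : Prop where
  mem_iff : ∀ k, k ∈ O ↔ 1 ≤ k ∧ k + q ≤ L + 1 ∧ Match x q k j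
  first_mem : b ∈ O
  last_mem : e ∈ O
  le : b ≤ j
  le' : j ≤ e
  next : ∀ k ∈ O, b ≤ k → k < e → ∃ m ∈ O, k < m ∧ m ≤ e ∧ m < k + q
  first : ∀ k ∈ O, k < b → k + q ≤ b
  last : ∀ k ∈ O, e < k → e + q ≤ k

theorem IsChain.matches (h : IsChain x q L O j b e) (hk : k ∈ O) (hk' : k' ∈ O) :
    Match x q k k' :=
  ((h.mem_iff k).1 hk).2.2.trans ((h.mem_iff k').1 hk').2.2.symm

theorem IsChain.mem_of_match (h : IsChain x q L O j b e) (hk : k ∈ O) (h1 : 1 ≤ k')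
    (h2 : k' + q ≤ L + 1) (hm : Match x q k k') : k' ∈ O :=
  (h.mem_iff k').2 ⟨h1, h2, hm.symm.trans ((h.mem_iff k).1 hk).2.2⟩

/-- Each `nxt` link goes to the nearest occurrence, hence not past the successor that the chain
provides up to `e`; behind `e` there is a gap. -/
theorem IsChain.chainEnd (h : IsChain x q L O j b e) (hk : k ∈ O) (hb : b ≤ k) (he : k ≤ e) :
    chainEnd x q L k = e := by
  induction hn : e - k using Nat.strong_induction_on generalizing k with
  | _ n ih =>
    subst hn
    rcases he.eq_or_lt with rfl | hlt
    · refine chainEnd_of_nxt_eq_zero (nxt_eq_zero fun m h1 h2 h3 h4 => ?_)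
      have := h.last m (h.mem_of_match hk (by omega) h3 h4) h1
      omega
    · obtain ⟨m, hm, h1, h2, h3⟩ := h.next k hk hb hlt
      obtain ⟨n1, n2⟩ := nxt_le h1 h3 ((h.mem_iff m).1 hm).2.1 (h.matches hk hm)
      obtain ⟨s1, s2, s3, s4⟩ := nxt_spec n1
      rw [chainEnd_of_nxt_ne_zero n1]
      exact ih _ (by omega) (h.mem_of_match hk (by omega) s3 s4) (by omega) (by omega) rfl

/-- A link cannot leave the chain on the left, since occurrences before `b` do not reach `b`. It
skips no element either: from any earlier `m`, chain successors lead to an element before `k` that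
overlaps it, so the nearest such element is at least `m`. -/
theorem IsChain.prv (h : IsChain x q L O j b e) (hk : k ∈ O) (hb : b ≤ k) (he : k ≤ e) :
    (prv x q k = 0 ∨ prv x q k ∈ O ∧ b ≤ prv x q k) ∧
      ∀ m ∈ O, b ≤ m → m < k → m ≤ prv x q k := by
  have hmem : SLPNonOverlap.prv x q k ≠ 0 → SLPNonOverlap.prv x q k ∈ O := fun h0 => by
    have hs := prv_spec h0
    have := prv_le x q k
    have := (h.mem_iff k).1 hk
    exact h.mem_of_match hk (by omega) (by omega) hs.2.symm
  constructor
  · by_cases h0 : SLPNonOverlap.prv x q k = 0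
    · exact Or.inl h0
    · refine Or.inr ⟨hmem h0, ?_⟩
      have hs := prv_spec h0
      by_contra hlt
      rcases hb.eq_or_lt with rfl | hb
      · have := h.first _ (hmem h0) (by omega)
        omega
      · have := h.first _ (hmem h0) (by omega)
        obtain ⟨hb1, hb2, hb3⟩ := (h.mem_iff b).1 h.first_mem
        have := le_prv hb1 hb (by omega) (h.matches h.first_mem hk)
        omega
  · intro m hm hbm hmk
    induction hn : k - m using Nat.strong_induction_on generalizing m with
    | _ n ih =>
      subst hn
      obtain ⟨m', hm', h1, h2, h3⟩ := h.next m hm hbm (by omega)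
      have := (h.mem_iff m).1 hm
      by_cases h4 : m' < k
      · have := ih _ (by omega) m' hm' (by omega) h4 rfl
        omega
      · exact le_prv (by omega) hmk (by omega) (h.matches hm hk)

/-- The hypothesis `hle` is the invariant of the walk: no chain element compatible with `k` has been
passed. -/
theorem IsChain.back (h : IsChain x q L O j b e) (k : ℕ) {y : ℕ}
    (hy : y ∈ O ∧ b ≤ y ∧ y ≤ e ∨ y = 0) (hle : ∀ m ∈ O, b ≤ m → m + q ≤ k → m ≤ y) :
    (back x q k y = 0 ∨ back x q k y ∈ O ∧ b ≤ back x q k y) ∧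
      ∀ m ∈ O, b ≤ m → m + q ≤ k → m ≤ back x q k y := by
  induction y using Nat.strong_induction_on with
  | _ y ih =>
    rcases hy with ⟨h1, h2, h3⟩ | rfl
    · have h4 := (h.mem_iff y).1 h1
      by_cases h5 : k < y + q
      · have h6 := prv_le x q y
        obtain ⟨h7, h8⟩ := h.prv h1 h2 h3
        rw [back_of_lt h4.1 h5]
        refine ih _ (by omega) ?_ fun m hm hbm hmk => h8 m hm hbm (by omega)
        rcases h7 with h7 | h7
        · exact Or.inr h7
        · exact Or.inl ⟨h7.1, h7.2, by omega⟩
      · rw [back_of_le (by omega)]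
        exact ⟨Or.inr ⟨h1, h2⟩, hle⟩
    · rw [back_zero]
      exact ⟨Or.inl rfl, hle⟩

/-- After taking the rightmost element `k`, the remaining candidates are those that end before `k`.
By `IsChain.back` they are the chain elements up to `jump x q k`, so `packing` and `count` obey the
same recursion. -/
theorem IsChain.packing_eq_count (h : IsChain x q L O j b e) (hq : 1 ≤ q) (hk : k ∈ O)
    (hb : b ≤ k) (he : k ≤ e) :
    packing q (O.filter (fun m => b ≤ m ∧ m ≤ k)) = count x q k := by
  induction k using Nat.strong_induction_on with
  | _ k ih =>
    have hk1 := ((h.mem_iff k).1 hk).1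
    rw [packing_of_isGreatest hq (m := k) (Finset.mem_filter.2 ⟨hk, hb, le_rfl⟩)
      (fun m hm => (Finset.mem_filter.1 hm).2.2), Finset.filter_filter, count_eq hq hk1]
    congr 1
    have hj := jump_add_le x q k
    obtain ⟨h1, h2⟩ := h.back k (y := k) (Or.inl ⟨hk, hb, he⟩) (fun m _ _ _ => by omega)
    change (jump x q k = 0 ∨ jump x q k ∈ O ∧ b ≤ jump x q k) at h1
    change ∀ m ∈ O, b ≤ m → m + q ≤ k → m ≤ jump x q k at h2
    rcases h1 with h1 | ⟨h1, h3⟩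
    · rw [h1, count_zero, Finset.filter_false_of_mem, packing_empty]
      rintro m hm ⟨⟨h4, h5⟩, h6⟩
      have := h2 m hm h4 h6
      have := (h.mem_iff m).1 hm
      omega
    · have := (h.mem_iff _).1 h1
      rw [← ih _ (by omega) h1 h3 (by omega)]
      congr 1
      refine Finset.filter_congr fun m hm => ?_
      constructor
      · rintro ⟨⟨h4, h5⟩, h6⟩
        exact ⟨h4, h2 m hm h4 h6⟩
      · rintro ⟨h4, h5⟩
        omega

end Cover

end Chains

/-! ### From longest overlapping covers to chains -/

section Text

variable {σ : ℕ}

/-- The letter at position `p ≥ 1`, as a number. -/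
def text (X : List (Fin σ)) (p : ℕ) : ℕ := ((X[p - 1]?).map Fin.val).getD 0

theorem text_eq_iff {X Y : List (Fin σ)} {p p' : ℕ} (h : p - 1 < X.length)
    (h' : p' - 1 < Y.length) : text X p = text Y p' ↔ X[p - 1]? = Y[p' - 1]? := by
  simp only [text, List.getElem?_eq_getElem h, List.getElem?_eq_getElem h', Option.map_some,
    Option.getD_some, Option.some_inj]
  exact Fin.ext_iff.symm

theorem copyOf_append_left (X Y : List (Fin σ)) :
    CopyOf (text (X ++ Y)) (text X) 0 X.length := by
  intro p h1 h2
  rw [text, text, List.getElem?_append_left (by omega), Nat.zero_add]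

theorem copyOf_append_right (X Y : List (Fin σ)) :
    CopyOf (text (X ++ Y)) (text Y) X.length Y.length := by
  intro p h1 h2
  rw [text, text, List.getElem?_append_right (by omega)]
  congr 3
  omega

variable {X : List (Fin σ)} {q j k : ℕ}

theorem mem_Occ_substr (hq : 1 ≤ q) (hj : 1 ≤ j) (hT : j + q ≤ X.length + 1) :
    k ∈ Occ X (substr X j (j + q - 1)) ↔
      1 ≤ k ∧ k + q ≤ X.length + 1 ∧ Match (text X) q k j := by
  have hlen : (substr X j (j + q - 1)).length = q := by
    rw [length_substr]
    omega
  rw [mem_Occ (by rw [← List.length_pos_iff]; omega), hlen]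
  refine and_congr_right fun h1 => and_congr_right fun h2 => forall₂_congr fun t ht => ?_
  rw [text_eq_iff (by omega) (by omega), getElem?_substr, if_pos (by omega),
    Nat.sub_add_comm h1, Nat.sub_add_comm hj]

/-- The gaps on both sides come from maximality: an occurrence outside the cover that overlaps its
first or last element would extend it. The end of the cover is an end position, whereas `IsChain`
speaks of starts, hence `e + 1 - q`. -/
theorem isChain_of_isLongestCover (hq : 1 ≤ q) (hj : 1 ≤ j) (hT : j + q ≤ X.length + 1)
    {b e : ℕ} (h : IsLongestCover X q j (b, e)) :
    q ≤ e + 1 ∧ IsChain (text X) q X.length (Occ X (substr X j (j + q - 1))) j b (e + 1 - q) := by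
  obtain ⟨⟨h1, h2, h3, h4, h5⟩, h6⟩ := h
  obtain ⟨e', he', rfl⟩ := mem_shift.1 h2
  simp only at h1 h3 h4 h5
  have hee : q - 1 + e' + 1 - q = e' := by omega
  rw [hee]
  have next : ∀ k ∈ Occ X (substr X j (j + q - 1)), b ≤ k → k < e' →
      ∃ m ∈ Occ X (substr X j (j + q - 1)), k < m ∧ m ≤ e' ∧ m < k + q := by
    intro k hk hbk hke
    obtain ⟨m, hm⟩ := h5 k (by
      simp only [Finset.mem_inter, Finset.mem_Icc]
      exact ⟨by omega, hk⟩)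
    simp only [Finset.mem_inter, Finset.mem_Icc] at hm
    exact ⟨m, hm.2, by omega, by omega, by omega⟩
  refine ⟨by omega, fun k => mem_Occ_substr hq hj hT, h1, he', h3, by omega, next, ?_, ?_⟩
  · intro k hk hkb
    by_contra hlt
    have := h6 (k, q - 1 + e') ⟨hk, h2, by simp only; omega, h4, ?_⟩
    · simp only at this
      omega
    · intro m hm
      simp only [Finset.mem_inter, Finset.mem_Icc] at hm
      by_cases hmb : b ≤ m
      · obtain ⟨m', hm', a1, a2, a3⟩ := next m hm.2 hmb (by omega)
        exact ⟨m', by simp only [Finset.mem_inter, Finset.mem_Icc]; exact ⟨by omega, hm'⟩⟩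
      · exact ⟨b, by simp only [Finset.mem_inter, Finset.mem_Icc]; exact ⟨by omega, h1⟩⟩
  · intro k hk hke
    by_contra hlt
    have := h6 (b, q - 1 + k) ⟨h1, mem_shift.2 ⟨k, hk, rfl⟩, h3, by simp only; omega, ?_⟩
    · simp only at this
      omega
    · intro m hm
      simp only [Finset.mem_inter, Finset.mem_Icc] at hm
      by_cases hmb : m < e'
      · obtain ⟨m', hm', a1, a2, a3⟩ := next m hm.2 (by omega) hmb
        exact ⟨m', by simp only [Finset.mem_inter, Finset.mem_Icc]; exact ⟨by omega, hm'⟩⟩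
      · exact ⟨k, by simp only [Finset.mem_inter, Finset.mem_Icc]; exact ⟨by omega, hk⟩⟩

/-- This replaces the specification by a quantity defined through links alone, which is the one the
machine computes. -/
theorem nOcc_loc_eq_count (hq : 1 ≤ q) (hj : 1 ≤ j) (hT : j + q ≤ X.length + 1) :
    nOcc (substr X (loc X q j).1 (loc X q j).2) (substr X j (j + q - 1)) =
      count (text X) q (chainEnd (text X) q X.length j) := by
  have hlen : (substr X j (j + q - 1)).length = q := by
    rw [length_substr]
    omega
  obtain ⟨he, h⟩ := isChain_of_isLongestCover hq hj hT
    (b := (loc X q j).1) (e := (loc X q j).2) ((loc_eq_iff hq hj (by omega) (loc X q j)).1 rfl)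
  have hjO := (mem_Occ_substr hq hj hT).2 ⟨hj, hT, fun t _ => rfl⟩
  rw [nOcc_substr (by rw [← List.length_pos_iff]; omega) (mem_Occ_bounds h.first_mem).1, hlen,
    h.chainEnd hjO h.le h.le', ← h.packing_eq_count hq h.last_mem (h.le.trans h.le') le_rfl]
  congr 1
  refine Finset.filter_congr fun m _ => ?_
  omega

end Text

/-! ### A program logic for the word RAM, with time bounds and framing -/

section Machine

instance (k : ℕ) : OfNat Expr k := ⟨.lit k⟩
instance : Add Expr := ⟨.bin .plus⟩
instance : Sub Expr := ⟨.bin .minus⟩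
instance : Mul Expr := ⟨.bin .times⟩

/-- Comparison, as an expression. -/
def Expr.lt (a b : Expr) : Expr := .bin .less a b

/-- Test for equality, as an expression. -/
def Expr.eq (a b : Expr) : Expr := .bin .equal a b

/-- The value of an expression if no word overflows. -/
def Expr.den (s : State) : Expr → ℕ
  | .lit k => k
  | .reg x => s.reg x
  | .load a => s.mem (a.den s)
  | .bin o a b => o.apply (a.den s) (b.den s)

/-- The result of an operation on numbers below `W` that are `x` and `y` is at most `W`. -/
def Op.Small (W : ℕ) : Op → ℕ → ℕ → Prop
  | .plus, x, y => x + y ≤ W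
  | .times, x, y => x * y ≤ W
  | _, _, _ => True

/-- No word overflows in the evaluation of an expression, if registers and memory fit. -/
def Expr.Ok (W : ℕ) (s : State) : Expr → Prop
  | .lit k => k ≤ W
  | .reg _ => True
  | .load a => a.Ok W s
  | .bin o a b => a.Ok W s ∧ b.Ok W s ∧ o.Small W (a.den s) (b.den s)

/-- All registers and memory cells hold numbers that are at most `W`. -/
structure Fits (W : ℕ) (s : State) : Prop where
  pos : 1 ≤ W
  reg : ∀ x, s.reg x ≤ W
  mem : ∀ a, s.mem a ≤ W

variable {W b : ℕ} {s s' : State}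

theorem fit_eq_some {v w : ℕ} : fit W v = some w ↔ v ≤ W ∧ v = w := by
  unfold fit
  split_ifs with h <;> simp [h]

theorem Expr.eval_le {e : Expr} {v : ℕ} (h : e.eval W s = some v) : v ≤ W := by
  cases e <;> simp only [Expr.eval, Option.bind_eq_some_iff, fit_eq_some] at h
  · omega
  · omega
  · obtain ⟨p, -, h1, h2⟩ := h; omega
  · obtain ⟨x, -, y, -, h1, h2⟩ := h; omega

theorem Fits.eval (hs : Fits W s) {e : Expr} (h : e.Ok W s) : e.eval W s = some (e.den s) := by
  induction e with
  | lit k => exact fit_eq_some.2 ⟨h, rfl⟩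
  | reg x => exact fit_eq_some.2 ⟨hs.reg x, rfl⟩
  | load a ih =>
    rw [Expr.eval, ih h]
    exact fit_eq_some.2 ⟨hs.mem _, rfl⟩
  | bin o x y ihx ihy =>
    obtain ⟨hx, hy, h⟩ := h
    rw [Expr.eval, ihx hx, ihy hy]
    refine fit_eq_some.2 ⟨?_, rfl⟩
    have h1 := Expr.eval_le (ihx hx)
    have h2 := hs.pos
    cases o <;> simp only [Op.apply, Op.Small] at h ⊢
    · exact h
    · omega
    · exact h
    · split_ifs <;> omega
    · split_ifs <;> omega

/-- Write `v` into register `x`. -/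
def State.setReg (s : State) (x v : ℕ) : State := { s with reg := Function.update s.reg x v }

/-- Write `v` into memory cell `m`. -/
def State.setMem (s : State) (m v : ℕ) : State := { s with mem := Function.update s.mem m v }

theorem Fits.setReg (hs : Fits W s) {v : ℕ} (x : ℕ) (hv : v ≤ W) : Fits W (s.setReg x v) := by
  refine ⟨hs.pos, fun y => ?_, hs.mem⟩
  simp only [State.setReg, Function.update_apply]
  split_ifs
  · exact hv
  · exact hs.reg y

theorem Fits.setMem (hs : Fits W s) {v : ℕ} (m : ℕ) (hv : v ≤ W) : Fits W (s.setMem m v) := by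
  refine ⟨hs.pos, hs.reg, fun y => ?_⟩
  simp only [State.setMem, Function.update_apply]
  split_ifs
  · exact hv
  · exact hs.mem y

/-- Only evaluated, hence fitting, values are ever written. Therefore `Fits` need not appear in any
invariant. -/
theorem Exec.fits {P : Prog} {t : ℕ} (h : Exec W P s s' t) (hs : Fits W s) : Fits W s' := by
  induction h with
  | skip => exact hs
  | assign he => exact hs.setReg _ (Expr.eval_le he)
  | store ha he => exact hs.setMem _ (Expr.eval_le he)
  | seq _ _ ih₁ ih₂ => exact ih₂ (ih₁ hs)
  | cond_true _ _ _ ih => exact ih hs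
  | cond_false _ _ ih => exact ih hs
  | loop_true _ _ _ _ ih₁ ih₂ => exact ih₂ (ih₁ hs)
  | loop_false => exact hs

/-- An upper bound for the time of a program each of whose loops has at most `b` iterations. -/
def Prog.time (b : ℕ) : Prog → ℕ
  | .skip => 1
  | .assign _ e => e.cost + 1
  | .store a e => a.cost + e.cost + 1
  | .seq p q => p.time b + q.time b
  | .cond c p q => c.cost + 1 + max (p.time b) (q.time b)
  | .loop c p => c.cost + 1 + b * (c.cost + 1 + p.time b)

/-- The nesting depth of loops. -/
def Prog.depth : Prog → ℕ
  | .skip => 0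
  | .assign _ _ => 0
  | .store _ _ => 0
  | .seq p q => max p.depth q.depth
  | .cond _ p q => max p.depth q.depth
  | .loop _ p => p.depth + 1

/-- This separates a constant of the program text from the iteration bound; with depth 2 and `b = 10
* q` it yields `O(q²)` without counting single instructions. -/
theorem Prog.time_le (hb : 1 ≤ b) (P : Prog) : P.time b ≤ P.time 1 * b ^ P.depth := by
  have key : ∀ {m d d' : ℕ}, d ≤ d' → m * b ^ d ≤ m * b ^ d' := fun h =>
    Nat.mul_le_mul_left _ (Nat.pow_le_pow_right hb h)
  induction P with
  | skip => simp [Prog.time, Prog.depth]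
  | assign => simp [Prog.time, Prog.depth]
  | store => simp [Prog.time, Prog.depth]
  | seq p q ihp ihq =>
    simp only [Prog.time, Prog.depth, add_mul]
    exact add_le_add (ihp.trans (key (le_max_left _ _))) (ihq.trans (key (le_max_right _ _)))
  | cond c p q ihp ihq =>
    simp only [Prog.time, Prog.depth]
    have h1 := ihp.trans (key (le_max_left p.depth q.depth))
    have h2 := ihq.trans (key (le_max_right p.depth q.depth))
    have h3 : 1 ≤ b ^ max p.depth q.depth := Nat.one_le_pow _ _ hb
    rw [add_mul]
    refine add_le_add (Nat.le_mul_of_pos_right _ h3) (max_le ?_ ?_)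
    · exact h1.trans (Nat.mul_le_mul_right _ (le_max_left _ _))
    · exact h2.trans (Nat.mul_le_mul_right _ (le_max_right _ _))
  | loop c p ih =>
    simp only [Prog.time, Prog.depth, one_mul]
    have h3 : 1 ≤ b ^ p.depth := Nat.one_le_pow _ _ hb
    have h4 : c.cost + 1 ≤ (c.cost + 1) * b ^ p.depth := Nat.le_mul_of_pos_right _ h3
    have h5 : c.cost + 1 ≤ (c.cost + 1) * (b ^ p.depth * b) :=
      Nat.le_mul_of_pos_right _ (Nat.mul_pos h3 hb)
    calc c.cost + 1 + b * (c.cost + 1 + p.time b)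
        ≤ (c.cost + 1) * (b ^ p.depth * b) +
          b * ((c.cost + 1) * b ^ p.depth + p.time 1 * b ^ p.depth) := by gcongr
      _ = _ := by rw [pow_succ]; ring

/-- Started in `s`, with words bounded by `W`, the program halts within its time bound, in a state
that satisfies `Q`. -/
def Runs (W b : ℕ) (P : Prog) (Q : State → Prop) (s : State) : Prop :=
  Fits W s → ∃ s' t, Exec W P s s' t ∧ t ≤ P.time b ∧ Q s'

variable {Q Q' : State → Prop} {p p' : Prog}

theorem Runs.mono (h : Runs W b p Q s) (hQ : ∀ s, Q s → Q' s) : Runs W b p Q' s := fun hs =>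
  let ⟨s', t, h1, h2, h3⟩ := h hs
  ⟨s', t, h1, h2, hQ _ h3⟩

theorem Runs.skip (h : Q s) : Runs W b .skip Q s := fun _ => ⟨s, _, .skip s, le_rfl, h⟩

theorem Runs.assign {x : ℕ} {e : Expr} (he : e.Ok W s) (h : Q (s.setReg x (e.den s))) :
    Runs W b (.assign x e) Q s := fun hs => ⟨_, _, .assign (hs.eval he), le_rfl, h⟩

theorem Runs.store {a e : Expr} (ha : a.Ok W s) (he : e.Ok W s)
    (h : Q (s.setMem (a.den s) (e.den s))) : Runs W b (.store a e) Q s :=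
  fun hs => ⟨_, _, .store (hs.eval ha) (hs.eval he), le_rfl, h⟩

theorem Runs.seq (h : Runs W b p (Runs W b p' Q) s) : Runs W b (.seq p p') Q s := fun hs =>
  let ⟨_, _, h1, h2, h3⟩ := h hs
  let ⟨s'', _, k1, k2, k3⟩ := h3 (h1.fits hs)
  ⟨s'', _, .seq h1 k1, add_le_add h2 k2, k3⟩

theorem Runs.cond {c : Expr} (hc : c.Ok W s) (h : c.den s ≠ 0 → Runs W b p Q s)
    (h' : c.den s = 0 → Runs W b p' Q s) : Runs W b (.cond c p p') Q s := fun hs => by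
  have he := hs.eval hc
  by_cases h0 : c.den s = 0
  · obtain ⟨s', t, h1, h2, h3⟩ := h' h0 hs
    exact ⟨s', _, .cond_false (h0 ▸ he) h1, Nat.add_le_add_left (h2.trans (le_max_right _ _)) _,
      h3⟩
  · obtain ⟨s', t, h1, h2, h3⟩ := h h0 hs
    exact ⟨s', _, .cond_true he h0 h1, Nat.add_le_add_left (h2.trans (le_max_left _ _)) _, h3⟩

/-- Kept apart from `Runs.loop` because the outer loop over the variables has `n` iterations, which
the common bound `b` of the inner loops does not cover. -/
theorem exec_loop {c : Expr} {τ : ℕ} (I : State → Prop) (μ : State → ℕ)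
    (hc : ∀ s, I s → c.Ok W s)
    (hp : ∀ s, I s → c.den s ≠ 0 → Fits W s →
      ∃ s' t, Exec W p s s' t ∧ t ≤ τ ∧ I s' ∧ μ s' < μ s)
    (h : I s) (hs : Fits W s) :
    ∃ s' t, Exec W (.loop c p) s s' t ∧ t ≤ c.cost + 1 + μ s * (c.cost + 1 + τ) ∧ I s' ∧
      c.den s' = 0 := by
  induction hn : μ s using Nat.strong_induction_on generalizing s with
  | _ m ih =>
    subst hn
    have he := hs.eval (hc s h)
    by_cases h0 : c.den s = 0
    · exact ⟨s, _, .loop_false (h0 ▸ he), Nat.le_add_right _ _, h, h0⟩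
    · obtain ⟨s', t, h1, h2, h3, h4⟩ := hp s h h0 hs
      obtain ⟨s'', t', k1, k2, k3⟩ := ih _ h4 h3 (h1.fits hs) rfl
      refine ⟨s'', _, .loop_true he h0 h1 k1, ?_, k3⟩
      have h5 : (μ s' + 1) * (c.cost + 1 + τ) ≤ μ s * (c.cost + 1 + τ) :=
        Nat.mul_le_mul_right _ h4
      rw [add_mul, one_mul] at h5
      omega

theorem Runs.loop {c : Expr} (I : State → Prop) (μ : State → ℕ) (h : I s) (hb : μ s ≤ b)
    (hc : ∀ s, I s → c.Ok W s)
    (hp : ∀ s, I s → c.den s ≠ 0 → Runs W b p (fun s' => I s' ∧ μ s' < μ s) s)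
    (hQ : ∀ s, I s → c.den s = 0 → Q s) : Runs W b (.loop c p) Q s := fun hs => by
  obtain ⟨s', t, h1, h2, h3, h4⟩ := exec_loop (τ := p.time b) I μ hc (fun s h h' => hp s h h') h hs
  exact ⟨s', t, h1, h2.trans (Nat.add_le_add_left (Nat.mul_le_mul_right _ hb) _), hQ _ h3 h4⟩

/-! ### Simplification of expressions and states -/

@[simp] theorem den_ofNat (k : ℕ) : (ofNat(k) : Expr).den s = k := rfl
@[simp] theorem den_lit (k : ℕ) : (Expr.lit k).den s = k := rfl
@[simp] theorem den_reg (x : ℕ) : (Expr.reg x).den s = s.reg x := rfl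
@[simp] theorem den_load (x : Expr) : (Expr.load x).den s = s.mem (x.den s) := rfl
@[simp] theorem den_add (x y : Expr) : (x + y).den s = x.den s + y.den s := rfl
@[simp] theorem den_sub (x y : Expr) : (x - y).den s = x.den s - y.den s := rfl
@[simp] theorem den_mul (x y : Expr) : (x * y).den s = x.den s * y.den s := rfl
@[simp] theorem den_lt (x y : Expr) : (x.lt y).den s = if x.den s < y.den s then 1 else 0 := rfl
@[simp] theorem den_eq (x y : Expr) : (x.eq y).den s = if x.den s = y.den s then 1 else 0 := rfl
@[simp] theorem ok_ofNat (k : ℕ) : (ofNat(k) : Expr).Ok W s ↔ k ≤ W := Iff.rfl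
@[simp] theorem ok_lit (k : ℕ) : (Expr.lit k).Ok W s ↔ k ≤ W := Iff.rfl
@[simp] theorem ok_reg (x : ℕ) : (Expr.reg x).Ok W s ↔ True := Iff.rfl
@[simp] theorem ok_load (x : Expr) : (Expr.load x).Ok W s ↔ x.Ok W s := Iff.rfl
@[simp] theorem ok_add (x y : Expr) :
    (x + y).Ok W s ↔ x.Ok W s ∧ y.Ok W s ∧ x.den s + y.den s ≤ W := Iff.rfl
@[simp] theorem ok_mul (x y : Expr) :
    (x * y).Ok W s ↔ x.Ok W s ∧ y.Ok W s ∧ x.den s * y.den s ≤ W := Iff.rfl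
@[simp] theorem ok_sub (x y : Expr) : (x - y).Ok W s ↔ x.Ok W s ∧ y.Ok W s :=
  and_congr_right fun _ => and_iff_left trivial
@[simp] theorem ok_lt (x y : Expr) : (x.lt y).Ok W s ↔ x.Ok W s ∧ y.Ok W s :=
  and_congr_right fun _ => and_iff_left trivial
@[simp] theorem ok_eq (x y : Expr) : (x.eq y).Ok W s ↔ x.Ok W s ∧ y.Ok W s :=
  and_congr_right fun _ => and_iff_left trivial

@[simp] theorem reg_setReg (x v y : ℕ) :
    (s.setReg x v).reg y = if y = x then v else s.reg y := Function.update_apply _ _ _ _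
@[simp] theorem mem_setReg (x v : ℕ) : (s.setReg x v).mem = s.mem := rfl
@[simp] theorem reg_setMem (m v : ℕ) : (s.setMem m v).reg = s.reg := rfl
theorem mem_setMem (m v y : ℕ) :
    (s.setMem m v).mem y = if y = m then v else s.mem y := Function.update_apply _ _ _ _

/-! ### Arrays

Sixteen arrays are interleaved in the memory above the address in register `3`. -/

/-- The `t`-th entry of the array `f`. -/
def State.fld (s : State) (f t : ℕ) : ℕ := s.mem (s.reg 3 + (16 * t + f))

/-- Write `v` into the `t`-th entry of the array `f`. -/
def State.setFld (s : State) (f t v : ℕ) : State := s.setMem (s.reg 3 + (16 * t + f)) v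

/-- The address of the `t`-th entry of the array `f`. -/
def Expr.addr (f : ℕ) (t : Expr) : Expr := .reg 3 + (16 * t + .lit f)

/-- The `t`-th entry of the array `f`, as an expression. -/
def Expr.arr (f : ℕ) (t : Expr) : Expr := .load (Expr.addr f t)

/-- Write `e` into the `t`-th entry of the array `f`. -/
def Prog.put (f : ℕ) (t e : Expr) : Prog := .store (Expr.addr f t) e

@[simp] theorem den_arr (f : ℕ) (t : Expr) : (Expr.arr f t).den s = s.fld f (t.den s) := rfl

theorem ok_addr (f : ℕ) (t : Expr) : (Expr.addr f t).Ok W s ↔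
    t.Ok W s ∧ 16 ≤ W ∧ s.reg 3 + (16 * t.den s + f) ≤ W := by
  simp only [Expr.addr, ok_add, ok_mul, ok_reg, ok_ofNat, ok_lit, den_add, den_mul, den_reg,
    den_ofNat, den_lit, true_and]
  constructor
  · rintro ⟨⟨⟨h1, h2, h3⟩, h4, h5⟩, h6⟩
    exact ⟨h2, h1, h6⟩
  · rintro ⟨h1, h2, h3⟩
    exact ⟨⟨⟨h2, h1, by omega⟩, by omega, by omega⟩, h3⟩

@[simp] theorem ok_arr (f : ℕ) (t : Expr) : (Expr.arr f t).Ok W s ↔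
    t.Ok W s ∧ 16 ≤ W ∧ s.reg 3 + (16 * t.den s + f) ≤ W := ok_addr f t

theorem Runs.put {f : ℕ} {t e : Expr}
    (h1 : t.Ok W s ∧ 16 ≤ W ∧ s.reg 3 + (16 * t.den s + f) ≤ W) (h2 : e.Ok W s)
    (h : Q (s.setFld f (t.den s) (e.den s))) : Runs W b (.put f t e) Q s :=
  Runs.store ((ok_addr f t).2 h1) h2 h

@[simp] theorem reg_setFld (f t v : ℕ) : (s.setFld f t v).reg = s.reg := rfl

theorem fld_setFld {f f' : ℕ} (hf : f < 16) (hf' : f' < 16) (t t' v : ℕ) :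
    (s.setFld f t v).fld f' t' = if f' = f ∧ t' = t then v else s.fld f' t' := by
  unfold State.fld State.setFld
  rw [mem_setMem]
  congr 1
  simp only [reg_setMem, eq_iff_iff]
  omega

@[simp] theorem fld_setReg {x : ℕ} (hx : x ≠ 3) (v f : ℕ) :
    (s.setReg x v).fld f = s.fld f := by
  funext t
  unfold State.fld
  rw [reg_setReg, if_neg hx.symm, mem_setReg]

theorem fld_setMem {m : ℕ} (hm : m < s.reg 3) (v f t : ℕ) :
    (s.setMem m v).fld f t = s.fld f t := by
  unfold State.fld
  rw [mem_setMem, reg_setMem, if_neg (by omega)]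

theorem mem_setFld {a : ℕ} (ha : a < s.reg 3) (f t v : ℕ) : (s.setFld f t v).mem a = s.mem a := by
  unfold State.setFld
  rw [mem_setMem, if_neg (by omega)]

/-- The registers below `20`, the array entries except those in `F`, and the memory cells below the
arrays except those in `F 16` are unchanged. -/
structure Frame (F : ℕ → ℕ → Prop) (s s' : State) : Prop where
  reg : ∀ x < 20, s'.reg x = s.reg x
  low : ∀ a < s.reg 3, ¬ F 16 a → s'.mem a = s.mem a
  fld : ∀ f < 16, ∀ t, ¬ F f t → s'.fld f t = s.fld f t

variable {F G : ℕ → ℕ → Prop}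

theorem Frame.refl (F : ℕ → ℕ → Prop) (s : State) : Frame F s s :=
  ⟨fun _ _ => rfl, fun _ _ _ => rfl, fun _ _ _ _ => rfl⟩

theorem Frame.trans {s'' : State} (h : Frame F s s') (h' : Frame F s' s'') : Frame F s s'' :=
  ⟨fun x hx => (h'.reg x hx).trans (h.reg x hx), fun a ha hF => (h'.low a (by
    rw [h.reg 3 (by decide)]; exact ha) hF).trans (h.low a ha hF),
    fun f hf t ht => (h'.fld f hf t ht).trans (h.fld f hf t ht)⟩

theorem Frame.mono (h : Frame F s s') (hFG : ∀ f t, F f t → G f t) : Frame G s s' :=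
  ⟨h.reg, fun a ha hF => h.low a ha fun h' => hF (hFG 16 a h'),
    fun f hf t ht => h.fld f hf t fun h' => ht (hFG f t h')⟩

theorem Frame.setReg (h : Frame F s s') {x : ℕ} (hx : 20 ≤ x) (v : ℕ) :
    Frame F s (s'.setReg x v) :=
  ⟨fun y hy => by rw [reg_setReg, if_neg (by omega), h.reg y hy], h.low,
    fun f hf t ht => by rw [fld_setReg (by omega), h.fld f hf t ht]⟩

theorem Frame.setFld (h : Frame F s s') {f t : ℕ} (hf : f < 16) (ht : F f t) (v : ℕ) :
    Frame F s (s'.setFld f t v) :=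
  ⟨h.reg, fun a ha hF => by
      rw [mem_setFld (by rw [h.reg 3 (by decide)]; exact ha), h.low a ha hF],
    fun f' hf' t' ht' => by
      rw [fld_setFld hf hf', if_neg, h.fld f' hf' t' ht']
      rintro ⟨rfl, rfl⟩
      exact ht' ht⟩

theorem Frame.setMem (h : Frame F s s') {m : ℕ} (hm : m < s.reg 3) (hF : F 16 m) (v : ℕ) :
    Frame F s (s'.setMem m v) :=
  ⟨h.reg, fun a ha hFa => by
      rw [mem_setMem, if_neg, h.low a ha hFa]
      rintro rfl
      exact hFa hF,
    fun f hf t ht => by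
      rw [fld_setMem (by rw [h.reg 3 (by decide)]; exact hm), h.fld f hf t ht]⟩

end Machine

/-! ### Loops over array entries, stored tables, prefix and suffix letters -/

section Blocks

/-- The minimum of two numbers, as an expression. -/
def Expr.min (x y : Expr) : Expr := x - (x - y)

/-- The maximum of two numbers, as an expression. -/
def Expr.max (x y : Expr) : Expr := x + (y - x)

@[simp] theorem den_min {s : State} (x y : Expr) :
    (Expr.min x y).den s = Min.min (x.den s) (y.den s) := by
  simp only [Expr.min, den_sub]
  omega

@[simp] theorem den_max {s : State} (x y : Expr) :
    (Expr.max x y).den s = Max.max (x.den s) (y.den s) := by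
  simp only [Expr.max, den_add, den_sub]
  omega

@[simp] theorem ok_min {W : ℕ} {s : State} (x y : Expr) :
    (Expr.min x y).Ok W s ↔ x.Ok W s ∧ y.Ok W s := by
  simp only [Expr.min, ok_sub]
  tauto

@[simp] theorem ok_max {W : ℕ} {s : State} (x y : Expr) :
    (Expr.max x y).Ok W s ↔ x.Ok W s ∧ y.Ok W s ∧ Max.max (x.den s) (y.den s) ≤ W := by
  simp only [Expr.max, ok_add, ok_sub, den_sub]
  have : x.den s + (y.den s - x.den s) = Max.max (x.den s) (y.den s) := by omega
  rw [this]
  tauto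

infixr:60 " ;; " => Prog.seq

/-- Run `p` with register `20` going from `lo` to `hi - 1`. -/
def Prog.for (lo hi : Expr) (p : Prog) : Prog :=
  .assign 20 lo ;; .assign 21 hi ;;
    .loop ((Expr.reg 20).lt (.reg 21)) (p ;; .assign 20 (.reg 20 + 1))

variable {W b : ℕ} {s s₀ : State} {F : ℕ → ℕ → Prop} {Q : State → Prop} {p : Prog}

/-- A loop that writes the entries at `t k` of the arrays in `fs`, for `lo ≤ k < hi`. -/
theorem Runs.for {lo hi : ℕ} {elo ehi : Expr} (fs : List ℕ) (t : ℕ → ℕ) (v : ℕ → ℕ → ℕ)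
    (hfs : ∀ f ∈ fs, f < 16)
    (h1 : elo.Ok W s) (h2 : elo.den s = lo)
    (h3 : ehi.Ok W (s.setReg 20 lo)) (h4 : ehi.den (s.setReg 20 lo) = hi)
    (hW : hi < W) (hb : hi ≤ lo + b)
    (ht : ∀ k m, lo ≤ k → k < hi → lo ≤ m → m < hi → t k = t m → k = m)
    (step : ∀ k s', lo ≤ k → k < hi → s'.reg 20 = k →
      Frame (fun f u => f ∈ fs ∧ ∃ m, lo ≤ m ∧ m < hi ∧ u = t m) s s' →
      (∀ m, lo ≤ m → m < k → ∀ f ∈ fs, s'.fld f (t m) = v f m) →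
      Runs W b p (fun s'' => s''.reg 20 = s'.reg 20 ∧ s''.reg 21 = s'.reg 21 ∧
        Frame (fun f u => f ∈ fs ∧ u = t k) s' s'' ∧ ∀ f ∈ fs, s''.fld f (t k) = v f k) s')
    (hQ : ∀ s', Frame (fun f u => f ∈ fs ∧ ∃ m, lo ≤ m ∧ m < hi ∧ u = t m) s s' →
      (∀ m, lo ≤ m → m < hi → ∀ f ∈ fs, s'.fld f (t m) = v f m) → Q s') :
    Runs W b (.for elo ehi p) Q s := by
  refine Runs.seq (Runs.assign h1 (Runs.seq ?_))
  rw [h2]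
  refine Runs.assign h3 ?_
  rw [h4]
  refine Runs.loop (fun s' => lo ≤ s'.reg 20 ∧ s'.reg 21 = hi ∧
    Frame (fun f u => f ∈ fs ∧ ∃ m, lo ≤ m ∧ m < hi ∧ u = t m) s s' ∧
    ∀ m, lo ≤ m → m < s'.reg 20 → m < hi → ∀ f ∈ fs, s'.fld f (t m) = v f m)
    (fun s' => hi - s'.reg 20) ⟨?_, ?_, ?_, ?_⟩ ?_ ?_ ?_ ?_
  · simp
  · simp
  · exact ((Frame.refl _ s).setReg (by omega) _).setReg (by omega) _
  · intro m hm hm'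
    simp at hm'
    omega
  · simp
    omega
  · intro s _
    simp
  · rintro s' ⟨i1, i2, i3, i4⟩ hc
    rw [den_lt, den_reg, den_reg, i2] at hc
    have hlt : s'.reg 20 < hi := by
      by_contra h
      simp [h] at hc
    refine Runs.seq ((step _ s' i1 hlt rfl i3 fun m h h' => i4 m h h' (by omega)).mono ?_)
    rintro s'' ⟨j1, j2, j3, j4⟩
    refine Runs.assign ?_ ?_
    · simp only [ok_add, ok_reg, ok_ofNat, den_reg, den_ofNat, j1, true_and]
      omega
    · simp only [den_add, den_reg, den_ofNat, j1, reg_setReg]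
      refine ⟨⟨by simp; omega, by simp [j2, i2], ?_, fun m hm hm' hm'' f hf => ?_⟩, by simp; omega⟩
      · refine (i3.trans (j3.mono ?_)).setReg (by omega) _
        rintro f u ⟨hf, rfl⟩
        exact ⟨hf, _, i1, hlt, rfl⟩
      · rw [fld_setReg (by omega)]
        simp only [if_true] at hm'
        by_cases hmk : m = s'.reg 20
        · rw [hmk]
          exact j4 f hf
        -- Injectivity of `t` on the range keeps the entries of earlier iterations intact.
        · rw [j3.fld f (hfs f hf) _ fun h => hmk (ht _ _ hm hm'' i1 hlt h.2)]
          exact i4 m hm (by omega) hm'' f hf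
  · rintro s ⟨i1, i2, i3, i4⟩ hc
    rw [den_lt, den_reg, den_reg, i2] at hc
    have hlt : hi ≤ s.reg 20 := by
      by_contra h
      simp [not_le.1 h] at hc
    exact hQ s i3 fun m hm hm' => i4 m hm (by omega) hm'

/-- The information that is stored for a variable that derives a string `x` of length `len`;
`g f t` is the `t`-th of the entries for this variable in the array `f`. -/
structure Table (q len : ℕ) (x : ℕ → ℕ) (g : ℕ → ℕ → ℕ) : Prop where
  pre : ∀ p, 1 ≤ p → p ≤ 3 * q → p ≤ len → g 1 p = x p
  suf : ∀ p, p < 3 * q → p < len → g 2 p = x (len - p)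
  count : ∀ p, q ≤ p + 1 → p < 3 * q → p < len → g 3 p = count x q (len - p)
  final : ∀ p, q ≤ p + 1 → p < 3 * q → p < len → g 4 p = final x q (len - p)
  endPos : ∀ j, 1 ≤ j → j < q → j + q ≤ len + 1 → g 5 j = chainEnd x q len j
  endCount : ∀ j, 1 ≤ j → j < q → j + q ≤ len + 1 →
    g 6 j = SLPNonOverlap.count x q (chainEnd x q len j)
  endFinal : ∀ j, 1 ≤ j → j < q → j + q ≤ len + 1 →
    g 7 j = SLPNonOverlap.final x q (chainEnd x q len j)

/-- The numbers that occur when the variable number `i` is processed: lengths `a` and `c` of the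
two parts, positions `I`, `L`, `R` of the entries for the variable and its parts, address `O` of
its part of the output. -/
structure Dims (W b n q V i a c I L R O : ℕ) : Prop where
  two_le : 2 ≤ q
  b_eq : b = 10 * q
  q_le : q ≤ V
  n_le : n ≤ V
  lt : i < n
  a_pos : 1 ≤ a
  c_pos : 1 ≤ c
  I_le : I + 4 * q ≤ 4 * V
  L_le : L + 4 * q ≤ I
  R_le : R + 4 * q ≤ I
  le_O : 3 * n ≤ O
  O_le : O + 3 * q ≤ 3 * n + 3 * V
  W_le : 1000 * (V + a + c) ≤ W

/-- The contents of the registers when a variable is processed. -/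
structure Ctx (n q V i a c I L R O : ℕ) (s : State) : Prop where
  r1 : s.reg 1 = q
  r2 : s.reg 2 = i
  r3 : s.reg 3 = 3 * n + 3 * V
  r6 : s.reg 6 = a
  r7 : s.reg 7 = a + c
  r8 : s.reg 8 = I
  r9 : s.reg 9 = L
  r10 : s.reg 10 = R
  r11 : s.reg 11 = a - 3 * q
  r12 : s.reg 12 = min (a + 3 * q) (a + c)
  r13 : s.reg 13 = max 1 (a + 3 - 2 * q)
  r14 : s.reg 14 = min (a + q) (a + c + 2 - q)
  r15 : s.reg 15 = 2 * q - 2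
  r16 : s.reg 16 = O
  r17 : s.reg 17 = c

variable {n q V i a c I L R O : ℕ} {x y z : ℕ → ℕ}

theorem Ctx.of_frame {s : State} (h : Ctx n q V i a c I L R O s₀) (hF : Frame F s₀ s) :
    Ctx n q V i a c I L R O s := by
  constructor <;> rw [hF.reg _ (by decide)]
  exacts [h.r1, h.r2, h.r3, h.r6, h.r7, h.r8, h.r9, h.r10, h.r11, h.r12, h.r13, h.r14, h.r15,
    h.r16, h.r17]

theorem Ctx.setReg {s : State} (h : Ctx n q V i a c I L R O s) {x : ℕ} (hx : 20 ≤ x) (v : ℕ) :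
    Ctx n q V i a c I L R O (s.setReg x v) :=
  h.of_frame ((Frame.refl (fun _ _ => False) s).setReg hx v)

/-- Compute the prefix and the suffix of the string. -/
def textProg : Prog :=
  .for 1 (Expr.min (3 * .reg 1) (.reg 7) + 1)
    (.cond ((Expr.reg 20).lt (.reg 6 + 1))
      (.put 1 (.reg 8 + .reg 20) (.arr 1 (.reg 9 + .reg 20)))
      (.put 1 (.reg 8 + .reg 20) (.arr 1 (.reg 10 + (.reg 20 - .reg 6))))) ;;
  .for 0 (Expr.min (3 * .reg 1) (.reg 7))
    (.cond ((Expr.reg 20).lt (.reg 17))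
      (.put 2 (.reg 8 + .reg 20) (.arr 2 (.reg 10 + .reg 20)))
      (.put 2 (.reg 8 + .reg 20) (.arr 2 (.reg 9 + (.reg 20 - .reg 17)))))

theorem runs_textProg (hd : Dims W b n q V i a c I L R O) (h : Ctx n q V i a c I L R O s)
    (hx : Table q a x fun f t => s.fld f (L + t)) (hy : Table q c y fun f t => s.fld f (R + t))
    (hzx : CopyOf z x 0 a) (hzy : CopyOf z y a c) :
    Runs W b textProg (fun s' =>
      Frame (fun f t => (f = 1 ∨ f = 2) ∧ I ≤ t ∧ t < I + 4 * q) s s' ∧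
      (∀ p, 1 ≤ p → p ≤ 3 * q → p ≤ a + c → s'.fld 1 (I + p) = z p) ∧
      (∀ p, p < 3 * q → p < a + c → s'.fld 2 (I + p) = z (a + c - p))) s := by
  obtain ⟨d1, d2, d3, d4, d5, d6, d7, d8, d9, d10, d11, d12, d13⟩ := hd
  refine Runs.seq (Runs.for (lo := 1) (hi := min (3 * q) (a + c) + 1)
    [1] (fun p => I + p) (fun _ p => z p) ?_ ?_ ?_ ?_ ?_ ?_ ?_ ?_ ?_ ?_)
  · simp
  · simp; omega
  · simp
  · simp [h.r1]; omega
  · simp [h.r1, h.r7]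
  · omega
  · omega
  · intro k m _ _ _ _ hkm
    omega
  · intro k s' hk hk' r20 hF hm
    have h' := h.of_frame hF
    refine Runs.cond (by simp [h'.r6]; omega) (fun hc => ?_) (fun hc => ?_)
    · simp [r20, h'.r6] at hc
      refine Runs.put (by simp [h'.r8, h'.r3, r20]; omega) (by simp [h'.r9, h'.r3, r20]; omega) ?_
      simp only [den_add, den_reg, den_arr, h'.r8, r20, h'.r9]
      refine ⟨by simp [r20], by simp, (Frame.refl _ _).setFld (by decide) (by simp) _, ?_⟩
      simp only [List.mem_singleton, forall_eq]
      rw [fld_setFld (by decide) (by decide), if_pos ⟨rfl, rfl⟩, hF.fld _ (by decide),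
        hx.pre k hk (by omega) (by omega), hzx k hk (by omega), Nat.zero_add]
      rintro ⟨-, m, h1, h2, h3⟩
      omega
    · simp [r20, h'.r6] at hc
      refine Runs.put (by simp [h'.r8, h'.r3, r20]; omega)
        (by simp [h'.r10, h'.r6, h'.r3, r20]; omega) ?_
      simp only [den_add, den_sub, den_reg, den_arr, h'.r8, r20, h'.r10, h'.r6]
      refine ⟨by simp [r20], by simp, (Frame.refl _ _).setFld (by decide) (by simp) _, ?_⟩
      simp only [List.mem_singleton, forall_eq]
      rw [fld_setFld (by decide) (by decide), if_pos ⟨rfl, rfl⟩, hF.fld _ (by decide),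
        hy.pre _ (by omega) (by omega) (by omega),
        hzy _ (by omega) (by omega), Nat.add_sub_cancel' (by omega)]
      rintro ⟨-, m, h1, h2, h3⟩
      omega
  · intro s₁ hF₁ h₁
    have h := h.of_frame hF₁
    refine (Runs.for (lo := 0) (hi := min (3 * q) (a + c))
      [2] (fun p => I + p) (fun _ p => z (a + c - p)) ?_ ?_ ?_ ?_ ?_ ?_ ?_ ?_ ?_ ?_)
    · simp
    · simp
    · simp
    · simp [h.r1]; omega
    · simp [h.r1, h.r7]
    · omega
    · omega
    · intro k m _ _ _ _ hkm
      omega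
    · intro k s' hk hk' r20 hF hm
      have h' := h.of_frame hF
      refine Runs.cond (by simp) (fun hc => ?_) (fun hc => ?_)
      · simp [r20, h'.r17] at hc
        refine Runs.put (by simp [h'.r8, h'.r3, r20]; omega)
          (by simp [h'.r10, h'.r3, r20]; omega) ?_
        simp only [den_add, den_reg, den_arr, h'.r8, r20, h'.r10]
        refine ⟨by simp [r20], by simp, (Frame.refl _ _).setFld (by decide) (by simp) _, ?_⟩
        simp only [List.mem_singleton, forall_eq]
        rw [fld_setFld (by decide) (by decide), if_pos ⟨rfl, rfl⟩, hF.fld _ (by decide),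
          hF₁.fld _ (by decide), hy.suf k (by omega) (by omega), hzy _ (by omega) (by omega),
          Nat.add_sub_assoc (by omega)]
        · simp
        · rintro ⟨-, m, h1, h2, h3⟩
          omega
      · simp [r20, h'.r17] at hc
        refine Runs.put (by simp [h'.r8, h'.r3, r20]; omega)
          (by simp [h'.r9, h'.r17, h'.r3, r20]; omega) ?_
        simp only [den_add, den_sub, den_reg, den_arr, h'.r8, r20, h'.r9, h'.r17]
        refine ⟨by simp [r20], by simp, (Frame.refl _ _).setFld (by decide) (by simp) _, ?_⟩
        simp only [List.mem_singleton, forall_eq]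
        rw [fld_setFld (by decide) (by decide), if_pos ⟨rfl, rfl⟩, hF.fld _ (by decide),
          hF₁.fld _ (by decide), hx.suf _ (by omega) (by omega), hzx _ (by omega) (by omega)]
        · congr 1
          omega
        · simp
        · rintro ⟨-, m, h1, h2, h3⟩
          omega
    · intro s₂ hF₂ h₂
      refine ⟨(hF₁.mono ?_).trans (hF₂.mono ?_), fun p h1 h2 h3 => ?_, fun p h1 h2 => ?_⟩
      · rintro f u ⟨hf, m, h1, h2, rfl⟩
        simp at hf
        omega
      · rintro f u ⟨hf, m, h1, h2, rfl⟩
        simp at hf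
        omega
      · rw [hF₂.fld _ (by decide) _ (by simp)]
        exact h₁ p h1 (by omega) 1 (by simp)
      · exact h₂ p (by omega) (by omega) 2 (by simp)

end Blocks

/-! ### The window around the boundary and its overlapping equal pairs -/

section Blocks

variable {W b : ℕ} {s s₀ : State} {F : ℕ → ℕ → Prop} {Q : State → Prop} {p : Prog}
variable {n q V i a c I L R O : ℕ} {x y z : ℕ → ℕ}

/-- Copy the part of the string around the boundary of the two parts to array `8`. -/
def windowProg : Prog :=
  .for (.reg 11 + 1) (.reg 12 + 1)
    (.cond ((Expr.reg 20).lt (.reg 6 + 1))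
      (.put 8 (.reg 20) (.arr 2 (.reg 9 + (.reg 6 - .reg 20))))
      (.put 8 (.reg 20) (.arr 1 (.reg 10 + (.reg 20 - .reg 6)))) ;;
    .put 9 (.reg 20) 0 ;; .put 15 (.reg 20) 0)

theorem runs_windowProg (hd : Dims W b n q V i a c I L R O) (h : Ctx n q V i a c I L R O s)
    (hx : Table q a x fun f t => s.fld f (L + t)) (hy : Table q c y fun f t => s.fld f (R + t))
    (hzx : CopyOf z x 0 a) (hzy : CopyOf z y a c) :
    Runs W b windowProg (fun s' =>
      Frame (fun f _ => f = 8 ∨ f = 9 ∨ f = 15) s s' ∧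
      ∀ k, a - 3 * q < k → k ≤ min (a + 3 * q) (a + c) →
        s'.fld 8 k = z k ∧ s'.fld 9 k = 0 ∧ s'.fld 15 k = 0) s := by
  obtain ⟨d1, d2, d3, d4, d5, d6, d7, d8, d9, d10, d11, d12, d13⟩ := hd
  refine Runs.for (lo := a - 3 * q + 1) (hi := min (a + 3 * q) (a + c) + 1)
    [8, 9, 15] (fun p => p) (fun f p => if f = 8 then z p else 0) ?_ ?_ ?_ ?_ ?_ ?_ ?_ ?_ ?_ ?_
  · simp
  · simp [h.r11]; omega
  · simp [h.r11]
  · simp [h.r12]; omega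
  · simp [h.r12]
  · omega
  · omega
  · intro k m _ _ _ _ hkm
    exact hkm
  · intro k s' hk hk' r20 hF hm
    have h' := h.of_frame hF
    have key : ∀ v, v = z k → Runs W b (.put 9 (.reg 20) 0 ;; .put 15 (.reg 20) 0)
        (fun s'' => s''.reg 20 = k ∧ s''.reg 21 = s'.reg 21 ∧
        Frame (fun f u => f ∈ [8, 9, 15] ∧ u = k) s' s'' ∧
        ∀ f ∈ [8, 9, 15], s''.fld f k = if f = 8 then z k else 0) (s'.setFld 8 k v) := by
      intro v hv
      refine Runs.seq (Runs.put (by simp [h'.r3, r20]; omega) (by simp) ?_)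
      refine Runs.put (by simp [h'.r3, r20]; omega) (by simp) ?_
      simp only [den_reg, reg_setFld, r20, den_ofNat]
      refine ⟨trivial, trivial, (((Frame.refl _ _).setFld (by decide) (by simp) _).setFld
        (by decide) (by simp) _).setFld (by decide) (by simp) _, ?_⟩
      simp [fld_setFld, hv]
    refine Runs.seq (Runs.cond (by simp [h'.r6]; omega) (fun hc => ?_) (fun hc => ?_))
    · simp [r20, h'.r6] at hc
      refine Runs.put (by simp [h'.r3, r20]; omega)
        (by simp [h'.r9, h'.r3, h'.r6, r20]; omega) ?_
      simp only [den_add, den_sub, den_reg, den_arr, r20, h'.r9, h'.r6]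
      refine key _ ?_
      rw [hF.fld _ (by decide) _ (by simp), hx.suf _ (by omega) (by omega),
        hzx _ (by omega) (by omega), Nat.zero_add]
      congr 1
      omega
    · simp [r20, h'.r6] at hc
      refine Runs.put (by simp [h'.r3, r20]; omega)
        (by simp [h'.r10, h'.r6, h'.r3, r20]; omega) ?_
      simp only [den_add, den_sub, den_reg, den_arr, r20, h'.r10, h'.r6]
      refine key _ ?_
      rw [hF.fld _ (by decide) _ (by simp), hy.pre _ (by omega) (by omega) (by omega),
        hzy _ (by omega) (by omega), Nat.add_sub_cancel' (by omega)]
  · intro s₁ hF₁ h₁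
    refine ⟨hF₁.mono ?_, fun k hk hk' => ?_⟩
    · rintro f u ⟨hf, -⟩
      simpa using hf
    · have := h₁ k hk (by omega)
      simpa using this

/-- The `q`-grams at `k' < k` in the part `o + 1, …, e` of the text are equal and overlap. -/
structure Overlap (z : ℕ → ℕ) (q o e k' k : ℕ) : Prop where
  lt_left : o < k'
  lt : k' < k
  lt_add : k < k' + q
  le_right : k + q ≤ e + 1
  match_eq : Match z q k' k

/-- `A` and `N` contain the nearest overlapping pairs of equal `q`-grams `(k', k)` with
`k - k' < d`,
or `k - k' = d` and `p ≤ k'`. -/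
structure Links (z : ℕ → ℕ) (q o e d p : ℕ) (A N : ℕ → ℕ) : Prop where
  prv_zero : ∀ k, o < k → k ≤ e → A k = 0 → ∀ k', Overlap z q o e k' k →
    d ≤ k - k' ∧ (k - k' = d → k' < p)
  prv_pos : ∀ k, o < k → k ≤ e → A k ≠ 0 → Overlap z q o e (A k) k ∧
    ∀ k', Overlap z q o e k' k → k' ≤ A k
  nxt_zero : ∀ k, o < k → k ≤ e → N k = 0 → ∀ k', Overlap z q o e k k' →
    d ≤ k' - k ∧ (k' - k = d → k < p)
  nxt_pos : ∀ k, o < k → k ≤ e → N k ≠ 0 → Overlap z q o e k (N k) ∧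
    ∀ k', Overlap z q o e k k' → N k ≤ k'

variable {o e d p' : ℕ} {A N A' N' : ℕ → ℕ}

theorem Links.step_of_not (h : Links z q o e d (p' + 1) A N)
    (hn : ¬ Overlap z q o e p' (p' + d)) : Links z q o e d p' A N := by
  constructor
  · intro k h1 h2 h3 k' h4
    obtain ⟨h5, h6⟩ := h.prv_zero k h1 h2 h3 k' h4
    refine ⟨h5, fun h7 => ?_⟩
    have h8 := h4.lt
    have : k' ≠ p' := by
      rintro rfl
      apply hn
      obtain rfl : k = k' + d := by omega
      exact h4
    have := h6 h7
    omega
  · exact h.prv_pos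
  · intro k h1 h2 h3 k' h4
    obtain ⟨h5, h6⟩ := h.nxt_zero k h1 h2 h3 k' h4
    refine ⟨h5, fun h7 => ?_⟩
    have h8 := h4.lt
    have : k ≠ p' := by
      rintro rfl
      apply hn
      obtain rfl : k' = k + d := by omega
      exact h4
    have := h6 h7
    omega
  · exact h.nxt_pos

/-- Distances are treated in increasing order, so an entry that is still `0` has no nearer partner
and the pair just found is the nearest. Entries that are already set must be kept. -/
theorem Links.step (h : Links z q o e d (p' + 1) A N)
    (ho : Overlap z q o e p' (p' + d))
    (hA : ∀ k, A' k = if k = p' + d ∧ A k = 0 then p' else A k)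
    (hN : ∀ k, N' k = if k = p' ∧ N k = 0 then p' + d else N k) :
    Links z q o e d p' A' N' := by
  have o1 := ho.lt_left
  have o2 := ho.lt
  constructor
  · intro k h1 h2 h3 k' h4
    rw [hA] at h3
    split_ifs at h3 with hk
    · omega
    · obtain ⟨h5, h6⟩ := h.prv_zero k h1 h2 h3 k' h4
      have h8 := h4.lt
      omega
  · intro k h1 h2 h3
    rw [hA] at h3 ⊢
    split_ifs at h3 ⊢ with hk
    · obtain ⟨rfl, hk0⟩ := hk
      refine ⟨ho, fun k' h4 => ?_⟩
      have := h.prv_zero _ h1 h2 hk0 k' h4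
      omega
    · exact h.prv_pos k h1 h2 h3
  · intro k h1 h2 h3 k' h4
    rw [hN] at h3
    split_ifs at h3 with hk
    · omega
    · obtain ⟨h5, h6⟩ := h.nxt_zero k h1 h2 h3 k' h4
      have h8 := h4.lt
      omega
  · intro k h1 h2 h3
    rw [hN] at h3 ⊢
    split_ifs at h3 ⊢ with hk
    · obtain ⟨rfl, hk0⟩ := hk
      refine ⟨ho, fun k' h4 => ?_⟩
      have := h.nxt_zero _ h1 h2 hk0 k' h4
      have := h4.lt
      omega
    · exact h.nxt_pos k h1 h2 h3

/-- Once the scan has reached `o + 1`, all pairs at distance `d` are covered. No pair at distance `d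
+ 1` starts at or after `e + 1 - (d + 1)`, as its right member would stick out of the window. -/
theorem Links.succ (h : Links z q o e d p' A N) (hp : p' ≤ o + 1) (hq : 1 ≤ q) :
    Links z q o e (d + 1) (e + 1 - (d + 1)) A N := by
  refine ⟨fun k h1 h2 h3 k' h4 => ?_, h.prv_pos, fun k h1 h2 h3 k' h4 => ?_, h.nxt_pos⟩
  · have := h.prv_zero k h1 h2 h3 k' h4
    have := h4.lt
    have := h4.lt_left
    have := h4.le_right
    omega
  · have := h.nxt_zero k h1 h2 h3 k' h4
    have := h4.lt
    have := h4.lt_left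
    have := h4.le_right
    omega

theorem Links.zero (hq : 1 ≤ q) (hA : ∀ k, o < k → k ≤ e → A k = 0)
    (hN : ∀ k, o < k → k ≤ e → N k = 0) : Links z q o e 1 (e + 1 - 1) A N := by
  refine ⟨fun k h1 h2 h3 k' h4 => ?_, fun k h1 h2 h3 => absurd (hA k h1 h2) h3,
    fun k h1 h2 h3 k' h4 => ?_, fun k h1 h2 h3 => absurd (hN k h1 h2) h3⟩ <;>
  · have := h4.lt
    have := h4.le_right
    omega

/-- The window has a margin of `q` to the left of `k`, or begins with the text, so it contains every
earlier occurrence overlapping the one at `k`. -/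
theorem Links.prv_eq (h : Links z q o e q p' A N) {k : ℕ} (hk : o = 0 ∨ o + q ≤ k) (hk' : 1 ≤ k)
    (hok : o < k) (he : k + q ≤ e + 1) (hq : 1 ≤ q) : A k = prv z q k := by
  have h0 := prv_le z q k
  have hov : ∀ k', 1 ≤ k' → k' < k → k < k' + q → Match z q k' k → Overlap z q o e k' k :=
    fun k' h1 h2 h3 h4 => ⟨by omega, h2, h3, he, h4⟩
  by_cases h1 : A k = 0
  · by_contra h2
    have h3 := prv_spec (x := z) (q := q) (k := k) (by omega)
    have := h.prv_zero k hok (by omega) h1 _ (hov _ (by omega) (by omega) h3.1 h3.2)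
    omega
  · obtain ⟨h2, h3⟩ := h.prv_pos k hok (by omega) h1
    have h4 := le_prv (by have := h2.lt_left; omega) h2.lt h2.lt_add h2.match_eq
    have h5 := prv_spec (x := z) (q := q) (k := k) (by omega)
    have := h3 _ (hov _ (by omega) (by omega) h5.1 h5.2)
    omega

/-- An overlapping later occurrence ends by `k + 2q - 2`, so it lies in the window, unless the
window already ends with the text. -/
theorem Links.nxt_eq (h : Links z q o e q p' A N) {k l : ℕ} (hk : e = l ∨ k + 2 * q ≤ e + 2)
    (hel : e ≤ l) (hok : o < k) (hke : k ≤ e) : N k = nxt z q l k := by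
  have hov : ∀ k', k < k' → k' < k + q → k' + q ≤ l + 1 → Match z q k k' → Overlap z q o e k k' :=
    fun k' h1 h2 h3 h4 => ⟨hok, h1, h2, by omega, h4⟩
  by_cases h1 : N k = 0
  · rw [h1, nxt_eq_zero]
    intro m h2 h3 h4 h5
    have := h.nxt_zero k hok hke h1 _ (hov m h2 h3 h4 h5)
    omega
  · obtain ⟨h2, h3⟩ := h.nxt_pos k hok hke h1
    have h4 := h2.le_right
    refine (SLPNonOverlap.nxt_eq h2.lt h2.lt_add (by omega) h2.match_eq fun m h5 h6 h7 => ?_).symm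
    by_contra h8
    have := h2.lt_add
    have := h3 m (hov m h5 (by omega) h6 h7)
    omega

/-- `r` is the length of the longest common prefix of the parts of the text that start at `p` and
at `p + d` and end before `e + 1`. -/
structure Run (z : ℕ → ℕ) (e d p r : ℕ) : Prop where
  eq : ∀ t < r, z (p + t) = z (p + d + t)
  le : p + r + d ≤ e + 1
  max : p + r + d = e + 1 ∨ z (p + r) ≠ z (p + d + r)

theorem Run.overlap_iff {r : ℕ} (h : Run z e d p' r) (h1 : o < p') (h2 : 1 ≤ d) (h3 : d < q) :
    Overlap z q o e p' (p' + d) ↔ q ≤ r := by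
  constructor
  · intro ho
    by_contra hr
    rcases h.max with h4 | h4
    · have := ho.le_right
      omega
    · exact h4 (ho.match_eq r (by omega))
  · intro hr
    have := h.le
    exact ⟨h1, by omega, by omega, by omega, fun t ht => h.eq t (by omega)⟩

theorem Run.step_eq {r : ℕ} (h : Run z e d (p' + 1) r) (he : z p' = z (p' + d)) :
    Run z e d p' (r + 1) := by
  obtain ⟨h1, h2, h3⟩ := h
  refine ⟨fun t ht => ?_, by omega, ?_⟩
  · cases t with
    | zero => exact he
    | succ t =>
      have := h1 t (by omega)
      rw [show p' + (t + 1) = p' + 1 + t by omega, show p' + d + (t + 1) = p' + 1 + d + t by omega]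
      exact this
  · rcases h3 with h3 | h3
    · left; omega
    · right
      rw [show p' + (r + 1) = p' + 1 + r by omega, show p' + d + (r + 1) = p' + 1 + d + r by omega]
      exact h3

theorem Run.step_ne {r : ℕ} (h : Run z e d (p' + 1) r) (he : z p' ≠ z (p' + d)) :
    Run z e d p' 0 := by
  have := h.le
  exact ⟨fun t ht => by omega, by omega, Or.inr he⟩

/-- For each `q`-gram around the boundary, find the nearest equal `q`-grams that overlap it. -/
def matchProg : Prog :=
  .assign 22 1 ;;
  .loop ((Expr.reg 22).lt (.reg 1)) (
    .assign 23 0 ;; .assign 20 (.reg 12 + 1 - .reg 22) ;;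
    .loop ((Expr.reg 11 + 1).lt (.reg 20)) (
      .assign 20 (.reg 20 - 1) ;;
      .cond ((Expr.arr 8 (.reg 20)).eq (.arr 8 (.reg 20 + .reg 22)))
        (.assign 23 (.reg 23 + 1)) (.assign 23 0) ;;
      .cond ((Expr.reg 23).lt (.reg 1)) .skip (
        .cond (.arr 15 (.reg 20)) .skip (.put 15 (.reg 20) (.reg 20 + .reg 22)) ;;
        .cond (.arr 9 (.reg 20 + .reg 22)) .skip (.put 9 (.reg 20 + .reg 22) (.reg 20)))) ;;
    .assign 22 (.reg 22 + 1))

/-- Testing `q` letters for each of the `O(q²)` pairs would be too slow. The common extension at `p`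
follows in constant time from that at `p + 1` (`Run.step_eq`, `Run.step_ne`), and the `q`-grams
agree when it has reached `q` (`Run.overlap_iff`). -/
theorem runs_matchProg (hd : Dims W b n q V i a c I L R O) (h : Ctx n q V i a c I L R O s)
    (hz : ∀ k, a - 3 * q < k → k ≤ min (a + 3 * q) (a + c) →
        s.fld 8 k = z k ∧ s.fld 9 k = 0 ∧ s.fld 15 k = 0) :
    Runs W b matchProg (fun s' =>
      Frame (fun f _ => f = 9 ∨ f = 15) s s' ∧
      ∃ p, Links z q (a - 3 * q) (min (a + 3 * q) (a + c)) q p (s'.fld 9) (s'.fld 15)) s := by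
  obtain ⟨d1, d2, d3, d4, d5, d6, d7, d8, d9, d10, d11, d12, d13⟩ := hd
  have r11 := h.r11
  have r12 := h.r12
  generalize ho : a - 3 * q = o at *
  generalize he : min (a + 3 * q) (a + c) = e at *
  refine Runs.seq (Runs.assign (by simp; omega) ?_)
  refine Runs.loop (fun s' => Frame (fun f _ => f = 9 ∨ f = 15) s s' ∧ 1 ≤ s'.reg 22 ∧
    s'.reg 22 ≤ q ∧ Links z q o e (s'.reg 22) (e + 1 - s'.reg 22) (s'.fld 9) (s'.fld 15))
    (fun s' => q - s'.reg 22) ⟨(Frame.refl _ s).setReg (by omega) _, by simp, by simp; omega, ?_⟩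
    (by simp; omega) (fun s' _ => by simp) ?_ ?_
  · simp only [den_ofNat, reg_setReg, if_true]
    refine Links.zero (by omega) (fun k h1 h2 => ?_) fun k h1 h2 => ?_
    · rw [fld_setReg (by decide)]; exact (hz k h1 h2).2.1
    · rw [fld_setReg (by decide)]; exact (hz k h1 h2).2.2
  · rintro s₁ ⟨hF₁, hd₁, -, hL₁⟩ hc
    have h₁ := h.of_frame hF₁
    simp [h₁.r1] at hc
    have e12 := hF₁.reg 12 (by decide)
    rw [r12] at e12
    refine Runs.seq (Runs.assign (by simp) (Runs.seq (Runs.assign (by simp [e12]; omega) ?_)))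
    simp only [den_ofNat, den_sub, den_add, den_reg, reg_setReg, e12,
      Nat.reduceEqDiff, if_false]
    generalize hdd : s₁.reg 22 = d at *
    refine Runs.seq (Runs.loop (fun s' => Frame (fun f _ => f = 9 ∨ f = 15) s s' ∧ s'.reg 22 = d ∧
      s'.reg 20 ≤ e + 1 - d ∧ (o < s'.reg 20 → Run z e d (s'.reg 20) (s'.reg 23)) ∧
      Links z q o e d (s'.reg 20) (s'.fld 9) (s'.fld 15))
      (fun s' => s'.reg 20 - (o + 1)) ⟨(hF₁.setReg (by omega) _).setReg (by omega) _, by simp [hdd],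
        by simp, ?_, ?_⟩ (by simp; omega) ?_ ?_ ?_)
    -- At `e + 1 - d` the shifted copy starts just behind the window, so the initial run is empty.
    · simp only [reg_setReg, if_true]
      intro _
      exact ⟨fun t ht => by simp at ht, by simp; omega, Or.inl (by simp; omega)⟩
    · simp only [reg_setReg, if_true]
      exact hL₁
    · intro s₂ h₂
      simp [h₂.1.reg 11 (by decide), r11]
      omega
    · rintro s₂ ⟨hF₂, e22, hle, hrun, hL₂⟩ hc₂
      have h₂ := h.of_frame hF₂
      have e11 := hF₂.reg 11 (by decide)
      rw [r11] at e11
      simp [e11] at hc₂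
      obtain ⟨p, hp⟩ : ∃ p, s₂.reg 20 = p + 1 := ⟨s₂.reg 20 - 1, by omega⟩
      rw [hp] at hle hrun hL₂ hc₂
      have hrun := hrun (by omega)
      have hrle := hrun.le
      refine Runs.seq (Runs.assign (by simp; omega) (Runs.seq ?_))
      simp only [den_sub, den_reg, den_ofNat, hp, Nat.add_sub_cancel]
      have hz1 : s₂.fld 8 p = z p := by
        rw [hF₂.fld 8 (by decide) _ (by simp)]; exact (hz p (by omega) (by omega)).1
      have hz2 : s₂.fld 8 (p + d) = z (p + d) := by
        rw [hF₂.fld 8 (by decide) _ (by simp)]; exact (hz _ (by omega) (by omega)).1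
      -- Both outcomes of the letter comparison leave a correct run at `p`; what follows depends
      -- only on its length `r`.
      have key : ∀ r, Run z e d p r → Runs W b (.cond ((Expr.reg 23).lt (.reg 1)) .skip (
          .cond (.arr 15 (.reg 20)) .skip (.put 15 (.reg 20) (.reg 20 + .reg 22)) ;;
          .cond (.arr 9 (.reg 20 + .reg 22)) .skip (.put 9 (.reg 20 + .reg 22) (.reg 20))))
          (fun s' => (Frame (fun f _ => f = 9 ∨ f = 15) s s' ∧ s'.reg 22 = d ∧
          s'.reg 20 ≤ e + 1 - d ∧ (o < s'.reg 20 → Run z e d (s'.reg 20) (s'.reg 23)) ∧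
          Links z q o e d (s'.reg 20) (s'.fld 9) (s'.fld 15)) ∧
          s'.reg 20 - (o + 1) < p + 1 - (o + 1)) ((s₂.setReg 20 p).setReg 23 r) := by
        intro r hr
        have hiff := hr.overlap_iff (q := q) (o := o) (by omega) hd₁ hc
        have fin : ∀ s' : State, Frame (fun f _ => f = 9 ∨ f = 15) s s' → s'.reg 20 = p →
            s'.reg 22 = d → s'.reg 23 = r → Links z q o e d p (s'.fld 9) (s'.fld 15) →
            (Frame (fun f _ => f = 9 ∨ f = 15) s s' ∧ s'.reg 22 = d ∧
            s'.reg 20 ≤ e + 1 - d ∧ (o < s'.reg 20 → Run z e d (s'.reg 20) (s'.reg 23)) ∧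
            Links z q o e d (s'.reg 20) (s'.fld 9) (s'.fld 15)) ∧
            s'.reg 20 - (o + 1) < p + 1 - (o + 1) := by
          intro s' f1 f2 f3 f4 f5
          rw [f2, f4]
          exact ⟨⟨f1, f3, by omega, fun _ => hr, f5⟩, by omega⟩
        have hF₃ := (hF₂.setReg (x := 20) (by omega) p).setReg (x := 23) (by omega) r
        refine Runs.cond (by simp) (fun hc₃ => Runs.skip ?_) fun hc₃ => ?_
        · simp [h₂.r1] at hc₃
          refine fin _ hF₃ (by simp) (by simp [e22]) (by simp) ?_
          refine Links.step_of_not ?_ fun hov => by have := hiff.1 hov; omega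
          simpa using hL₂
        · simp [h₂.r1] at hc₃
          have hov := hiff.2 hc₃
          have hs := hL₂.step (A' := fun k => if k = p + d ∧ s₂.fld 9 k = 0 then p else s₂.fld 9 k)
            (N' := fun k => if k = p ∧ s₂.fld 15 k = 0 then p + d else s₂.fld 15 k) hov
            (fun k => rfl) (fun k => rfl)
          have key₂ : ∀ s₄ : State, Frame (fun f _ => f = 9 ∨ f = 15) s s₄ → s₄.reg 20 = p →
              s₄.reg 22 = d → s₄.reg 23 = r → (∀ k, s₄.fld 9 k = s₂.fld 9 k) →
              (∀ k, s₄.fld 15 k = if k = p ∧ s₂.fld 15 k = 0 then p + d else s₂.fld 15 k) →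
              Runs W b
              (.cond (.arr 9 (.reg 20 + .reg 22)) .skip (.put 9 (.reg 20 + .reg 22) (.reg 20)))
              (fun s' => (Frame (fun f _ => f = 9 ∨ f = 15) s s' ∧ s'.reg 22 = d ∧
              s'.reg 20 ≤ e + 1 - d ∧ (o < s'.reg 20 → Run z e d (s'.reg 20) (s'.reg 23)) ∧
              Links z q o e d (s'.reg 20) (s'.fld 9) (s'.fld 15)) ∧
              s'.reg 20 - (o + 1) < p + 1 - (o + 1)) s₄ := by
            intro s₄ f1 f2 f3 f4 f5 f6
            have f7 := (h.of_frame f1).r3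
            refine Runs.cond (by simp [f2, f3, f7]; omega) (fun hc₄ => Runs.skip ?_) fun hc₄ => ?_
            · simp [f2, f3, f5] at hc₄
              refine fin _ f1 f2 f3 f4 ?_
              convert hs using 1
              · funext k
                rw [f5, if_neg]
                rintro ⟨rfl, hk⟩
                exact hc₄ hk
              · funext k
                exact f6 k
            · simp [f2, f3, f5] at hc₄
              refine Runs.put (by simp [f2, f3, f7]; omega) (by simp) ?_
              simp only [den_add, den_reg, f2, f3]
              refine fin _ (f1.setFld (by decide) (by simp) _) f2 f3 f4 ?_
              convert hs using 1
              · funext k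
                rw [fld_setFld (by decide) (by decide), f5]
                by_cases hk : k = p + d
                · rw [hk]; simp [hc₄]
                · simp [hk]
              · funext k
                rw [fld_setFld (by decide) (by decide), f6]
                simp
          refine Runs.seq (Runs.cond (by simp [h₂.r3]; omega) (fun hc₄ => Runs.skip ?_)
            fun hc₄ => ?_)
          · simp at hc₄
            refine key₂ _ hF₃ (by simp) (by simp [e22]) (by simp) (by simp) fun k => ?_
            rw [fld_setReg (by decide), fld_setReg (by decide), if_neg]
            rintro ⟨rfl, hk⟩
            exact hc₄ hk
          · simp at hc₄
            refine Runs.put (by simp [h₂.r3]; omega) (by simp [e22]; omega) ?_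
            refine key₂ _ (hF₃.setFld (by decide) (by simp) _) (by simp) (by simp [e22]) (by simp)
              (fun k => ?_) fun k => ?_
            · rw [fld_setFld (by decide) (by decide)]
              simp
            · rw [fld_setFld (by decide) (by decide)]
              by_cases hk : k = p
              · rw [hk]; simp [hc₄, e22]
              · simp [hk]
      refine Runs.cond (by simp [h₂.r3, e22]; omega) (fun hc₃ => ?_) fun hc₃ => ?_
      · simp [e22, hz1, hz2] at hc₃
        refine Runs.assign (by simp; omega) ?_
        have := key _ (hrun.step_eq hc₃)
        simp only [den_add, den_reg, den_ofNat, reg_setReg, Nat.reduceEqDiff, if_false]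
        exact this
      · simp [e22, hz1, hz2] at hc₃
        exact Runs.assign (by simp) (key _ (hrun.step_ne hc₃))
    · rintro s₂ ⟨hF₂, e22, hle, hrun, hL₂⟩ hc₂
      have e11 := hF₂.reg 11 (by decide)
      rw [r11] at e11
      simp [e11] at hc₂
      refine Runs.assign (by simp [e22]; omega) ⟨⟨hF₂.setReg (by omega) _, by simp, by
        simp [e22]; omega, ?_⟩, by simp [e22]; omega⟩
      simp only [den_add, den_reg, den_ofNat, e22, reg_setReg, if_true]
      rw [fld_setReg (by decide), fld_setReg (by decide)]
      exact hL₂.succ (by omega) (by omega)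
  · rintro s₁ ⟨hF₁, hd₁, hd₂, hL₁⟩ hc
    simp [(h.of_frame hF₁).r1] at hc
    obtain hq : s₁.reg 22 = q := by omega
    rw [hq] at hL₁
    exact ⟨hF₁, _, hL₁⟩

end Blocks

/-! ### Counts and chain ends around the boundary -/

section Blocks

variable {W b : ℕ} {s s₀ : State} {F : ℕ → ℕ → Prop} {Q : State → Prop} {p : Prog}
variable {n q V i a c I L R O : ℕ} {x y z : ℕ → ℕ}

/-- Compute `count` and `final` around the boundary, in the arrays `10` and `11`. -/
def countProg : Prog :=
  .for (.reg 11 + 1) (Expr.min (.reg 6 + .reg 15) (.reg 7 + 1 - .reg 1) + 1)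
    (.cond ((Expr.reg 20 + .reg 1).lt (.reg 6 + 2))
      (.put 10 (.reg 20) (.arr 3 (.reg 9 + (.reg 6 - .reg 20))) ;;
        .put 11 (.reg 20) (.arr 4 (.reg 9 + (.reg 6 - .reg 20))))
      (.assign 24 (.reg 20) ;;
        .loop ((Expr.lt 0 (.reg 24)) * ((Expr.reg 20).lt (.reg 24 + .reg 1)))
          (.assign 24 (.arr 9 (.reg 24))) ;;
        .cond (.reg 24)
          (.put 10 (.reg 20) (.arr 10 (.reg 24) + 1) ;; .put 11 (.reg 20) (.arr 11 (.reg 24)))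
          (.put 10 (.reg 20) 1 ;; .put 11 (.reg 20) (.reg 20))))

/-- For `q`-grams inside `X_l` the stored values remain valid (`CopyOf.count_final_prefix`). The
others start at `a + 2 - q` or later, and the walk reads links from `a + 3 - 2q` on, where the
window gives them correctly. -/
theorem runs_countProg (hd : Dims W b n q V i a c I L R O) (h : Ctx n q V i a c I L R O s)
    (hx : Table q a x fun f t => s.fld f (L + t)) (hzx : CopyOf z x 0 a)
    (hprv : ∀ k, 1 ≤ k → a + 3 ≤ k + 2 * q → k + 2 ≤ a + 2 * q → k + q ≤ a + c + 1 →
      s.fld 9 k = prv z q k) :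
    Runs W b countProg (fun s' => Frame (fun f _ => f = 10 ∨ f = 11) s s' ∧
      ∀ k, a - 3 * q < k → k + 2 ≤ a + 2 * q → k + q ≤ a + c + 1 →
        s'.fld 10 k = count z q k ∧ s'.fld 11 k = final z q k) s := by
  obtain ⟨d1, d2, d3, d4, d5, d6, d7, d8, d9, d10, d11, d12, d13⟩ := hd
  refine Runs.for (lo := a - 3 * q + 1) (hi := min (a + (2 * q - 2)) (a + c + 1 - q) + 1)
    [10, 11] (fun p => p) (fun f p => if f = 10 then count z q p else final z q p)
    ?_ ?_ ?_ ?_ ?_ ?_ ?_ ?_ ?_ ?_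
  · simp
  · simp [h.r11]; omega
  · simp [h.r11]
  · simp [h.r6, h.r15, h.r7, h.r1]; omega
  · simp [h.r6, h.r15, h.r7, h.r1]
  · omega
  · omega
  · intro k m _ _ _ _ hkm
    exact hkm
  · intro k s' hk hk' r20 hF hm
    have h' := h.of_frame hF
    have fin : ∀ (s'' : State) (u v : ℕ), Frame (fun f u => f ∈ [10, 11] ∧ u = k) s' s'' →
        u = count z q k → v = final z q k →
        Frame (fun f u => f ∈ [10, 11] ∧ u = k) s' ((s''.setFld 10 k u).setFld 11 k v) ∧
        ∀ f ∈ [10, 11], ((s''.setFld 10 k u).setFld 11 k v).fld f k =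
          if f = 10 then count z q k else final z q k := by
      intro s'' u v hF' hu hv
      refine ⟨(hF'.setFld (by decide) (by simp) _).setFld (by decide) (by simp) _, ?_⟩
      simp [fld_setFld, hu, hv]
    refine Runs.cond (by simp [h'.r6, h'.r1, r20]; omega) (fun hc => ?_) (fun hc => ?_)
    · simp [r20, h'.r6, h'.r1] at hc
      refine Runs.seq (Runs.put (by simp [h'.r3, r20]; omega)
        (by simp [h'.r9, h'.r3, h'.r6, r20]; omega) ?_)
      refine Runs.put (by simp [h'.r3, r20]; omega)
        (by simp [h'.r9, h'.r3, h'.r6, r20]; omega) ?_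
      simp only [den_add, den_sub, den_reg, den_arr, reg_setFld, r20, h'.r9, h'.r6]
      obtain ⟨e1, e2⟩ := hzx.count_final_prefix (k := k) (q := q) (by omega) (by omega) (by omega)
      have e3 : a - (a - k) = k := by omega
      have e4 := hx.count (a - k) (by omega) (by omega) (by omega)
      have e5 := hx.final (a - k) (by omega) (by omega) (by omega)
      rw [e3] at e4 e5
      have := fin s' (s'.fld 3 (L + (a - k))) (s'.fld 4 (L + (a - k))) (Frame.refl _ _)
        (by rw [e1, ← e4, hF.fld 3 (by decide) _ (by simp)])
        (by rw [e2, ← e5, hF.fld 4 (by decide) _ (by simp)])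
      rw [fld_setFld (by decide) (by decide), if_neg (by simp)]
      exact ⟨trivial, trivial, this⟩
    · simp [r20, h'.r6, h'.r1] at hc
      refine Runs.seq (Runs.assign (by simp) (Runs.seq ?_))
      simp only [den_reg, r20]
      -- Links strictly decrease and the walk stops `q` positions below `k`, so there are at most
      -- `q` iterations.
      refine Runs.loop (fun s'' => ∃ y, s'' = s'.setReg 24 y ∧ y ≤ k ∧ back z q k y = jump z q k)
        (fun s'' => s''.reg 24 + q - k) ⟨k, rfl, le_rfl, rfl⟩ (by simp; omega) ?_ ?_ ?_
      · rintro _ ⟨y, rfl, hy, -⟩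
        simp [r20, h'.r1]
        split_ifs <;> omega
      · rintro _ ⟨y, rfl, hy, hb⟩ hc'
        have hc' : 0 < y ∧ k < y + q := by
          simp [r20, h'.r1] at hc'
          omega
        have hp := prv_le z q y
        have hA : s'.fld 9 y = prv z q y := by
          rw [hF.fld _ (by decide) _ (by simp)]
          exact hprv y (by omega) (by omega) (by omega) (by omega)
        refine Runs.assign (by simp [h'.r3]; omega) ?_
        simp only [den_arr, den_reg, reg_setReg, if_true]
        rw [fld_setReg (by decide), hA]
        refine ⟨⟨prv z q y, ?_, by omega, ?_⟩, by omega⟩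
        · simp [State.setReg]
        · rw [← hb, back_of_lt hc'.1 hc'.2]
      · rintro _ ⟨y, rfl, hy, hb⟩ hc'
        have hc' : y = 0 ∨ y + q ≤ k := by
          by_contra hc''
          rw [not_or] at hc''
          simp [r20, h'.r1] at hc'
          omega
        have hj : y = jump z q k := by
          rcases hc' with rfl | hc'
          · simpa using hb
          · rwa [back_of_le hc'] at hb
        refine Runs.cond (by simp) (fun h0 => ?_) fun h0 => ?_
        · simp at h0
          -- The target is at least `k + 2 - 2q ≥ a + 4 - 3q`, so it is inside the window and was
          -- handled earlier in the loop; this is where the margin `3q` is needed.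
          have hl := lt_jump_add (x := z) (q := q) (k := k) (by omega) (by omega)
          have hm' := hm y (by omega) (by omega)
          simp only [List.mem_cons, List.not_mem_nil, or_false, forall_eq_or_imp, forall_eq,
            if_true, Nat.reduceEqDiff, if_false] at hm'
          refine Runs.seq (Runs.put (by simp [h'.r3, r20]; omega) ?_ ?_)
          · have := count_le (x := z) (q := q) (k := y) (by omega)
            simp [h'.r3, hm'.1]
            omega
          refine Runs.put (by simp [h'.r3, r20]; omega) (by simp [h'.r3]; omega) ?_
          simp only [den_add, den_ofNat, den_reg, den_arr, reg_setFld, reg_setReg, r20,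
            Nat.reduceEqDiff, if_false, if_true]
          rw [fld_setFld (by decide) (by decide), if_neg (by simp), fld_setReg (by decide),
            fld_setReg (by decide)]
          have := fin (s'.setReg 24 y) (s'.fld 10 y + 1) (s'.fld 11 y)
            ((Frame.refl _ _).setReg (by omega) _)
            (by rw [hm'.1, count_eq (k := k) (by omega) (by omega), hj])
            (by rw [hm'.2, final_eq (k := k) (by omega) (by omega), hj])
          exact ⟨trivial, trivial, this⟩
        · simp at h0
          subst h0
          refine Runs.seq (Runs.put (by simp [h'.r3, r20]; omega) (by simp; omega) ?_)
          refine Runs.put (by simp [h'.r3, r20]; omega) (by simp) ?_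
          simp only [den_ofNat, den_reg, reg_setFld, reg_setReg, r20, Nat.reduceEqDiff, if_false]
          have := fin (s'.setReg 24 0) 1 k
            ((Frame.refl _ _).setReg (by omega) _)
            (by rw [count_of_jump_eq_zero (by omega) (by omega) hj.symm])
            (by rw [final_of_jump_eq_zero hj.symm])
          exact ⟨trivial, trivial, this⟩
  · intro s₁ hF₁ h₁
    refine ⟨hF₁.mono ?_, fun k hk hk' hk'' => ?_⟩
    · rintro f u ⟨hf, -⟩
      simpa using hf
    · have := h₁ k hk (by omega)
      simpa using this

/-- Turn `final` and `count` for a position of the right part, in the registers `25` and `26`, into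
those for the corresponding position of the whole string. -/
def liftProg : Prog :=
  .cond ((Expr.reg 15).lt (.reg 25))
    (.assign 26 (.reg 26) ;; .assign 25 (.reg 6 + .reg 25))
    (.assign 26 (.reg 26 - 1 + .arr 10 (.reg 6 + .reg 25)) ;;
      .assign 25 (.arr 11 (.reg 6 + .reg 25)))

/-- Either `final` exceeds `2q - 2` and the selection cannot cross the boundary, or `a + final` is
in the window and its known values complete the selection. The program subtracts 1 because that
position would be counted twice. -/
theorem runs_liftProg (hd : Dims W b n q V i a c I L R O) (h : Ctx n q V i a c I L R O s)
    (hzy : CopyOf z y a c)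
    (hcf : ∀ k, a - 3 * q < k → k + 2 ≤ a + 2 * q → k + q ≤ a + c + 1 →
        s.fld 10 k = count z q k ∧ s.fld 11 k = final z q k)
    {k : ℕ} (hk : 1 ≤ k) (hkc : k + q ≤ c + 1) (h25 : s.reg 25 = final y q k)
    (h26 : s.reg 26 = count y q k) (hQ : Q ((s.setReg 26 (count z q (a + k))).setReg 25
      (final z q (a + k)))) : Runs W b liftProg Q s := by
  obtain ⟨d1, d2, d3, d4, d5, d6, d7, d8, d9, d10, d11, d12, d13⟩ := hd
  obtain ⟨f1, f2, -⟩ := final_bounds (x := y) (q := q) hk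
  have f3 := count_le (x := y) (q := q) (k := k) (by omega)
  have f4 := one_le_count (x := y) (q := q) (k := k) (by omega) hk
  have f5 := count_le (x := z) (q := q) (k := a + final y q k) (by omega)
  refine Runs.cond (by simp) (fun hc => ?_) fun hc => ?_
  · simp [h.r15, h25] at hc
    obtain ⟨e1, e2⟩ := hzy.count_final_of_lt (k := k) (q := q) (by omega) hk hkc (by omega)
    refine Runs.seq (Runs.assign (by simp) ?_)
    refine Runs.assign (by simp [h25, h.r6]; omega) ?_
    simpa [h25, h26, h.r6, ← e1, ← e2] using hQ
  · simp [h.r15, h25] at hc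
    obtain ⟨e1, e2⟩ := hzy.count_final (k := k) (q := q) (by omega) hk hkc
    obtain ⟨e3, e4⟩ := hcf (a + final y q k) (by omega) (by omega) (by omega)
    refine Runs.seq (Runs.assign (by simp [h25, h26, h.r6, h.r3, e3]; omega) ?_)
    refine Runs.assign (by simp [h25, h.r6, h.r3]; omega) ?_
    have e5 : count y q k - 1 + count z q (a + final y q k) = count z q (a + k) := by omega
    simpa [h25, h26, h.r6, e3, e4, e5, ← e2] using hQ

/-- Compute the ends of the chains around the boundary, with their values of `count` and `final`,
in the arrays `12`, `13` and `14`, and write the output. -/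
def chainProg : Prog :=
  .assign 20 (.reg 14) ;;
  .loop ((Expr.reg 13).lt (.reg 20)) (
    .assign 20 (.reg 20 - 1) ;;
    .cond ((Expr.reg 6).lt (.reg 20))
      (.assign 25 (.arr 7 (.reg 10 + (.reg 20 - .reg 6))) ;;
        .assign 26 (.arr 6 (.reg 10 + (.reg 20 - .reg 6))) ;;
        .put 12 (.reg 20) (.reg 6 + .arr 5 (.reg 10 + (.reg 20 - .reg 6))) ;;
        liftProg ;; .put 13 (.reg 20) (.reg 26) ;; .put 14 (.reg 20) (.reg 25))
      (.assign 24 (.arr 15 (.reg 20)) ;;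
        .cond (.reg 24)
          (.put 12 (.reg 20) (.arr 12 (.reg 24)) ;; .put 13 (.reg 20) (.arr 13 (.reg 24)) ;;
            .put 14 (.reg 20) (.arr 14 (.reg 24)))
          (.put 12 (.reg 20) (.reg 20) ;; .put 13 (.reg 20) (.arr 10 (.reg 20)) ;;
            .put 14 (.reg 20) (.arr 11 (.reg 20)))) ;;
    .store (.reg 16 + (.reg 20 - .reg 13)) (.arr 13 (.reg 20)))

/-- Positions are processed from right to left. Those in `X_r` take their chain end from the table
of `X_r`; those in `X_l` inherit it from their successor or, without one, are their own chain end.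
-/
theorem runs_chainProg (hd : Dims W b n q V i a c I L R O) (h : Ctx n q V i a c I L R O s)
    (hy : Table q c y fun f t => s.fld f (R + t)) (hzy : CopyOf z y a c)
    (hnxt : ∀ k, 1 ≤ k → a + 3 ≤ k + 2 * q → k ≤ a → s.fld 15 k = nxt z q (a + c) k)
    (hcf : ∀ k, a - 3 * q < k → k + 2 ≤ a + 2 * q → k + q ≤ a + c + 1 →
        s.fld 10 k = count z q k ∧ s.fld 11 k = final z q k) :
    Runs W b chainProg (fun s' =>
      Frame (fun f t => f = 12 ∨ f = 13 ∨ f = 14 ∨ f = 16 ∧ O ≤ t ∧ t < O + 3 * q) s s' ∧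
      ∀ k, max 1 (a + 3 - 2 * q) ≤ k → k < min (a + q) (a + c + 2 - q) →
        s'.fld 12 k = chainEnd z q (a + c) k ∧
        s'.fld 13 k = count z q (chainEnd z q (a + c) k) ∧
        s'.fld 14 k = final z q (chainEnd z q (a + c) k) ∧
        s'.mem (O + (k - max 1 (a + 3 - 2 * q))) = count z q (chainEnd z q (a + c) k)) s := by
  have hd' := hd
  obtain ⟨d1, d2, d3, d4, d5, d6, d7, d8, d9, d10, d11, d12, d13⟩ := hd
  have r13 := h.r13
  have r14 := h.r14
  generalize hlo : max 1 (a + 3 - 2 * q) = lo at *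
  generalize hhi : min (a + q) (a + c + 2 - q) = hi at *
  generalize hG : (fun f t => f = 12 ∨ f = 13 ∨ f = 14 ∨ f = 16 ∧ O ≤ t ∧ t < O + 3 * q) = G
  have hG' : ∀ f t, G f t ↔ f = 12 ∨ f = 13 ∨ f = 14 ∨ f = 16 ∧ O ≤ t ∧ t < O + 3 * q := by
    simp [← hG]
  have hGn : ∀ f < 12, ∀ t, ¬ G f t := by
    intro f hf t
    rw [hG']
    omega
  refine Runs.seq (Runs.assign (by simp) ?_)
  simp only [den_reg, r14]
  refine Runs.loop (fun s' => Frame G s s' ∧ s'.reg 20 ≤ hi ∧ ∀ k, lo ≤ k → s'.reg 20 ≤ k → k < hi →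
        s'.fld 12 k = chainEnd z q (a + c) k ∧
        s'.fld 13 k = count z q (chainEnd z q (a + c) k) ∧
        s'.fld 14 k = final z q (chainEnd z q (a + c) k) ∧
        s'.mem (O + (k - lo)) = count z q (chainEnd z q (a + c) k)) (fun s' => s'.reg 20 - lo)
    ⟨(Frame.refl _ s).setReg (by omega) _, by simp, fun k h1 h2 h3 => ?_⟩ (by simp; omega)
    (fun _ _ => by simp) ?_ ?_
  · simp at h2
    omega
  · rintro s₁ ⟨hF, hle, hm⟩ hc
    have e13 := hF.reg 13 (by decide)
    rw [r13] at e13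
    simp [e13] at hc
    obtain ⟨k, hk⟩ : ∃ k, s₁.reg 20 = k + 1 := ⟨s₁.reg 20 - 1, by omega⟩
    rw [hk] at hle hc hm ⊢
    refine Runs.seq (Runs.assign (by simp; omega) ?_)
    simp only [den_sub, den_reg, den_ofNat, hk, Nat.add_sub_cancel]
    have h₁ := h.of_frame hF
    generalize hK : (fun f t => (f = 12 ∨ f = 13 ∨ f = 14) ∧ t = k) = K
    have hK' : ∀ f t, K f t ↔ (f = 12 ∨ f = 13 ∨ f = 14) ∧ t = k := by simp [← hK]
    have hF₂ := (Frame.refl K s₁).setReg (x := 20) (by omega) k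
    have fin : ∀ s₃ : State, Frame K s₁ s₃ → s₃.reg 20 = k →
        s₃.fld 12 k = chainEnd z q (a + c) k →
        s₃.fld 13 k = count z q (chainEnd z q (a + c) k) →
        s₃.fld 14 k = final z q (chainEnd z q (a + c) k) →
        Runs W b (.store (.reg 16 + (.reg 20 - .reg 13)) (.arr 13 (.reg 20)))
        (fun s' => (Frame G s s' ∧ s'.reg 20 ≤ hi ∧ ∀ k, lo ≤ k → s'.reg 20 ≤ k → k < hi →
        s'.fld 12 k = chainEnd z q (a + c) k ∧
        s'.fld 13 k = count z q (chainEnd z q (a + c) k) ∧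
        s'.fld 14 k = final z q (chainEnd z q (a + c) k) ∧
        s'.mem (O + (k - lo)) = count z q (chainEnd z q (a + c) k)) ∧
          s'.reg 20 - lo < k + 1 - lo) s₃ := by
      intro s₃ hF₃ e20 v12 v13 v14
      have h₃ := h₁.of_frame hF₃
      have g13 := hF₃.reg 13 (by decide)
      rw [e13] at g13
      refine Runs.store (by simp [h₃.r16, e20, g13]; omega) (by simp [h₃.r3, e20]; omega) ?_
      simp only [den_add, den_sub, den_reg, den_arr, h₃.r16, e20, g13, v13, reg_setMem]
      have hO : O + (k - lo) < s₃.reg 3 := by rw [h₃.r3]; omega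
      refine ⟨⟨(hF.trans (hF₃.mono fun f t hf => ?_)).setMem (by rw [h.r3]; omega) ?_ _, by omega,
        fun m m1 m2 m3 => ?_⟩, by omega⟩
      · rw [hK'] at hf
        rw [hG']
        tauto
      · rw [hG']
        omega
      · rw [fld_setMem hO, fld_setMem hO, fld_setMem hO, mem_setMem]
        by_cases hmk : m = k
        · rw [hmk, if_pos rfl]
          exact ⟨v12, v13, v14, rfl⟩
        · have hn : ∀ f, ¬ K f m := by
            intro f
            rw [hK']
            tauto
          rw [if_neg (by omega), hF₃.fld _ (by decide) _ (hn _), hF₃.fld _ (by decide) _ (hn _),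
            hF₃.fld _ (by decide) _ (hn _), hF₃.low _ (by rw [h₁.r3]; omega) (by rw [hK']; omega)]
          exact hm m m1 (by omega) m3
    refine Runs.seq (Runs.cond (by simp) (fun hc₂ => ?_) fun hc₂ => ?_)
    · simp [h₁.r6] at hc₂
      -- The bound `hi ≤ a + q` makes `k - a < q`, the range stored for prefixes.
      have t5 := hy.endPos (k - a) (by omega) (by omega) (by omega)
      have t6 := hy.endCount (k - a) (by omega) (by omega) (by omega)
      have t7 := hy.endFinal (k - a) (by omega) (by omega) (by omega)
      simp only [← hF.fld _ (show 5 < 16 by decide) _ (hGn 5 (by decide) _)] at t5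
      simp only [← hF.fld _ (show 6 < 16 by decide) _ (hGn 6 (by decide) _)] at t6
      simp only [← hF.fld _ (show 7 < 16 by decide) _ (hGn 7 (by decide) _)] at t7
      obtain ⟨c1, c2, -⟩ := chainEnd_spec (x := y) (q := q) (L := c) (k := k - a) (by omega)
      have hce := hzy.chainEnd (k := k - a) (q := q) (by omega) (by omega)
      rw [Nat.add_sub_cancel' (by omega)] at hce
      refine Runs.seq (Runs.assign (by simp [h₁.r10, h₁.r6, h₁.r3]; omega) ?_)
      refine Runs.seq (Runs.assign (by simp [h₁.r10, h₁.r6, h₁.r3]; omega) ?_)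
      refine Runs.seq (Runs.put (by simp [h₁.r3]; omega)
        (by simp [h₁.r10, h₁.r6, h₁.r3, t5]; omega) ?_)
      simp only [den_add, den_sub, den_reg, den_arr, reg_setReg, Nat.reduceEqDiff, if_true,
        if_false, h₁.r10, h₁.r6]
      have hF₃ := ((hF₂.setReg (x := 25) (by omega) (s₁.fld 7 (R + (k - a)))).setReg (x := 26)
        (by omega) (s₁.fld 6 (R + (k - a)))).setFld (f := 12) (t := k) (by decide)
        (by rw [hK']; simp) (a + s₁.fld 5 (R + (k - a)))
      simp only [fld_setReg (show 20 ≠ 3 by decide), fld_setReg (show 25 ≠ 3 by decide),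
        fld_setReg (show 26 ≠ 3 by decide)]
      refine Runs.seq (runs_liftProg (k := chainEnd y q c (k - a)) hd' (h₁.of_frame hF₃) hzy ?_
        (by omega) (by omega) (by simp [t7]) (by simp [t6]) ?_)
      · intro m m1 m2 m3
        rw [hF₃.fld _ (by decide) _ (by rw [hK']; omega), hF₃.fld _ (by decide) _
          (by rw [hK']; omega), hF.fld _ (by decide) _ (hGn _ (by decide) _),
          hF.fld _ (by decide) _ (hGn _ (by decide) _)]
        exact hcf m m1 m2 m3
      · rw [← hce]
        have hF₄ := (hF₃.setReg (x := 26) (by omega)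
          (count z q (chainEnd z q (a + c) k))).setReg (x := 25) (by omega)
          (final z q (chainEnd z q (a + c) k))
        have r3 := (h₁.of_frame hF₄).r3
        refine Runs.seq (Runs.put (by simp [h₁.r3]; omega) (by simp) ?_)
        refine Runs.put (by simp [h₁.r3]; omega) (by simp) ?_
        refine fin _ ((hF₄.setFld (by decide) (by rw [hK']; simp) _).setFld (by decide)
          (by rw [hK']; simp) _) (by simp) ?_ ?_ ?_
        · simp [fld_setFld, t5, hce]
        · simp [fld_setFld]
        · simp [fld_setFld]
    · simp [h₁.r6] at hc₂
      refine Runs.seq (Runs.assign (by simp [h₁.r3]; omega) ?_)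
      simp only [den_reg, den_arr, reg_setReg, if_true, fld_setReg (show 20 ≠ 3 by decide)]
      rw [hF.fld 15 (by decide) _ (by rw [hG']; omega), hnxt k (by omega) (by omega) hc₂]
      have hF₃ := hF₂.setReg (x := 24) (by omega) (nxt z q (a + c) k)
      refine Runs.cond (by simp) (fun hc₃ => ?_) fun hc₃ => ?_
      · simp at hc₃
        -- The successor lies in `(k, k + q)` with `k ≤ a`, hence below `hi`, and its entry is
        -- already filled.
        obtain ⟨n1, n2, n3, n4⟩ := nxt_spec hc₃
        obtain ⟨w1, w2, w3, -⟩ := hm (nxt z q (a + c) k) (by omega) (by omega) (by omega)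
        rw [← chainEnd_of_nxt_ne_zero hc₃] at w1 w2 w3
        refine Runs.seq (Runs.put (by simp [h₁.r3]; omega) (by simp [h₁.r3]; omega) ?_)
        refine Runs.seq (Runs.put (by simp [h₁.r3]; omega) (by simp [h₁.r3]; omega) ?_)
        refine Runs.put (by simp [h₁.r3]; omega) (by simp [h₁.r3]; omega) ?_
        refine fin _ (((hF₃.setFld (by decide) (by rw [hK']; simp) _).setFld (by decide)
          (by rw [hK']; simp) _).setFld (by decide) (by rw [hK']; simp) _) (by simp) ?_ ?_ ?_
        · simp [fld_setFld, w1]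
        · simp [fld_setFld, w2]
        · simp [fld_setFld, w3]
      · simp at hc₃
        obtain ⟨w2, w3⟩ := hcf k (by omega) (by omega) (by omega)
        rw [← hF.fld _ (by decide) _ (hGn _ (by decide) _)] at w2 w3
        have hce := chainEnd_of_nxt_eq_zero hc₃
        refine Runs.seq (Runs.put (by simp [h₁.r3]; omega) (by simp) ?_)
        refine Runs.seq (Runs.put (by simp [h₁.r3]; omega) (by simp [h₁.r3]; omega) ?_)
        refine Runs.put (by simp [h₁.r3]; omega) (by simp [h₁.r3]; omega) ?_
        refine fin _ (((hF₃.setFld (by decide) (by rw [hK']; simp) _).setFld (by decide)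
          (by rw [hK']; simp) _).setFld (by decide) (by rw [hK']; simp) _) (by simp) ?_ ?_ ?_
        · simp [fld_setFld, hce]
        · simp [fld_setFld, hce, w2]
        · simp [fld_setFld, hce, w3]
  · rintro s₁ ⟨hF, hle, hm⟩ hc
    have e13 := hF.reg 13 (by decide)
    rw [r13] at e13
    simp [e13] at hc
    exact ⟨hF, fun k h1 h2 => hm k h1 (by omega) h2⟩

end Blocks

/-! ### Stored counts for the suffix, chain ends for the prefix, and the whole step for a
concatenation -/

section Blocks

variable {W b : ℕ} {s s₀ : State} {F : ℕ → ℕ → Prop} {Q : State → Prop} {p : Prog}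
variable {n q V i a c I L R O : ℕ} {x y z : ℕ → ℕ}

/-- Compute `count` and `final` for the last positions of the string. -/
def suffixProg : Prog :=
  .for (.reg 1 - 1) (Expr.min (3 * .reg 1) (.reg 7))
    (.cond ((Expr.reg 6 + .reg 15).lt (.reg 7 - .reg 20))
      (.assign 25 (.arr 4 (.reg 10 + .reg 20)) ;; .assign 26 (.arr 3 (.reg 10 + .reg 20)) ;;
        liftProg ;; .put 3 (.reg 8 + .reg 20) (.reg 26) ;; .put 4 (.reg 8 + .reg 20) (.reg 25))
      (.put 3 (.reg 8 + .reg 20) (.arr 10 (.reg 7 - .reg 20)) ;;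
        .put 4 (.reg 8 + .reg 20) (.arr 11 (.reg 7 - .reg 20))))

/-- Positions beyond `a + 2q - 2` lie in `X_r` and are lifted from its table; the others are near
enough to the boundary to be in the window arrays, even if `X_r` is short. -/
theorem runs_suffixProg (hd : Dims W b n q V i a c I L R O) (h : Ctx n q V i a c I L R O s)
    (hy : Table q c y fun f t => s.fld f (R + t)) (hzy : CopyOf z y a c)
    (hcf : ∀ k, a - 3 * q < k → k + 2 ≤ a + 2 * q → k + q ≤ a + c + 1 →
        s.fld 10 k = count z q k ∧ s.fld 11 k = final z q k) :
    Runs W b suffixProg (fun s' =>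
      Frame (fun f t => (f = 3 ∨ f = 4) ∧ I ≤ t ∧ t < I + 4 * q) s s' ∧
      ∀ p, q ≤ p + 1 → p < 3 * q → p < a + c → s'.fld 3 (I + p) = count z q (a + c - p) ∧
        s'.fld 4 (I + p) = final z q (a + c - p)) s := by
  have hd' := hd
  obtain ⟨d1, d2, d3, d4, d5, d6, d7, d8, d9, d10, d11, d12, d13⟩ := hd
  refine Runs.for (lo := q - 1) (hi := min (3 * q) (a + c)) [3, 4] (fun p => I + p)
    (fun f p => if f = 3 then count z q (a + c - p) else final z q (a + c - p))
    ?_ ?_ ?_ ?_ ?_ ?_ ?_ ?_ ?_ ?_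
  · simp
  · simp; omega
  · simp [h.r1]
  · simp [h.r1]; omega
  · simp [h.r1, h.r7]
  · omega
  · omega
  · intro k m _ _ _ _ hkm
    omega
  · intro k s' hk hk' r20 hF hm
    have h' := h.of_frame hF
    have hcf' : ∀ k, a - 3 * q < k → k + 2 ≤ a + 2 * q → k + q ≤ a + c + 1 →
        s'.fld 10 k = count z q k ∧ s'.fld 11 k = final z q k := by
      intro k k1 k2 k3
      rw [hF.fld 10 (by decide) _ (by simp), hF.fld 11 (by decide) _ (by simp)]
      exact hcf k k1 k2 k3
    refine Runs.cond (by simp [h'.r6, h'.r15]; omega) (fun hc => ?_) (fun hc => ?_)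
    · simp [r20, h'.r6, h'.r15, h'.r7] at hc
      have e4 := hy.count k (by omega) (by omega) (by omega)
      have e5 := hy.final k (by omega) (by omega) (by omega)
      beta_reduce at e4 e5
      rw [← hF.fld _ (by decide) _ (by rintro ⟨-, m, -, hm, he⟩; omega)] at e4 e5
      refine Runs.seq (Runs.assign (by simp [h'.r10, h'.r3, r20]; omega) ?_)
      refine Runs.seq (Runs.assign (by simp [h'.r10, h'.r3, r20]; omega) ?_)
      simp only [den_arr, den_add, den_reg, reg_setReg, Nat.reduceEqDiff, if_false, r20, h'.r10,
        fld_setReg (show 25 ≠ 3 by decide)]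
      refine Runs.seq (runs_liftProg (k := c - k) hd'
        ((h'.setReg (x := 25) (by omega) _).setReg (x := 26) (by omega) _) hzy ?_ (by omega)
        (by omega) (by simp [e5]) (by simp [e4]) ?_)
      · simp only [fld_setReg (show 25 ≠ 3 by decide), fld_setReg (show 26 ≠ 3 by decide)]
        exact hcf'
      rw [← Nat.add_sub_assoc (by omega)]
      refine Runs.seq (Runs.put (by simp [h'.r8, h'.r3, r20]; omega) (by simp) ?_)
      refine Runs.put (by simp [h'.r8, h'.r3, r20]; omega) (by simp) ?_
      refine ⟨by simp [r20], by simp, ?_, ?_⟩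
      · refine ((((((Frame.refl _ _).setReg (by omega) _).setReg (by omega) _).setReg
          (by omega) _).setReg (by omega) _).setFld (by decide) ?_ _).setFld (by decide) ?_ _ <;>
        simp [h'.r8, r20]
      · simp [fld_setFld, h'.r8, r20]
    · simp [r20, h'.r6, h'.r15, h'.r7] at hc
      obtain ⟨e1, e2⟩ := hcf' (a + c - k) (by omega) (by omega) (by omega)
      refine Runs.seq (Runs.put (by simp [h'.r8, h'.r3, r20]; omega)
        (by simp [h'.r7, h'.r3, r20]; omega) ?_)
      refine Runs.put (by simp [h'.r8, h'.r3, r20]; omega) (by simp [h'.r7, h'.r3, r20]; omega) ?_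
      refine ⟨by simp, by simp, ?_, ?_⟩
      · refine ((Frame.refl _ _).setFld (by decide) ?_ _).setFld (by decide) ?_ _ <;>
        simp [h'.r8, r20]
      · simp [fld_setFld, h'.r8, h'.r7, r20, e1, e2]
  · intro s₁ hF₁ h₁
    refine ⟨hF₁.mono ?_, fun k hk hk' hk'' => ?_⟩
    · rintro f u ⟨hf, m, h1, h2, rfl⟩
      simp at hf
      omega
    · have := h₁ k (by omega) (by omega)
      simpa using this

/-- Copy the entries around the boundary at the position in register `24`. -/
def copyEndProg : Prog :=
  .put 5 (.reg 8 + .reg 20) (.arr 12 (.reg 24)) ;;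
  .put 6 (.reg 8 + .reg 20) (.arr 13 (.reg 24)) ;;
  .put 7 (.reg 8 + .reg 20) (.arr 14 (.reg 24))

/-- Compute the ends of the chains that start at the first positions of the string. -/
def prefixProg : Prog :=
  .for 1 (Expr.min (.reg 1 - 1) (.reg 7 + 1 - .reg 1) + 1)
    (.cond ((Expr.reg 20 + .reg 1).lt (.reg 6 + 2))
      (.cond ((Expr.arr 5 (.reg 9 + .reg 20)).lt (.reg 13))
        (.put 5 (.reg 8 + .reg 20) (.arr 5 (.reg 9 + .reg 20)) ;;
          .put 6 (.reg 8 + .reg 20) (.arr 6 (.reg 9 + .reg 20)) ;;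
          .put 7 (.reg 8 + .reg 20) (.arr 7 (.reg 9 + .reg 20)))
        (.assign 24 (.arr 5 (.reg 9 + .reg 20)) ;; copyEndProg))
      (.assign 24 (.reg 20) ;; copyEndProg))

/-- For a `q`-gram inside `X_l`, let `m` be its chain end there. If `m` is below the boundary
region, the chain also ends at `m` in `X_i` (`CopyOf.chainEnd_eq_self`); otherwise it continues from
`m`, whose entry is in the window arrays. A `q`-gram not inside `X_l` starts in the boundary region
itself. -/
theorem runs_prefixProg (hd : Dims W b n q V i a c I L R O) (h : Ctx n q V i a c I L R O s)
    (hx : Table q a x fun f t => s.fld f (L + t)) (hzx : CopyOf z x 0 a)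
    (hw : ∀ k, max 1 (a + 3 - 2 * q) ≤ k → k < min (a + q) (a + c + 2 - q) →
        s.fld 12 k = chainEnd z q (a + c) k ∧
        s.fld 13 k = count z q (chainEnd z q (a + c) k) ∧
        s.fld 14 k = final z q (chainEnd z q (a + c) k)) :
    Runs W b prefixProg (fun s' =>
      Frame (fun f t => (f = 5 ∨ f = 6 ∨ f = 7) ∧ I ≤ t ∧ t < I + 4 * q) s s' ∧
      ∀ j, 1 ≤ j → j < q → j + q ≤ a + c + 1 →
        s'.fld 5 (I + j) = chainEnd z q (a + c) j ∧
        s'.fld 6 (I + j) = count z q (chainEnd z q (a + c) j) ∧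
        s'.fld 7 (I + j) = final z q (chainEnd z q (a + c) j)) s := by
  obtain ⟨d1, d2, d3, d4, d5, d6, d7, d8, d9, d10, d11, d12, d13⟩ := hd
  refine Runs.for (lo := 1) (hi := min (q - 1) (a + c + 1 - q) + 1) [5, 6, 7] (fun p => I + p)
    (fun f j => if f = 5 then chainEnd z q (a + c) j else
      if f = 6 then count z q (chainEnd z q (a + c) j) else final z q (chainEnd z q (a + c) j))
    ?_ ?_ ?_ ?_ ?_ ?_ ?_ ?_ ?_ ?_
  · simp
  · simp; omega
  · simp
  · simp [h.r1, h.r7]; omega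
  · simp [h.r1, h.r7]
  · omega
  · omega
  · intro k m _ _ _ _ hkm
    omega
  · intro k s' hk hk' r20 hF hm
    have h' := h.of_frame hF
    have copy : ∀ m, max 1 (a + 3 - 2 * q) ≤ m → m < min (a + q) (a + c + 2 - q) →
        chainEnd z q (a + c) m = chainEnd z q (a + c) k →
        Runs W b copyEndProg (fun s'' => s''.reg 20 = s'.reg 20 ∧ s''.reg 21 = s'.reg 21 ∧
        Frame (fun f u => f ∈ [5, 6, 7] ∧ u = I + k) s' s'' ∧
        ∀ f ∈ [5, 6, 7], s''.fld f (I + k) = if f = 5 then chainEnd z q (a + c) k else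
          if f = 6 then count z q (chainEnd z q (a + c) k) else
            final z q (chainEnd z q (a + c) k)) (s'.setReg 24 m) := by
      intro m m1 m2 me
      obtain ⟨w1, w2, w3⟩ := hw m m1 m2
      rw [← hF.fld _ (by decide) _ (by simp), me] at w1 w2 w3
      refine Runs.seq (Runs.put (by simp [h'.r8, h'.r3, r20]; omega)
        (by simp [h'.r3]; omega) ?_)
      refine Runs.seq (Runs.put (by simp [h'.r8, h'.r3, r20]; omega)
        (by simp [h'.r3]; omega) ?_)
      refine Runs.put (by simp [h'.r8, h'.r3, r20]; omega) (by simp [h'.r3]; omega) ?_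
      refine ⟨by simp, by simp, ?_, ?_⟩
      · refine ((((Frame.refl _ _).setReg (by omega) _).setFld (by decide) ?_ _).setFld
          (by decide) ?_ _).setFld (by decide) ?_ _ <;> simp [h'.r8, r20]
      · simp [fld_setFld, h'.r8, r20, w1, w2, w3]
    refine Runs.cond (by simp [h'.r1, h'.r6, r20]; omega) (fun hc => ?_) (fun hc => ?_)
    · simp [r20, h'.r1, h'.r6] at hc
      have t5 := hx.endPos k (by omega) (by omega) (by omega)
      have t6 := hx.endCount k (by omega) (by omega) (by omega)
      have t7 := hx.endFinal k (by omega) (by omega) (by omega)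
      beta_reduce at t5 t6 t7
      rw [← hF.fld _ (by decide) _ (by rintro ⟨-, m, -, hm, he⟩; omega)] at t5 t6 t7
      obtain ⟨c1, c2, c3⟩ := chainEnd_spec (x := x) (q := q) (L := a) (k := k) (by omega)
      have hce := hzx.chainEnd_prefix (q := q) (L := a + c) (k := k) (by omega) (by omega)
      refine Runs.cond (by simp [h'.r9, h'.r3, r20]; omega) (fun hc₂ => ?_) (fun hc₂ => ?_)
      · simp [r20, h'.r9, h'.r13, t5] at hc₂
        rw [hzx.chainEnd_eq_self (by omega) (by omega) c3] at hce
        obtain ⟨u1, u2⟩ := hzx.count_final_prefix (q := q) (k := chainEnd x q a k) (by omega)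
          (by omega) (by omega)
        rw [← u1] at t6
        rw [← u2] at t7
        refine Runs.seq (Runs.put (by simp [h'.r8, h'.r3, r20]; omega)
          (by simp [h'.r9, h'.r3, r20]; omega) ?_)
        refine Runs.seq (Runs.put (by simp [h'.r8, h'.r3, r20]; omega)
          (by simp [h'.r9, h'.r3, r20]; omega) ?_)
        refine Runs.put (by simp [h'.r8, h'.r3, r20]; omega)
          (by simp [h'.r9, h'.r3, r20]; omega) ?_
        refine ⟨by simp, by simp, ?_, ?_⟩
        · refine (((Frame.refl _ _).setFld (by decide) ?_ _).setFld
            (by decide) ?_ _).setFld (by decide) ?_ _ <;> simp [h'.r8, r20]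
        · simp [fld_setFld, h'.r8, h'.r9, r20, t5, t6, t7, hce]
      · simp [r20, h'.r9, h'.r13, t5] at hc₂
        refine Runs.seq (Runs.assign (by simp [h'.r9, h'.r3, r20]; omega) ?_)
        simp only [den_arr, den_add, den_reg, r20, h'.r9, t5]
        have := copy _ (by omega) (by omega) hce
        rwa [r20] at this
    · simp [r20, h'.r1, h'.r6] at hc
      refine Runs.seq (Runs.assign (by simp) ?_)
      simp only [den_reg]
      have := copy k (by omega) (by omega) rfl
      rwa [← r20] at this ⊢
  · intro s₁ hF₁ h₁
    refine ⟨hF₁.mono ?_, fun k hk hk' hk'' => ?_⟩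
    · rintro f u ⟨hf, m, h1, h2, rfl⟩
      simp at hf
      omega
    · have := h₁ k (by omega) (by omega)
      simpa using this

/-- Compute all entries for a variable `X_i = X_l X_r`. -/
def concatProg : Prog :=
  textProg ;; windowProg ;; matchProg ;; countProg ;; chainProg ;; suffixProg ;; prefixProg

/-- The array entries and memory cells that are modified when a variable is processed. -/
def Touched (q i I O : ℕ) (f t : ℕ) : Prop :=
  f = 0 ∧ t = i ∨ 1 ≤ f ∧ f ≤ 7 ∧ I ≤ t ∧ t < I + 4 * q ∨ 8 ≤ f ∧ f ≤ 15 ∨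
    f = 16 ∧ O ≤ t ∧ t < O + 3 * q

theorem Table.congr {g g' : ℕ → ℕ → ℕ} {len : ℕ} (h : Table q len x g)
    (hg : ∀ f t, 1 ≤ f → f ≤ 7 → t < 4 * q → g' f t = g f t) (hq : 1 ≤ q) :
    Table q len x g' := by
  constructor
  · intro p h1 h2 h3
    rw [hg _ _ (by omega) (by omega) (by omega), h.pre p h1 h2 h3]
  · intro p h1 h2
    rw [hg _ _ (by omega) (by omega) (by omega), h.suf p h1 h2]
  · intro p h1 h2 h3
    rw [hg _ _ (by omega) (by omega) (by omega), h.count p h1 h2 h3]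
  · intro p h1 h2 h3
    rw [hg _ _ (by omega) (by omega) (by omega), h.final p h1 h2 h3]
  · intro p h1 h2 h3
    rw [hg _ _ (by omega) (by omega) (by omega), h.endPos p h1 h2 h3]
  · intro p h1 h2 h3
    rw [hg _ _ (by omega) (by omega) (by omega), h.endCount p h1 h2 h3]
  · intro p h1 h2 h3
    rw [hg _ _ (by omega) (by omega) (by omega), h.endFinal p h1 h2 h3]

/-- Tables of earlier variables occupy blocks below `I` and are therefore untouched. -/
theorem Table.of_frame {s' : State} {len J : ℕ} (h : Table q len x fun f t => s.fld f (J + t))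
    (hF : Frame (Touched q i I O) s s') (hJ : J + 4 * q ≤ I) (hq : 1 ≤ q) :
    Table q len x fun f t => s'.fld f (J + t) := by
  refine h.congr (fun f t h1 h2 h3 => hF.fld f (by omega) _ ?_) hq
  rintro (h4 | h4 | h4 | h4) <;> omega

theorem runs_concatProg (hd : Dims W b n q V i a c I L R O) (h : Ctx n q V i a c I L R O s)
    (hx : Table q a x fun f t => s.fld f (L + t)) (hy : Table q c y fun f t => s.fld f (R + t))
    (hzx : CopyOf z x 0 a) (hzy : CopyOf z y a c) :
    Runs W b concatProg (fun s' => Frame (Touched q i I O) s s' ∧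
      (Table q (a + c) z fun f t => s'.fld f (I + t)) ∧
      ∀ k, max 1 (a + 3 - 2 * q) ≤ k → k < min (a + q) (a + c + 2 - q) →
        s'.mem (O + (k - max 1 (a + 3 - 2 * q))) = count z q (chainEnd z q (a + c) k)) s := by
  have dims := hd
  obtain ⟨d1, d2, d3, d4, d5, d6, d7, d8, d9, d10, d11, d12, d13⟩ := dims
  refine Runs.seq ((runs_textProg hd h hx hy hzx hzy).mono ?_)
  rintro s₁ ⟨F₁, p₁, p₂⟩
  have G₁ : Frame (Touched q i I O) s s₁ := F₁.mono fun f t ht => by unfold Touched; omega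
  refine Runs.seq ((runs_windowProg hd (h.of_frame G₁) (hx.of_frame G₁ (by omega) (by omega))
    (hy.of_frame G₁ (by omega) (by omega)) hzx hzy).mono ?_)
  rintro s₂ ⟨F₂, w₂⟩
  have G₂ := G₁.trans (F₂.mono (G := Touched q i I O) fun f t ht => by unfold Touched; omega)
  refine Runs.seq ((runs_matchProg hd (h.of_frame G₂) w₂).mono ?_)
  rintro s₃ ⟨F₃, p, l₃⟩
  have G₃ := G₂.trans (F₃.mono (G := Touched q i I O) fun f t ht => by unfold Touched; omega)
  refine Runs.seq ((runs_countProg hd (h.of_frame G₃) (hx.of_frame G₃ (by omega) (by omega)) hzx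
    fun k k1 k2 k3 k4 => l₃.prv_eq (by omega) k1 (by omega) (by omega) (by omega)).mono ?_)
  rintro s₄ ⟨F₄, c₄⟩
  have G₄ := G₃.trans (F₄.mono (G := Touched q i I O) fun f t ht => by unfold Touched; omega)
  refine Runs.seq ((runs_chainProg hd (h.of_frame G₄) (hy.of_frame G₄ (by omega) (by omega)) hzy
    (fun k k1 k2 k3 => ?_) c₄).mono ?_)
  · rw [F₄.fld 15 (by decide) _ (by omega)]
    exact l₃.nxt_eq (by omega) (by omega) (by omega) (by omega)
  rintro s₅ ⟨F₅, e₅⟩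
  have G₅ := G₄.trans (F₅.mono (G := Touched q i I O) fun f t ht => by unfold Touched; omega)
  refine Runs.seq ((runs_suffixProg hd (h.of_frame G₅) (hy.of_frame G₅ (by omega) (by omega)) hzy
    fun k k1 k2 k3 => ?_).mono ?_)
  · rw [F₅.fld 10 (by decide) _ (by omega), F₅.fld 11 (by decide) _ (by omega)]
    exact c₄ k k1 k2 k3
  rintro s₆ ⟨F₆, s₆'⟩
  have G₆ := G₅.trans (F₆.mono (G := Touched q i I O) fun f t ht => by unfold Touched; omega)
  refine (runs_prefixProg hd (h.of_frame G₆) (hx.of_frame G₆ (by omega) (by omega)) hzx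
    fun k k1 k2 => ?_).mono ?_
  · rw [F₆.fld 12 (by decide) _ (by omega), F₆.fld 13 (by decide) _ (by omega),
      F₆.fld 14 (by decide) _ (by omega)]
    obtain ⟨e1, e2, e3, -⟩ := e₅ k k1 k2
    exact ⟨e1, e2, e3⟩
  rintro s₇ ⟨F₇, s₇'⟩
  have G₇ := G₆.trans (F₇.mono (G := Touched q i I O) fun f t ht => by unfold Touched; omega)
  have old : ∀ f ≤ 2, 1 ≤ f → ∀ t, s₇.fld f t = s₁.fld f t := by
    intro f hf hf' t
    rw [F₇.fld f (by omega) _ (by omega), F₆.fld f (by omega) _ (by omega),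
      F₅.fld f (by omega) _ (by omega), F₄.fld f (by omega) _ (by omega),
      F₃.fld f (by omega) _ (by omega), F₂.fld f (by omega) _ (by omega)]
  refine ⟨G₇, ⟨fun p h1 h2 h3 => ?_, fun p h1 h2 => ?_, fun p h1 h2 h3 => ?_,
    fun p h1 h2 h3 => ?_, fun j h1 h2 h3 => (s₇' j h1 h2 h3).1,
    fun j h1 h2 h3 => (s₇' j h1 h2 h3).2.1,
    fun j h1 h2 h3 => (s₇' j h1 h2 h3).2.2⟩, fun k k1 k2 => ?_⟩
  · rw [old _ (by omega) (by omega)]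
    exact p₁ p h1 h2 h3
  · rw [old _ (by omega) (by omega)]
    exact p₂ p h1 h2
  · rw [F₇.fld _ (by omega) _ (by omega)]
    exact (s₆' p h1 h2 h3).1
  · rw [F₇.fld _ (by omega) _ (by omega)]
    exact (s₆' p h1 h2 h3).2
  · have hr : O + (k - max 1 (a + 3 - 2 * q)) < 3 * n + 3 * V := by omega
    rw [F₇.low _ (by rw [(h.of_frame G₆).r3]; exact hr) (by omega),
      F₆.low _ (by rw [(h.of_frame G₅).r3]; exact hr) (by omega)]
    exact (e₅ k k1 k2).2.2.2

end Blocks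

/-! ### The loop over all variables and the final bounds -/

section Main

variable {σ n q W b i : ℕ} {S : SLP σ n} {s s' : State}

theorem Runs.assign_eq {x v : ℕ} {e : Expr} {Q : State → Prop} (he : e.Ok W s)
    (hv : e.den s = v) (h : Q (s.setReg x v)) : Runs W b (.assign x e) Q s :=
  Runs.assign he (hv ▸ h)

theorem SLP.val_of_letter {i : Fin n} {a : Fin σ} (h : S.rule i = Rule.letter a) :
    S.val i = [a] := by
  rw [SLP.val]
  split
  · rename_i a' h'
    rw [h] at h'
    cases h'
    rfl
  · rename_i h'
    rw [h] at h'
    cases h'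

theorem SLP.val_of_pair {i l r : Fin n} (h : S.rule i = Rule.pair l r) :
    S.val i = S.val l ++ S.val r := by
  rw [SLP.val]
  split
  · rename_i h'
    rw [h] at h'
    cases h'
  · rename_i h'
    rw [h] at h'
    cases h'
    rfl

theorem SLP.len_of_pair {i l r : Fin n} (h : S.rule i = Rule.pair l r) :
    S.len i = S.len l + S.len r := by
  rw [SLP.len, S.val_of_pair h, List.length_append, SLP.len, SLP.len]

theorem SLP.len_pos (S : SLP σ n) (i : Fin n) : 1 ≤ S.len i := by
  induction i using WellFoundedLT.induction with
  | _ i ih =>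
    cases h : S.rule i with
    | letter a => rw [SLP.len, S.val_of_letter h, List.length_singleton]
    | pair l r =>
      have := ih l (S.lt_of_pair i l r h).1
      rw [S.len_of_pair h]
      omega

theorem SLP.len_le_maxLen (S : SLP σ n) (i : Fin n) : S.len i ≤ S.maxLen :=
  Finset.le_sup (Finset.mem_univ i)

/-- The first `i` variables have been processed. -/
structure Done (S : SLP σ n) (q i : ℕ) (s : State) : Prop where
  r0 : s.reg 0 = n
  r1 : s.reg 1 = q
  r2 : s.reg 2 = i
  r3 : s.reg 3 = 3 * n + 3 * (q * n)
  r15 : s.reg 15 = 2 * q - 2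
  le : i ≤ n
  input : ∀ a < 3 * n, s.mem a = (initState S q).mem a
  len : ∀ v : Fin n, v < i → s.fld 0 v = S.len v
  table : ∀ v : Fin n, v < i →
    Table q (S.len v) (text (S.val v)) fun f t => s.fld f (v * (4 * q) + t)
  out : ∀ v l r : Fin n, v < i → S.rule v = Rule.pair l r →
    ∀ k, max 1 (S.len l + 3 - 2 * q) ≤ k → k < min (S.len l + q) (S.len v + 2 - q) →
      s.mem (3 * n + 3 * q * v + (k - max 1 (S.len l + 3 - 2 * q))) =
        count (text (S.val v)) q (chainEnd (text (S.val v)) q (S.len v) k)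

theorem Done.setReg (h : Done S q i s) {x : ℕ} (hx : 4 ≤ x) (hx' : x ≠ 15) (v : ℕ) :
    Done S q i (s.setReg x v) := by
  obtain ⟨h1, h2, h3, h4, h5, h6, h7, h8, h9, h10⟩ := h
  have e : ∀ f, (s.setReg x v).fld f = s.fld f := fld_setReg (by omega) v
  refine ⟨?_, ?_, ?_, ?_, ?_, h6, h7, ?_, ?_, h10⟩
  · rw [reg_setReg, if_neg (by omega), h1]
  · rw [reg_setReg, if_neg (by omega), h2]
  · rw [reg_setReg, if_neg (by omega), h3]
  · rw [reg_setReg, if_neg (by omega), h4]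
  · rw [reg_setReg, if_neg (by omega), h5]
  · simpa only [e] using h8
  · simpa only [e] using h9

/-- Blocks of `4q` table entries and `3q` output cells per variable are disjoint, so old results
survive and only those of `v` have to be supplied. -/
theorem Done.succ (h : Done S q i s) (hq : 1 ≤ q) {v : Fin n} (hv : (v : ℕ) = i)
    (hF : Frame (Touched q i (i * (4 * q)) (3 * n + 3 * q * i)) s s')
    (hlen : s'.fld 0 i = S.len v)
    (htable : Table q (S.len v) (text (S.val v)) fun f t => s'.fld f (i * (4 * q) + t))
    (hout : ∀ l r : Fin n, S.rule v = Rule.pair l r →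
      ∀ k, max 1 (S.len l + 3 - 2 * q) ≤ k → k < min (S.len l + q) (S.len v + 2 - q) →
        s'.mem (3 * n + 3 * q * i + (k - max 1 (S.len l + 3 - 2 * q))) =
          count (text (S.val v)) q (chainEnd (text (S.val v)) q (S.len v) k)) :
    Done S q (i + 1) (s'.setReg 2 (i + 1)) := by
  obtain ⟨h1, h2, h3, h4, h5, h6, h7, h8, h9, h10⟩ := h
  have e : ∀ f, (s'.setReg 2 (i + 1)).fld f = s'.fld f := fld_setReg (by omega) _
  have hi : i < n := hv ▸ v.2
  have e1 : ∀ u w : ℕ, u < w → u * (4 * q) + 4 * q ≤ w * (4 * q) := fun u w h => by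
    calc u * (4 * q) + 4 * q = (u + 1) * (4 * q) := by ring
      _ ≤ _ := Nat.mul_le_mul_right _ h
  have e2 : ∀ u w : ℕ, u < w → 3 * q * u + 3 * q ≤ 3 * q * w := fun u w h => by
    calc 3 * q * u + 3 * q = 3 * q * (u + 1) := by ring
      _ ≤ _ := Nat.mul_le_mul_left _ h
  have e3 : 3 * q * n = 3 * (q * n) := by ring
  have key : ∀ u : Fin n, u < i + 1 → u < i ∨ u = v := fun u hu => by
    rw [Fin.ext_iff, hv]
    omega
  refine ⟨?_, ?_, ?_, ?_, ?_, hi, fun a ha => ?_, fun u hu => ?_, fun u hu => ?_,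
    fun u l r hu hr k k1 k2 => ?_⟩
  · simp [hF.reg 0 (by decide), h1]
  · simp [hF.reg 1 (by decide), h2]
  · simp
  · simp [hF.reg 3 (by decide), h4]
  · simp [hF.reg 15 (by decide), h5]
  · rw [mem_setReg, hF.low a (by omega), h7 a ha]
    rintro (h | h | h | h) <;> omega
  · rw [e]
    rcases key u hu with hu | rfl
    · rw [hF.fld _ (by decide), h8 u hu]
      rintro (h | h | h | h) <;> omega
    · rw [hv, hlen]
  · simp only [e]
    rcases key u hu with hu | rfl
    · exact (h9 u hu).of_frame hF (e1 _ _ hu) hq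
    · rw [hv]
      exact htable
  · rw [mem_setReg]
    rcases key u hu with hu | rfl
    · have := e2 _ _ hu
      have := e2 _ _ hi
      rw [hF.low _ (by omega), h10 u l r hu hr k k1 k2]
      rintro (h | h | h | h) <;> omega
    · rw [hv]
      exact hout l r hr k k1 k2

/-- Set up the registers to process a variable `X_i = X_l X_r`. -/
def setupProg : Prog :=
  .assign 4 (.load (3 * .reg 2 + 1)) ;; .assign 5 (.load (3 * .reg 2 + 2)) ;;
  .assign 9 (.reg 4 * (4 * .reg 1)) ;; .assign 10 (.reg 5 * (4 * .reg 1)) ;;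
  .assign 6 (.arr 0 (.reg 4)) ;; .assign 17 (.arr 0 (.reg 5)) ;; .assign 7 (.reg 6 + .reg 17) ;;
  .assign 11 (.reg 6 - 3 * .reg 1) ;;
  .assign 12 (Expr.min (.reg 6 + 3 * .reg 1) (.reg 7)) ;;
  .assign 13 (Expr.max 1 (.reg 6 + 3 - 2 * .reg 1)) ;;
  .assign 14 (Expr.min (.reg 6 + .reg 1) (.reg 7 + 2 - .reg 1))

theorem runs_setupProg {I O a c lv rv : ℕ} {Q : State → Prop}
    (h : Done S q i s) (hI : s.reg 8 = I) (hO : s.reg 16 = O)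
    (hl : s.mem (3 * i + 1) = lv) (hr : s.mem (3 * i + 2) = rv)
    (ha : s.fld 0 lv = a) (hc : s.fld 0 rv = c)
    (hd : Dims W b n q (q * n) i a c I (lv * (4 * q)) (rv * (4 * q)) O) (hlv : lv < n)
    (hrv : rv < n)
    (hQ : ∀ s', Ctx n q (q * n) i a c I (lv * (4 * q)) (rv * (4 * q)) O s' → Done S q i s' →
      Q s') : Runs W b setupProg Q s := by
  obtain ⟨d1, d2, d3, d4, d5, d6, d7, d8, d9, d10, d11, d12, d13⟩ := hd
  have r1 := h.r1
  have r2 := h.r2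
  have r3 := h.r3
  have r15 := h.r15
  refine Runs.seq (Runs.assign_eq (v := lv) (by simp [r2]; omega) (by simp [r2, hl]) ?_)
  refine Runs.seq (Runs.assign_eq (v := rv) (by simp [r2]; omega) (by simp [r2, hr]) ?_)
  refine Runs.seq (Runs.assign_eq (v := lv * (4 * q)) (by simp [r1]; omega) (by simp [r1]) ?_)
  refine Runs.seq (Runs.assign_eq (v := rv * (4 * q)) (by simp [r1]; omega) (by simp [r1]) ?_)
  refine Runs.seq (Runs.assign_eq (v := a) (by simp [r3]; omega) (by simp [ha]) ?_)
  refine Runs.seq (Runs.assign_eq (v := c) (by simp [r3]; omega) (by simp [hc]) ?_)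
  refine Runs.seq (Runs.assign_eq (v := a + c) (by simp; omega) (by simp) ?_)
  refine Runs.seq (Runs.assign_eq (v := a - 3 * q) (by simp [r1]; omega) (by simp [r1]) ?_)
  refine Runs.seq (Runs.assign_eq (v := min (a + 3 * q) (a + c)) (by simp [r1]; omega)
    (by simp [r1]) ?_)
  refine Runs.seq (Runs.assign_eq (v := max 1 (a + 3 - 2 * q)) (by simp [r1]; omega)
    (by simp [r1]) ?_)
  refine Runs.assign_eq (v := min (a + q) (a + c + 2 - q)) (by simp [r1]; omega)
    (by simp [r1]) ?_
  refine hQ _ ⟨?_, ?_, ?_, ?_, ?_, ?_, ?_, ?_, ?_, ?_, ?_, ?_, ?_, ?_, ?_⟩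
    (((((((((((h.setReg ?_ ?_ _).setReg ?_ ?_ _).setReg ?_ ?_ _).setReg ?_ ?_ _).setReg
      ?_ ?_ _).setReg ?_ ?_ _).setReg ?_ ?_ _).setReg ?_ ?_ _).setReg ?_ ?_ _).setReg
      ?_ ?_ _).setReg ?_ ?_ _)
  all_goals simp [r1, r2, r3, r15, hI, hO]

/-- Compute all entries for a variable `X_i` that is a letter. -/
def letterProg : Prog :=
  .put 0 (.reg 2) 1 ;; .put 1 (.reg 8 + 1) (.load (3 * .reg 2 + 1)) ;;
    .put 2 (.reg 8) (.load (3 * .reg 2 + 1))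

/-- Process a variable. -/
def iterProg : Prog :=
  .assign 8 (.reg 2 * (4 * .reg 1)) ;; .assign 16 (3 * .reg 0 + 3 * .reg 1 * .reg 2) ;;
  .cond (.load (3 * .reg 2)) (setupProg ;; concatProg ;; .put 0 (.reg 2) (.reg 7)) letterProg ;;
  .assign 2 (.reg 2 + 1)

theorem code_eq {v : Fin n} {a m : ℕ} (ha : a = 3 * v + m) (hm : m < 3) :
    (initState S q).mem a = (S.rule v).code m := by
  have h1 : a / 3 = v := by omega
  have h2 : a % 3 = m := by omega
  have h3 : a / 3 < n := h1 ▸ v.2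
  have h4 : (⟨a / 3, h3⟩ : Fin n) = v := Fin.ext h1
  simp only [initState]
  rw [dif_pos h3, h4, h2]

theorem runs_iterProg (hq : 2 ≤ q) (hW : 1000 * (q * n + S.maxLen) ≤ W) (h : Done S q i s)
    (hi : i < n) : Runs W (10 * q) iterProg (Done S q (i + 1)) s := by
  obtain ⟨v, hv⟩ : ∃ v : Fin n, (v : ℕ) = i := ⟨⟨i, hi⟩, rfl⟩
  have e1 : ∀ u w : ℕ, u < w → u * (4 * q) + 4 * q ≤ w * (4 * q) := fun u w h => by
    calc u * (4 * q) + 4 * q = (u + 1) * (4 * q) := by ring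
      _ ≤ _ := Nat.mul_le_mul_right _ h
  have e2 : 3 * q * i + 3 * q ≤ 3 * q * n := by
    calc 3 * q * i + 3 * q = 3 * q * (i + 1) := by ring
      _ ≤ _ := Nat.mul_le_mul_left _ hi
  have e3 : 3 * q * n = 3 * (q * n) := by ring
  have e4 : n * (4 * q) = 4 * (q * n) := by ring
  have e5 := e1 _ _ hi
  have e6 : q ≤ q * n := Nat.le_mul_of_pos_right _ (by omega)
  have e7 : n ≤ q * n := Nat.le_mul_of_pos_left _ (by omega)
  have hlen := S.len_le_maxLen v
  have r0 := h.r0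
  have r1 := h.r1
  have r2 := h.r2
  have r3 := h.r3
  refine Runs.seq (Runs.assign_eq (v := i * (4 * q)) (by simp [r1, r2]; omega)
    (by simp [r1, r2]) ?_)
  refine Runs.seq (Runs.assign_eq (v := 3 * n + 3 * q * i) (by simp [r0, r1, r2]; omega)
    (by simp [r0, r1, r2]) ?_)
  replace h := (h.setReg (x := 8) (by decide) (by decide) (i * (4 * q))).setReg (x := 16)
    (by decide) (by decide) (3 * n + 3 * q * i)
  have r8 : ((s.setReg 8 (i * (4 * q))).setReg 16 (3 * n + 3 * q * i)).reg 8 = i * (4 * q) := by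
    simp
  have r16 : ((s.setReg 8 (i * (4 * q))).setReg 16 (3 * n + 3 * q * i)).reg 16 =
    3 * n + 3 * q * i := by simp
  generalize (s.setReg 8 (i * (4 * q))).setReg 16 (3 * n + 3 * q * i) = s at h r8 r16
  clear r0 r1 r2 r3
  have r2 := h.r2
  have r3 := h.r3
  have m0 := h.input (3 * i) (by omega)
  have m1 := h.input (3 * i + 1) (by omega)
  have m2 := h.input (3 * i + 2) (by omega)
  rw [code_eq (v := v) (m := 0) (by omega) (by omega)] at m0
  rw [code_eq (v := v) (m := 1) (by omega) (by omega)] at m1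
  rw [code_eq (v := v) (m := 2) (by omega) (by omega)] at m2
  have fin : ∀ s', Done S q (i + 1) (s'.setReg 2 (i + 1)) → s'.reg 2 = i →
      Runs W (10 * q) (.assign 2 (.reg 2 + 1)) (Done S q (i + 1)) s' := fun s' h' hr =>
    Runs.assign_eq (by simp [hr]; omega) (by simp [hr]) h'
  refine Runs.seq (Runs.cond (by simp [r2]; omega) (fun hc => ?_) (fun hc => ?_))
  · simp only [den_load, den_ofNat, den_mul, den_reg, r2, m0] at hc
    cases hr : S.rule v with
    | letter a => simp [hr, Rule.code] at hc
    | pair l r =>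
      rw [hr] at m1 m2
      simp only [Rule.code] at m1 m2
      obtain ⟨hl, hrv⟩ := S.lt_of_pair v l r hr
      rw [Fin.lt_def, hv] at hl hrv
      have hsum := S.len_of_pair hr
      have hd : Dims W (10 * q) n q (q * n) i (S.len l) (S.len r) (i * (4 * q)) (l * (4 * q))
          (r * (4 * q)) (3 * n + 3 * q * i) :=
        ⟨hq, rfl, e6, e7, hi, S.len_pos l, S.len_pos r, by omega, e1 _ _ hl, e1 _ _ hrv,
          by omega, by omega, by omega⟩
      refine Runs.seq (runs_setupProg h r8 r16 m1 m2 (h.len l hl) (h.len r hrv) hd l.2 r.2 ?_)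
      intro s₁ c₁ h₁
      refine Runs.seq ((runs_concatProg (x := text (S.val l)) (y := text (S.val r))
        (z := text (S.val v)) hd c₁ (h₁.table l hl) (h₁.table r hrv) ?_ ?_).mono ?_)
      · rw [S.val_of_pair hr]
        exact copyOf_append_left _ _
      · rw [S.val_of_pair hr]
        exact copyOf_append_right _ _
      rintro s₂ ⟨F₂, t₂, o₂⟩
      have c₂ := c₁.of_frame F₂
      refine Runs.put (by simp [c₂.r2, c₂.r3]; omega) (by simp) ?_
      simp only [den_reg, c₂.r2, c₂.r7]
      have F := F₂.setFld (f := 0) (t := i) (by decide) (.inl ⟨rfl, rfl⟩) (S.len l + S.len r)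
      refine fin _ (h₁.succ (by omega) hv F ?_ ?_ ?_) c₂.r2
      · simp [fld_setFld, hsum]
      · rw [hsum]
        refine t₂.congr (fun f t h1 h2 _ => ?_) (by omega)
        rw [fld_setFld (by decide) (by omega), if_neg (by omega)]
      · intro l' r' hr' k k1 k2
        rw [hr] at hr'
        cases hr'
        rw [hsum] at k2 ⊢
        rw [mem_setFld (by rw [c₂.r3]; omega)]
        exact o₂ k k1 k2
  · simp only [den_load, den_ofNat, den_mul, den_reg, r2, m0] at hc
    cases hr : S.rule v with
    | pair l r => simp [hr, Rule.code] at hc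
    | letter a =>
      rw [hr] at m1
      simp only [Rule.code] at m1
      have hval := S.val_of_letter hr
      have hone : S.len v = 1 := by rw [SLP.len, hval, List.length_singleton]
      refine Runs.seq (Runs.put (by simp [r2, r3]; omega) (by simp; omega) ?_)
      refine Runs.seq (Runs.put (by simp [r8, r3]; omega) (by simp [r2]; omega) ?_)
      refine Runs.put (by simp [r8, r3]; omega) (by simp [r2]; omega) ?_
      simp only [den_load, den_mul, den_reg, den_add, den_ofNat, reg_setFld, r2, r8]
      rw [mem_setFld (by simp [r3]; omega), mem_setFld (by simp [r3]; omega), m1]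
      refine fin _ (h.succ (by omega) hv ((((Frame.refl _ s).setFld (by decide) ?_ _).setFld
        (by decide) ?_ _).setFld (by decide) ?_ _) ?_ ?_ ?_) (by simp [r2])
      · exact .inl ⟨rfl, rfl⟩
      · exact .inr (.inl (by omega))
      · exact .inr (.inl (by omega))
      · simp [fld_setFld, hone]
      · rw [hone]
        -- A string of length 1 contains no `q`-gram, since `q ≥ 2`; only the two letter entries are
        -- not vacuous.
        constructor <;> intro p h1 h2 <;> try intro h3
        · obtain rfl : p = 1 := by omega
          simp [fld_setFld, hval, text]
        · obtain rfl : p = 0 := by omega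
          simp [fld_setFld, hval, text]
          rw [mem_setFld (by rw [r3]; omega), m1]
        all_goals omega
      · intro l r hr'
        rw [hr] at hr'
        cases hr'

/-- Prepare to process the first variable. -/
def initProg : Prog :=
  .assign 3 (3 * .reg 0 + 3 * (.reg 1 * .reg 0)) ;; .assign 15 (2 * .reg 1 - 2) ;; .assign 2 0

/-- Process all variables, for `q`-grams with `q ≥ 2`. -/
def mainProg : Prog :=
  .cond ((1 : Expr).lt (.reg 1))
    (initProg ;; .loop ((Expr.reg 2).lt (.reg 0)) iterProg ;; .assign 0 (3 * .reg 0))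
    .skip

theorem iterProg_time_le (hq : 1 ≤ q) :
    iterProg.time (10 * q) ≤ iterProg.time 1 * (100 * q ^ 2) := by
  have h := Prog.time_le (b := 10 * q) (by omega) iterProg
  have hd : iterProg.depth = 2 := by decide
  rw [hd] at h
  calc _ ≤ _ := h
    _ = _ := by ring

theorem fits_initState (S : SLP σ n) (hW : 1000 * (q * n + S.maxLen + σ) ≤ W) (hq : 1 ≤ q)
    (hn : 1 ≤ n) : Fits W (initState S q) := by
  have e6 : q ≤ q * n := Nat.le_mul_of_pos_right _ (by omega)
  have e7 : n ≤ q * n := Nat.le_mul_of_pos_left _ (by omega)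
  refine ⟨by omega, fun x => ?_, fun a => ?_⟩
  · simp only [initState]
    split_ifs <;> omega
  · simp only [initState]
    split_ifs with h
    · generalize S.rule ⟨a / 3, h⟩ = R
      generalize a % 3 = m
      unfold Rule.code
      split <;> omega
    · omega

theorem exec_loop_iterProg (hq : 2 ≤ q) (hW : 1000 * (q * n + S.maxLen) ≤ W) (h : Done S q 0 s)
    (hs : Fits W s) :
    ∃ s' t, Exec W (.loop ((Expr.reg 2).lt (.reg 0)) iterProg) s s' t ∧
      t ≤ 4 + n * (4 + iterProg.time 1 * (100 * q ^ 2)) ∧ Done S q n s' := by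
  have step : ∀ s, (∃ i, Done S q i s) → ((Expr.reg 2).lt (.reg 0)).den s ≠ 0 → Fits W s →
      ∃ s' t, Exec W iterProg s s' t ∧ t ≤ iterProg.time 1 * (100 * q ^ 2) ∧
        (∃ i, Done S q i s') ∧ n - s'.reg 2 < n - s.reg 2 := by
    rintro s ⟨i, h⟩ hc hs
    simp [h.r0, h.r2] at hc
    obtain ⟨s', t, h1, h2, h3⟩ := runs_iterProg hq hW h hc hs
    refine ⟨s', t, h1, h2.trans (iterProg_time_le (by omega)), ⟨_, h3⟩, ?_⟩
    rw [h3.r2, h.r2]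
    omega
  obtain ⟨s', t, h1, h2, ⟨i, h3⟩, h4⟩ := exec_loop _ _ (fun s _ => by simp) step ⟨0, h⟩ hs
  refine ⟨s', t, h1, ?_, ?_⟩
  · rw [h.r2, Nat.sub_zero] at h2
    exact h2
  · have := h3.le
    simp [h3.r0, h3.r2] at h4
    obtain rfl : i = n := by omega
    exact h3

theorem runs_initProg (hW : 1000 * (q * n) ≤ W) (hq : 2 ≤ q) (hn : 1 ≤ n) :
    Runs W 1 initProg (Done S q 0) (initState S q) := by
  have e6 : q ≤ q * n := Nat.le_mul_of_pos_right _ (by omega)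
  have e7 : n ≤ q * n := Nat.le_mul_of_pos_left _ (by omega)
  have r0 : (initState S q).reg 0 = n := rfl
  have r1 : (initState S q).reg 1 = q := rfl
  refine Runs.seq (Runs.assign (by simp [r0, r1]; omega) ?_)
  refine Runs.seq (Runs.assign (by simp [r1]; omega) ?_)
  refine Runs.assign (by simp) ?_
  refine ⟨by simp [r0], by simp [r1], by simp, by simp [r0, r1], by simp [r1], by omega,
    fun a _ => by simp, ?_, ?_, ?_⟩ <;> intros <;> omega

/-- The state `s'` is the one before the last assignment, which turns register `0` from `n` into the
start address of the output and so leaves `Done`. -/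
theorem exec_mainProg (S : SLP σ n) (hW : 1000 * (q * n + S.maxLen + σ) ≤ W) (hq : 1 ≤ q)
    (hn : 1 ≤ n) : ∃ s t, Exec W mainProg (initState S q) s t ∧
      t ≤ 50 + n * (4 + iterProg.time 1 * (100 * q ^ 2)) ∧
      (2 ≤ q → s.reg 0 = 3 * n ∧ ∃ s', s'.mem = s.mem ∧ Done S q n s') := by
  have hs := fits_initState S hW hq hn
  have e6 : q ≤ q * n := Nat.le_mul_of_pos_right _ (by omega)
  have e7 : n ≤ q * n := Nat.le_mul_of_pos_left _ (by omega)
  have r1 : (initState S q).reg 1 = q := rfl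
  have hc := hs.eval (e := (1 : Expr).lt (.reg 1)) (by simp; omega)
  by_cases h2 : 2 ≤ q
  · obtain ⟨s₁, t₁, x₁, l₁, h₁⟩ := runs_initProg (W := W) (S := S) (by omega) h2 hn hs
    obtain ⟨s₂, t₂, x₂, l₂, h₂⟩ := exec_loop_iterProg h2 (by omega) h₁ (x₁.fits hs)
    have hf := (x₂.fits (x₁.fits hs)).eval (e := 3 * .reg 0) (by simp [h₂.r0]; omega)
    have ht : initProg.time 1 ≤ 30 := by decide
    refine ⟨_, _, .cond_true hc (by simp [r1]; omega) (.seq x₁ (.seq x₂ (.assign hf))), ?_,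
      fun _ => ⟨by simp [h₂.r0], s₂, rfl, h₂⟩⟩
    simp only [show ((1 : Expr).lt (.reg 1)).cost = 3 from rfl,
      show ((3 : Expr) * .reg 0).cost = 3 from rfl]
    omega
  · refine ⟨_, _, .cond_false (hc.trans ?_) (.skip _), ?_, fun h => absurd h h2⟩
    · simp [r1]
      omega
    · simp only [show ((1 : Expr).lt (.reg 1)).cost = 3 from rfl]
      omega

theorem exists_prog_nOcc_loc : ∃ (P : Prog) (C : ℕ), ∀ (σ n q : ℕ) (S : SLP σ n), 1 ≤ n → 1 ≤ q →
    ∃ (s : State) (t : ℕ),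
      Exec (C * (S.maxLen + q * n + σ)) P (initState S q) s t ∧
      t ≤ C * (q ^ 2 * n) ∧
      ∀ i l r : Fin n, S.rule i = Rule.pair l r →
        ∀ j : ℕ, S.lo q l ≤ j → j ≤ S.hi q i l →
          s.mem (s.reg 0 + 3 * q * i + (j - S.lo q l)) =
            nOcc (substr (S.val i) (loc (S.val i) q j).1 (loc (S.val i) q j).2)
              (substr (S.val i) j (j + q - 1)) := by
  -- The `1000` serves the word bound and absorbs the additive terms `50 + 4 * n`; the factor `100`
  -- is `(10 * q) ^ 2` without `q ^ 2`.
  refine ⟨mainProg, 1000 + 100 * iterProg.time 1, fun σ n q S hn hq => ?_⟩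
  generalize hT : iterProg.time 1 = T
  obtain ⟨s, t, hx, ht, hd⟩ := exec_mainProg (W := (1000 + 100 * T) * (S.maxLen + q * n + σ)) S
    (by rw [show q * n + S.maxLen + σ = S.maxLen + q * n + σ by omega]
        exact Nat.mul_le_mul_right _ (by omega)) hq hn
  refine ⟨s, t, hx, ?_, fun i l r hr j hj hj' => ?_⟩
  · rw [hT] at ht
    have h1 : n ≤ q ^ 2 * n := Nat.le_mul_of_pos_left _ (Nat.pow_pos (by omega))
    calc t ≤ 50 + n * (4 + T * (100 * q ^ 2)) := ht
      _ = 50 + 4 * n + 100 * T * (q ^ 2 * n) := by ring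
      _ ≤ 1000 * (q ^ 2 * n) + 100 * T * (q ^ 2 * n) := by omega
      _ = _ := by ring
  · obtain ⟨b1, b2⟩ := boundary_bounds hq hj hj'
    simp only [SLP.lo, SLP.hi] at hj hj'
    -- For `q = 1` the range of `j` is empty, because no 1-gram crosses the boundary; so `2 ≤ q`
    -- here.
    obtain ⟨e0, s', hm, h⟩ := hd (by omega)
    have h2 := h.out i l r i.2 hr j (by omega) (by omega)
    rw [nOcc_loc_eq_count hq b1 (by omega), e0, ← hm, SLP.lo]
    rw [show S.len l + 1 - 2 * (q - 1) = S.len l + 3 - 2 * q by omega]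
    exact h2

end Main

end SLPNonOverlap

theorem mainTheorem5 :
    -- all values are computed by one word RAM program in total time `O(q² n)`
    (∃ (P : Prog) (C : ℕ), ∀ (σ n q : ℕ) (S : SLP σ n), 1 ≤ n → 1 ≤ q →
      ∃ (s : State) (t : ℕ),
        Exec (C * (S.maxLen + q * n + σ)) P (initState S q) s t ∧
        t ≤ C * (q ^ 2 * n) ∧
        ∀ i l r : Fin n, S.rule i = Rule.pair l r →
          ∀ j : ℕ, S.lo q l ≤ j → j ≤ S.hi q i l →
            s.mem (s.reg 0 + 3 * q * i + (j - S.lo q l)) =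
              nOcc (substr (S.val i) (loc (S.val i) q j).1 (loc (S.val i) q j).2)
                (substr (S.val i) j (j + q - 1))) ∧
    -- the count splits into a left, a middle and a right part
    (∀ (σ n q : ℕ) (S : SLP σ n), 1 ≤ q →
      ∀ i l r : Fin n, S.rule i = Rule.pair l r →
        ∀ j : ℕ, S.lo q l ≤ j → j ≤ S.hi q i l →
          ∀ (X s : List (Fin σ)) (b e eL bR u₁ u₂ : ℕ),
            X = S.val i → s = substr X j (j + q - 1) → (b, e) = loc X q j →
            eL = lastEnd (b - 1) q (shift (b - 1) (Occ (substr X b (min e (S.len l))) s)) →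
            bR = firstStart (e + 1)
              (shift (max b (S.len l + 1) - 1) (Occ (substr X (max b (S.len l + 1)) e) s)) →
            u₁ = lastEnd (b - 1) q (shift (b - 1) (LnOcc (substr X b eL) s)) →
            u₂ = firstStart (e + 1) (shift (bR - 1) (RnOcc (substr X bR e) s)) →
            nOcc (substr X b e) s =
              nOcc (substr X b eL) s + nOcc (substr X (u₁ + 1) (u₂ - 1)) s +
                nOcc (substr X bR e) s) :=
  ⟨exists_prog_nOcc_loc, fun σ n q S hq i l _ _ j h1 h2 =>
    nOcc_loc_split σ n q S hq i l j h1 h2⟩
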